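/- **Setting.** Let $\mathbb M^3_s$ be the space of symmetric real $3\times3$ matrices with inner product $\sigma\cdot\tau=\sum_{ij}\sigma_{ij}\tau_{ij}$, and $a\odot b=\frac12(a\otimes b+b\otimes a)$. Let $\mathsf A_0$ be a symmetric positive definite linear map on $\mathbb M^3_s$; let $\mathbb K_0\subset\mathbb M^3_s$ be closed and convex with $0$ in its interior, with support function $\mathrm H_{\mathbb K_0}(p)=\sup_{\sigma\in\mathbb K_0}\sigma\cdot p\in[0,\infty]$; let $\mathsf G_c,\ell,L>0$. Let $\mathsf k,\mathsf w\in C^2([0,1])$ satisfy $\mathsf k(0)=1$, $\mathsf k(1)=0$, $\mathsf w(0)=0$, $\mathsf w(1)=1$ and, on $(0,1)$, $\mathsf w'>0$, $\mathsf k'<0$, $\mathsf k''\ge0$, $\mathsf w''\ge0$. Put $c_{\mathsf w}=\int_0^1\sqrt{\mathsf w}$ and assume $c^*_{\mathsf w}=\int_0^1\mathsf w^{-1/2}<\infty$. Let $\mathbf s\in\mathbb M^3_s$ with $\mathbf s\cdot\mathbf s=1$ and $\sigma_c>0$ with $\sigma_c\mathbf s\in\partial\mathbb K_0$. Let $\mathbf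 n,\mathbf d_0$ be unit vectors with $\mathbf d_0\cdot\mathbf n\ge0$ such that $\mathbf n\odot\mathbf d_0$ belongs to the normal cone of $\mathbb K_0$ at $\sigma_c\mathbf s$. Let $\Omega_L$ be an open cube of side $L$ centred at the origin with a face normal to $\mathbf n$, and $\Gamma=\{x\in\Omega_L:x\cdot\mathbf n=0\}$. Put $$A^{\mathbf s}=\frac1{\mathsf A_0^{-1}\mathbf s\cdot\mathbf s},\quad \varepsilon_e=\frac{\sigma_c}{A^{\mathbf s}},\quad \ell_{\rm ch}=\frac{\mathsf G_cA^{\mathbf s}}{\sigma_c^2},\quad \rho_c=\inf_{\alpha\in(0,1)}\frac1{c_{\mathsf w}|\mathsf k'(\alpha)|}\frac{d}{d\alpha}\frac{\sqrt{\mathsf w(\alpha)}}{|\mathsf k'(\alpha)|}.$$ A *state* is a triple $(v,q,\beta)$ with $v\in BD(\Omega_L;\mathbb R^3)$, $q$ a finite $\mathbb M^3_s$-valued measure on $\Omega_L$ with $\varepsilon(v)-q\in L^2$ (where $\varepsilon(v)$ is the distributional symmetric gradient), and $\beta\in H^1(\Omega_L)$. Its energy is $$\mathcal E_\ell(v,q,\beta)=\int_{\Omega_L}\tfrac12\mathsf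 A_0(\varepsilon(v)-q)\cdot(\varepsilon(v)-q)\,dx+\int_{\Omega_L}\mathsf k(\beta)\,d\mathrm H_{\mathbb K_0}(q)+\frac{\mathsf G_c}{4c_{\mathsf w}}\int_{\Omega_L}\Big(\frac{\mathsf w(\beta)}\ell+\ell|\nabla\beta|^2\Big)dx\in[0,\infty],$$ where $\mathrm H_{\mathbb K_0}(q)=\mathrm H_{\mathbb K_0}(dq/d\mu)\,\mu$ for any positive $\mu$ dominating $q$, and $\beta$ is taken in its precise representative in the second integral. The state is *admissible at load $t$* if $L^{-3}\int_{\Omega_L}\mathbf s\cdot d\varepsilon(v)=t$ and there is $\bar\alpha\in[0,1]$ with $0\le\beta\le\bar\alpha$ a.e. in $\Omega_L$ and $\beta=\bar\alpha$ a.e. on $\Gamma$ (for the area measure, in the sense of precise representatives). A *localized response* at load $t$ is a state $(u_t,p_t,\alpha_t)$ of the following form, for some $\bar\alpha_t$ such that either $0<\bar\alpha_t<1$ and $$t=\mathsf k(\bar\alpha_t)\,\varepsilon_e+\frac{\mathsf G_c}{c_{\mathsf w}\sigma_cL}\frac{\sqrt{\mathsf w(\bar\alpha_t)}}{|\mathsf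 k'(\bar\alpha_t)|},$$ or $\bar\alpha_t=1$, $\mathsf k'(1)\ne0$ and $t\ge\dfrac{\mathsf G_c}{\sigma_cL}\dfrac1{c_{\mathsf w}|\mathsf k'(1)|}$. With $d_t$ defined by $t=\mathsf k(\bar\alpha_t)\varepsilon_e+\frac{d_t}{L}\,\mathbf s\mathbf n\cdot\mathbf d_0$, $$u_t(x)=\mathsf k(\bar\alpha_t)\sigma_c\,(\mathsf A_0^{-1}\mathbf s)\,x+d_t\mathbf 1_{\{x\cdot\mathbf n>0\}}\mathbf d_0,\qquad p_t=d_t\,(\mathbf n\odot\mathbf d_0)\,\mathcal H^2\llcorner\Gamma,$$ and $\alpha_t(x)=a(x\cdot\mathbf n)$, where $a(r)\in[0,\bar\alpha_t]$ is given by $|r|=\ell\int_{a(r)}^{\bar\alpha_t}\mathsf w^{-1/2}$ if $|r|\le\ell\int_0^{\bar\alpha_t}\mathsf w^{-1/2}$, and $a(r)=0$ otherwise. **Proposition (Optimality of the localized deformation response).** One has $\rho_c>0$. If $2\ell c^*_{\mathsf w}\le L$ and $L/\ell_{\rm ch}\le\rho_c$, then for every $t>\varepsilon_e$ a localized response at load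 $t$ exists, and every localized response at load $t$ is admissible at load $t$, has finite energy, and satisfies $$\mathcal E_\ell(u_t,p_t,\alpha_t)\le\mathcal E_\ell(v,q,\beta)$$ for all states $(v,q,\beta)$ admissible at load $t$. -/

import Mathlib

open MeasureTheory Set Filter Topology
open scoped ENNReal ContDiff

noncomputable section

namespace CohesivePF

/-- Three-dimensional Euclidean space. -/
abbrev V3 := EuclideanSpace ℝ (Fin 3)

/-! ### Symmetric second-order tensors -/

/-- The space of symmetric `3 × 3` real matrices, with its usual (entrywise) topology. -/
def symTensors : Submodule ℝ (Matrix (Fin 3) (Fin 3) ℝ) where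
  carrier := {M | M.IsSymm}
  add_mem' := fun ha hb => ha.add hb
  zero_mem' := Matrix.isSymm_zero
  smul_mem' := fun c _ ha => ha.smul c

/-- The type of symmetric second-order tensors. -/
abbrev M3s := ↥symTensors

/-- The inner product of symmetric tensors. -/
def ddot (σ τ : M3s) : ℝ := ∑ i, ∑ j, σ.1 i j * τ.1 i j

/-- The symmetrized tensor product of two vectors. -/
def symProd (a b : V3) : M3s :=
  ⟨Matrix.of fun i j => (a i * b j + b i * a j) / 2, by
    ext i j; simp only [Matrix.transpose_apply, Matrix.of_apply]; ring⟩

/-- `σ n · d`, the component along `d` of the vector `σ n`. -/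
def traction (σ : M3s) (n d : V3) : ℝ := ∑ i, ∑ j, σ.1 i j * n j * d i

/-- The normal cone to `K` at `σ`. -/
def normalCone (K : Set M3s) (σ : M3s) : Set M3s := {ν | ∀ τ ∈ K, 0 ≤ ddot (σ - τ) ν}

/-- The support function `sup_{σ ∈ K} σ · p`, which may take the value `∞`. It is only used for sets
`K` that contain `0`, for which the supremum is non-negative, so that truncating the negative values
of `σ · p` changes nothing. -/
def supportFun (K : Set M3s) (p : M3s) : ℝ≥0∞ := ⨆ σ ∈ K, ENNReal.ofReal (ddot σ p)

/-! ### Tensor-valued measures -/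

/-- Finite Borel measures on space with values in the symmetric tensors. -/
@[ext]
structure TensorMeasure where
  comp : Fin 3 → Fin 3 → SignedMeasure V3
  symm : ∀ i j, comp i j = comp j i

/-- The sum of the total variations of the components. It is equivalent to the total variation
measure, and every component is absolutely continuous with respect to it. -/
def TensorMeasure.dom (q : TensorMeasure) : Measure V3 := ∑ i, ∑ j, (q.comp i j).totalVariation

/-- The density of a tensor-valued measure `q` with respect to the measure `q.dom`. -/
def TensorMeasure.density (q : TensorMeasure) (x : V3) : M3s :=
  ⟨Matrix.of fun i j => (q.comp i j).rnDeriv q.dom x, by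
    ext i j; simp only [Matrix.transpose_apply, Matrix.of_apply]; rw [q.symm]⟩

/-! ### Weak derivatives -/

/-- Smooth scalar functions with compact support in `Ω`. -/
def IsTest (Ω : Set V3) (φ : V3 → ℝ) : Prop :=
  ContDiff ℝ ∞ φ ∧ HasCompactSupport φ ∧ tsupport φ ⊆ Ω

/-- The partial derivative in the `i`-th coordinate. -/
def partialD (i : Fin 3) (φ : V3 → ℝ) (x : V3) : ℝ := fderiv ℝ φ x (EuclideanSpace.single i 1)

/-- `g` is the weak gradient of `β` in `Ω`. -/
def IsWeakGradient (Ω : Set V3) (β : V3 → ℝ) (g : V3 → V3) : Prop :=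
  ∀ φ, IsTest Ω φ → ∀ i,
    ∫ x in Ω, β x * partialD i φ x = - ∫ x in Ω, g x i * φ x

/-- The measure `E` is the linearized strain `(∇u + ∇ᵀu)/2` of `u` in `Ω`, in the sense of
distributions. -/
def IsStrain (Ω : Set V3) (u : V3 → V3) (E : TensorMeasure) : Prop :=
  ∀ φ, IsTest Ω φ → ∀ i j,
    (E.comp i j).integral φ (ContinuousLinearMap.lsmul ℝ ℝ) =
      - ∫ x in Ω, (u x i * partialD j φ x + u x j * partialD i φ x) / 2

open Classical in
/-- The precise representative of a locally integrable function: the limit of its averages over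
small balls where this limit exists, and `0` elsewhere. -/
def preciseRep (β : V3 → ℝ) (x : V3) : ℝ :=
  if ∃ a, Tendsto (fun r => ⨍ y in Metric.ball x r, β y) (𝓝[>] (0 : ℝ)) (𝓝 a) then
    limUnder (𝓝[>] (0 : ℝ)) (fun r => ⨍ y in Metric.ball x r, β y)
  else 0

/-! ### The cube, the mid-plane and the constitutive functions -/

/-- The open cube of side `L` centred at the origin, with edges along the orthonormal basis `b`. -/
def cube (b : OrthonormalBasis (Fin 3) ℝ V3) (L : ℝ) : Set V3 := {x | ∀ i, |inner ℝ (b i) x| < L / 2}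

/-- The area measure of the mid-plane `Γ = {x ∈ cube b L | x · b 0 = 0}`, the image of the
two-dimensional Lebesgue measure of a square of side `L`. -/
def midPlaneArea (b : OrthonormalBasis (Fin 3) ℝ V3) (L : ℝ) : Measure V3 :=
  Measure.map (fun y : ℝ × ℝ => y.1 • b 1 + y.2 • b 2)
    ((volume : Measure (ℝ × ℝ)).restrict (Ioo (-(L / 2)) (L / 2) ×ˢ Ioo (-(L / 2)) (L / 2)))

/-- The derivative of a function on `[0, 1]` (one-sided at the end points). -/
def D01 (f : ℝ → ℝ) : ℝ → ℝ := derivWithin f (Icc 0 1)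

/-- The assumptions on the strength degradation function `k` and the dissipation potential `w`. -/
structure IsConstitutive (k w : ℝ → ℝ) : Prop where
  k_smooth : ContDiffOn ℝ 2 k (Icc 0 1)
  w_smooth : ContDiffOn ℝ 2 w (Icc 0 1)
  k_zero : k 0 = 1
  k_one : k 1 = 0
  w_zero : w 0 = 0
  w_one : w 1 = 1
  w_deriv : ∀ a ∈ Ioo (0 : ℝ) 1, 0 < D01 w a
  k_deriv : ∀ a ∈ Ioo (0 : ℝ) 1, D01 k a < 0
  k_convex : ∀ a ∈ Ioo (0 : ℝ) 1, 0 ≤ D01 (D01 k) a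
  w_convex : ∀ a ∈ Ioo (0 : ℝ) 1, 0 ≤ D01 (D01 w) a

/-- The normalization constant `c_w`. -/
def cW (w : ℝ → ℝ) : ℝ := ∫ a in (0 : ℝ)..1, √(w a)

/-- The normalization constant `c*_w`. -/
def cStar (w : ℝ → ℝ) : ℝ := ∫ a in (0 : ℝ)..1, 1 / √(w a)

/-- The critical ratio of the cube size to the elasto-cohesive length. -/
def rhoC (k w : ℝ → ℝ) : ℝ :=
  sInf ((fun a => 1 / (cW w * |D01 k a|) * D01 (fun x => √(w x) / |D01 k x|) a) '' Ioo (0 : ℝ) 1)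

/-- The data of the multiaxial model problem: stiffness, strength domain, constitutive functions,
toughness, regularization length, cube size, cube frame (its first vector is the normal `n` to the
mid-plane), loading direction, strength in that direction, and direction of the jump. -/
structure Problem where
  A : M3s ≃ₗ[ℝ] M3s
  K : Set M3s
  k : ℝ → ℝ
  w : ℝ → ℝ
  Gc : ℝ
  ℓ : ℝ
  L : ℝ
  b : OrthonormalBasis (Fin 3) ℝ V3
  s : M3s
  σc : ℝ
  d₀ : V3

namespace Problem

variable (P : Problem)

/-- The unit normal to the mid-plane. -/
def n : V3 := P.b 0

/-- The cube `Ω_L`. -/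
def Ω : Set V3 := cube P.b P.L

/-- The standing assumptions. The last two say that the loading direction `s` is compatible with a
displacement jump of direction `d₀` across a surface with normal `n`. -/
structure Standing : Prop where
  A_symm : ∀ σ τ, ddot (P.A σ) τ = ddot σ (P.A τ)
  A_pos : ∀ σ, σ ≠ 0 → 0 < ddot (P.A σ) σ
  K_closed : IsClosed P.K
  K_convex : Convex ℝ P.K
  K_zero : 0 ∈ interior P.K
  constitutive : IsConstitutive P.k P.w
  Gc_pos : 0 < P.Gc
  ℓ_pos : 0 < P.ℓ
  L_pos : 0 < P.L
  s_unit : ddot P.s P.s = 1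
  σc_pos : 0 < P.σc
  σc_mem : P.σc • P.s ∈ frontier P.K
  d₀_unit : ‖P.d₀‖ = 1
  d₀_open : 0 ≤ inner ℝ P.d₀ P.n
  normal : symProd P.n P.d₀ ∈ normalCone P.K (P.σc • P.s)

/-- The stiffness in the direction `s`: a uniform stress `σ s` produces, through the elastic law,
the strain `σ / stiffness` in the direction `s`. -/
def stiffness : ℝ := 1 / ddot (P.A.symm P.s) P.s

/-- The elasto-cohesive length in the direction `s`. -/
def cohesiveLength : ℝ := P.Gc * P.stiffness / P.σc ^ 2

/-- The elastic limit deformation in the direction `s`. -/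
def epsE : ℝ := P.σc / P.stiffness

/-! ### States and energy -/

/-- States `(u, p, α)` with `u` of bounded deformation, `p` a tensor-valued measure and `α` in `H¹`.
The remaining data are determined by these: the strain measure `E` of `u`, the square-integrable
elastic strain `e = E - p`, and the weak gradient `g` of `α`. -/
structure State where
  u : V3 → V3
  p : TensorMeasure
  α : V3 → ℝ
  E : TensorMeasure
  e : V3 → M3s
  g : V3 → V3
  u_integrable : IntegrableOn u P.Ω
  strain : IsStrain P.Ω u E
  p_carried : ∀ i j, (p.comp i j).restrict P.Ω = p.comp i j
  e_memLp : ∀ i j, MemLp (fun x => (e x).1 i j) 2 (volume.restrict P.Ω)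
  decomposition : ∀ i j, E.comp i j =
    (volume.restrict P.Ω).withDensityᵥ (fun x => (e x).1 i j) + p.comp i j
  α_memLp : MemLp α 2 (volume.restrict P.Ω)
  g_memLp : MemLp g 2 (volume.restrict P.Ω)
  gradient : IsWeakGradient P.Ω α g

/-- The phase-field energy. The integral of `k(α) H_K(p)` over the measure `p` is
`∫ k(α) H_K(dp/dμ) dμ`, which does not depend on the dominating measure `μ` since `H_K` is positively
homogeneous; `α` enters there through its precise representative, since `p` may charge sets of zero
volume. -/
def energy (z : P.State) : ℝ≥0∞ :=
  (∫⁻ x in P.Ω, ENNReal.ofReal (ddot (P.A (z.e x)) (z.e x) / 2)) +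
  (∫⁻ x in P.Ω, ENNReal.ofReal (P.k (preciseRep z.α x)) * supportFun P.K (z.p.density x) ∂z.p.dom) +
  (∫⁻ x in P.Ω, ENNReal.ofReal
    (P.Gc / (4 * cW P.w) * (P.w (z.α x) / P.ℓ + P.ℓ * ‖z.g x‖ ^ 2)))

/-- The constraint of average deformation `t` in the direction `s`. -/
def HasAverageStrain (t : ℝ) (z : P.State) : Prop :=
  1 / P.L ^ 3 * ∑ i, ∑ j, P.s.1 i j * z.E.comp i j P.Ω = t

/-- The phase field attains its maximum, a constant in `[0, 1]`, uniformly on the mid-plane. -/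
def MaxOnMidPlane (z : P.State) : Prop :=
  ∃ ā ∈ Icc (0 : ℝ) 1, (∀ᵐ x ∂volume.restrict P.Ω, 0 ≤ z.α x ∧ z.α x ≤ ā) ∧
    ∀ᵐ x ∂midPlaneArea P.b P.L, preciseRep z.α x = ā

/-! ### The localized response -/

/-- The load at which the maximal damage is `ā`, for `ā < 1`. -/
def loadOf (ā : ℝ) : ℝ :=
  P.k ā * P.epsE + P.Gc / (cW P.w * P.σc * P.L) * (√(P.w ā) / |D01 P.k ā|)

/-- `ā` is the maximal damage of the localized response at the load `t`: before complete failure it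
is related to `t` by `t = loadOf ā`, and it is `1` from the failure load
`Gc / (σc L) / (c_w |k'(1)|)` on; this load is finite only if `k'(1) ≠ 0`. -/
def IsMaxDamage (t ā : ℝ) : Prop :=
  (ā ∈ Ioo (0 : ℝ) 1 ∧ t = P.loadOf ā) ∨
  (ā = 1 ∧ D01 P.k 1 ≠ 0 ∧ P.Gc / (P.σc * P.L) * (1 / (cW P.w * |D01 P.k 1|)) ≤ t)

/-- The amplitude of the displacement jump, fixed by
`t = k(ā) epsE + (jump / L) (s n · d₀)`. -/
def jump (t ā : ℝ) : ℝ := P.L * (t - P.k ā * P.epsE) / traction P.s P.n P.d₀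

/-- The displacement: uniform strain `k(ā) σc A⁻¹ s` off the mid-plane, uniform jump along `d₀` on
it (and no superposed rigid displacement). -/
def locDisp (t ā : ℝ) (x : V3) : V3 :=
  WithLp.toLp 2 ((P.k ā * P.σc) • (P.A.symm P.s).1.mulVec (WithLp.ofLp x)) +
    (if 0 < inner ℝ P.n x then P.jump t ā else 0) • P.d₀

/-- The nonlinear strain: the measure `jump • (n ⊙ d₀)` on the mid-plane. -/
def locPlastic (t ā : ℝ) : TensorMeasure where
  comp i j := (midPlaneArea P.b P.L).withDensityᵥ
    (fun _ => P.jump t ā * (symProd P.n P.d₀).1 i j)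
  symm i j := by rw [← (symProd P.n P.d₀).2.apply i j]

/-- The profile `a` of the phase field, as a function of the coordinate along the normal. -/
def IsProfile (ā : ℝ) (a : ℝ → ℝ) : Prop :=
  ∀ x,
    (|x| ≤ P.ℓ * ∫ β in (0 : ℝ)..ā, 1 / √(P.w β) →
      a x ∈ Icc 0 ā ∧ |x| = P.ℓ * ∫ β in (a x)..ā, 1 / √(P.w β)) ∧
    (P.ℓ * ∫ β in (0 : ℝ)..ā, 1 / √(P.w β) ≤ |x| → a x = 0)

/-- `z` is the localized, crack-like response at the load `t`. -/
def IsLocalizedResponse (t : ℝ) (z : P.State) : Prop :=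
  ∃ ā a, P.IsMaxDamage t ā ∧ P.IsProfile ā a ∧
    z.u =ᵐ[volume.restrict P.Ω] P.locDisp t ā ∧
    z.p = P.locPlastic t ā ∧
    z.α =ᵐ[volume.restrict P.Ω] fun x => a (inner ℝ P.n x)

end Problem

end CohesivePF

end

namespace CohesivePF

/-! ### Derivatives on the unit interval -/

/-! The problem reduces to one real variable, the value `b` that a competitor's phase field takes on
the mid-plane. The function `redEnergy t b` bounds from below the energy of every competitor with
maximum `b` (`redEnergy_le_energy`). It is least at the maximal damage `ā` of a localized response
(`redEnergy_le`), and it equals the energy of that response there (`localized_energy`).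

The lower bound is a duality argument. With the uniform stress `κ s`, `κ = k(b) σc`, Fenchel's
inequality bounds the elastic density below by `κ s·e - κ² A⁻¹s·s / 2`. Since the phase field is at
most `b` and `k` decreases, and since `σc s` lies in `K`, the nonlinear energy is at least the
integral of `κ s·dp`. The two linear terms add up to `κ` times the total strain along `s`, which the
load fixes to `κ L³ t`.

For the phase-field energy the comparison object is the one-dimensional profile `a` with maximum
`b`, which satisfies `ℓ|a'| = √w(a)` and, inside its support, `2ℓ² a'' = w'(a)`. Convexity of `w`
and of the square bounds the density below by its linearization at `a` (`energy_density_le`). After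
integration by parts the linear terms live only on the mid-plane, where `a'` jumps but the
competitor equals the profile, and on the two faces normal to `n`, where `a'` vanishes because `2ℓ
c*_w ≤ L` lets the profile fit into the cube. What remains is the energy of the profile, `(Gc L² /
c_w) ∫₀ᵇ √w` (`phaseField_le`). A competitor in `H¹` is reached by mollification
(`le_integral_cube`).

The derivative of `redEnergy t` at `b` is `L³ σc |k'(b)| (loadOf b - t)`, and the size condition
`L/ℓ_ch ≤ ρ_c` makes `loadOf` nondecreasing. Hence the reduced energy decreases up to `ā` and
increases afterwards. All inequalities are equalities for the localized response: its stress is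
`k(ā) σc s`, the normal-cone condition makes `σc s` maximize `σ · (n ⊙ d₀)` over `K`, and its phase
field is the profile. Existence follows from the intermediate value theorem for `loadOf`. Finally
`ρ_c > 0` because integrability of `w^{-1/2}` forces `w'(0) > 0`. -/

theorem hasDerivWithinAt_D01 {f : ℝ → ℝ} (hf : ContDiffOn ℝ 1 f (Icc 0 1)) {a : ℝ}
    (ha : a ∈ Icc (0 : ℝ) 1) : HasDerivWithinAt f (D01 f a) (Icc 0 1) a :=
  ((hf.differentiableOn (by norm_num)) a ha).hasDerivWithinAt

theorem hasDerivAt_D01 {f : ℝ → ℝ} (hf : ContDiffOn ℝ 1 f (Icc 0 1)) {a : ℝ}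
    (ha : a ∈ Ioo (0 : ℝ) 1) : HasDerivAt f (D01 f a) a :=
  (hasDerivWithinAt_D01 hf (Ioo_subset_Icc_self ha)).hasDerivAt (Icc_mem_nhds ha.1 ha.2)

theorem contDiffOn_D01 {f : ℝ → ℝ} (hf : ContDiffOn ℝ 2 f (Icc 0 1)) :
    ContDiffOn ℝ 1 (D01 f) (Icc 0 1) :=
  hf.derivWithin (uniqueDiffOn_Icc zero_lt_one) (by norm_num)

theorem monotoneOn_of_D01_nonneg {f : ℝ → ℝ} (hf : ContDiffOn ℝ 1 f (Icc 0 1))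
    (h : ∀ a ∈ Ioo (0 : ℝ) 1, 0 ≤ D01 f a) : MonotoneOn f (Icc 0 1) := by
  refine monotoneOn_of_deriv_nonneg (convex_Icc 0 1) hf.continuousOn ?_ ?_
  · intro x hx
    rw [interior_Icc] at hx
    exact (hasDerivAt_D01 hf hx).differentiableAt.differentiableWithinAt
  · intro x hx
    rw [interior_Icc] at hx
    rw [(hasDerivAt_D01 hf hx).deriv]
    exact h x hx

/-- A convex `C²` function on the unit interval lies above its tangents. -/
theorem tangent_le_of_D01_D01_nonneg {f : ℝ → ℝ} (hf : ContDiffOn ℝ 2 f (Icc 0 1))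
    (h : ∀ a ∈ Ioo (0 : ℝ) 1, 0 ≤ D01 (D01 f) a) {a b : ℝ} (ha : a ∈ Icc (0 : ℝ) 1)
    (hb : b ∈ Icc (0 : ℝ) 1) : f a + D01 f a * (b - a) ≤ f b := by
  have hf1 : ContDiffOn ℝ 1 f (Icc 0 1) := hf.of_le (by norm_num)
  have hmono := monotoneOn_of_D01_nonneg (contDiffOn_D01 hf) h
  rcases lt_trichotomy a b with hab | rfl | hab
  · obtain ⟨c, hc, hc'⟩ := exists_hasDerivAt_eq_slope f (D01 f) hab
      (hf.continuousOn.mono (Icc_subset_Icc ha.1 hb.2))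
      (fun x hx => hasDerivAt_D01 hf1 ⟨ha.1.trans_lt hx.1, hx.2.trans_le hb.2⟩)
    have := hmono ha ⟨ha.1.trans hc.1.le, hc.2.le.trans hb.2⟩ hc.1.le
    rw [hc', le_div_iff₀ (by linarith)] at this
    linarith
  · simp
  · obtain ⟨c, hc, hc'⟩ := exists_hasDerivAt_eq_slope f (D01 f) hab
      (hf.continuousOn.mono (Icc_subset_Icc hb.1 ha.2))
      (fun x hx => hasDerivAt_D01 hf1 ⟨hb.1.trans_lt hx.1, hx.2.trans_le ha.2⟩)
    have := hmono ⟨hb.1.trans hc.1.le, hc.2.le.trans ha.2⟩ ha hc.2.le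
    rw [hc', div_le_iff₀ (by linarith)] at this
    linarith

/-! ### Signs and monotonicity of the constitutive functions, and positivity of `rhoC` -/

namespace IsConstitutive

variable {k w : ℝ → ℝ}

theorem k_contDiffOn_one (h : IsConstitutive k w) : ContDiffOn ℝ 1 k (Icc 0 1) :=
  h.k_smooth.of_le (by norm_num)

theorem w_contDiffOn_one (h : IsConstitutive k w) : ContDiffOn ℝ 1 w (Icc 0 1) :=
  h.w_smooth.of_le (by norm_num)

theorem D01_k_monotoneOn (h : IsConstitutive k w) : MonotoneOn (D01 k) (Icc 0 1) :=
  monotoneOn_of_D01_nonneg (contDiffOn_D01 h.k_smooth) h.k_convex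

theorem D01_w_monotoneOn (h : IsConstitutive k w) : MonotoneOn (D01 w) (Icc 0 1) :=
  monotoneOn_of_D01_nonneg (contDiffOn_D01 h.w_smooth) h.w_convex

theorem D01_k_neg (h : IsConstitutive k w) {a : ℝ} (ha : a ∈ Ico (0 : ℝ) 1) : D01 k a < 0 := by
  -- The sign of `k'` is assumed only in the open interval; monotonicity of `k'` carries it from
  -- this midpoint back to `a`, so that `a = 0` is covered.
  have ha' : (a + 1) / 2 ∈ Ioo (0 : ℝ) 1 := ⟨by linarith [ha.1], by linarith [ha.2]⟩
  exact (h.D01_k_monotoneOn (Ico_subset_Icc_self ha) (Ioo_subset_Icc_self ha')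
    (by linarith [ha.2])).trans_lt (h.k_deriv _ ha')

theorem D01_k_one_nonpos (h : IsConstitutive k w) : D01 k 1 ≤ 0 := by
  have hc := (contDiffOn_D01 h.k_smooth).continuousOn 1 (right_mem_Icc.2 zero_le_one)
  have hc' : Tendsto (D01 k) (𝓝[Ioo 0 1] 1) (𝓝 (D01 k 1)) :=
    hc.mono_left (nhdsWithin_mono _ Ioo_subset_Icc_self)
  have : (𝓝[Ioo (0 : ℝ) 1] 1).NeBot := by
    rw [nhdsWithin_Ioo_eq_nhdsLT zero_lt_one]; infer_instance
  refine le_of_tendsto hc' ?_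
  filter_upwards [self_mem_nhdsWithin] with a ha using (h.k_deriv a ha).le

theorem D01_k_nonpos (h : IsConstitutive k w) {a : ℝ} (ha : a ∈ Icc (0 : ℝ) 1) : D01 k a ≤ 0 := by
  rcases ha.2.lt_or_eq with h1 | rfl
  · exact (h.D01_k_neg ⟨ha.1, h1⟩).le
  · exact h.D01_k_one_nonpos

theorem abs_D01_k (h : IsConstitutive k w) {a : ℝ} (ha : a ∈ Icc (0 : ℝ) 1) :
    |D01 k a| = - D01 k a := abs_of_nonpos (h.D01_k_nonpos ha)

theorem k_antitoneOn (h : IsConstitutive k w) : AntitoneOn k (Icc 0 1) := by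
  refine antitoneOn_of_deriv_nonpos (convex_Icc 0 1) h.k_smooth.continuousOn ?_ ?_
  · intro x hx
    rw [interior_Icc] at hx
    exact (hasDerivAt_D01 h.k_contDiffOn_one hx).differentiableAt.differentiableWithinAt
  · intro x hx
    rw [interior_Icc] at hx
    rw [(hasDerivAt_D01 h.k_contDiffOn_one hx).deriv]
    exact (h.k_deriv x hx).le

theorem k_nonneg (h : IsConstitutive k w) {a : ℝ} (ha : a ∈ Icc (0 : ℝ) 1) : 0 ≤ k a :=
  h.k_one ▸ h.k_antitoneOn ha (right_mem_Icc.2 zero_le_one) ha.2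

theorem k_le_one (h : IsConstitutive k w) {a : ℝ} (ha : a ∈ Icc (0 : ℝ) 1) : k a ≤ 1 :=
  h.k_zero ▸ h.k_antitoneOn (left_mem_Icc.2 zero_le_one) ha ha.1

theorem w_strictMonoOn (h : IsConstitutive k w) : StrictMonoOn w (Icc 0 1) := by
  refine strictMonoOn_of_deriv_pos (convex_Icc 0 1) h.w_smooth.continuousOn ?_
  intro x hx
  rw [interior_Icc] at hx
  rw [(hasDerivAt_D01 h.w_contDiffOn_one hx).deriv]
  exact h.w_deriv x hx

theorem w_pos (h : IsConstitutive k w) {a : ℝ} (ha : a ∈ Ioc (0 : ℝ) 1) : 0 < w a :=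
  h.w_zero ▸ h.w_strictMonoOn (left_mem_Icc.2 zero_le_one) (Ioc_subset_Icc_self ha) ha.1

theorem w_nonneg (h : IsConstitutive k w) {a : ℝ} (ha : a ∈ Icc (0 : ℝ) 1) : 0 ≤ w a :=
  h.w_zero ▸ h.w_strictMonoOn.monotoneOn (left_mem_Icc.2 zero_le_one) ha ha.1

theorem w_le_one (h : IsConstitutive k w) {a : ℝ} (ha : a ∈ Icc (0 : ℝ) 1) : w a ≤ 1 :=
  h.w_one ▸ h.w_strictMonoOn.monotoneOn ha (right_mem_Icc.2 zero_le_one) ha.2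

theorem sqrt_w_continuousOn (h : IsConstitutive k w) :
    ContinuousOn (fun a => √(w a)) (Icc 0 1) := h.w_smooth.continuousOn.sqrt

theorem D01_w_zero_nonneg (h : IsConstitutive k w) : 0 ≤ D01 w 0 := by
  have hc := (contDiffOn_D01 h.w_smooth).continuousOn 0 (left_mem_Icc.2 zero_le_one)
  have hc' : Tendsto (D01 w) (𝓝[Ioo 0 1] 0) (𝓝 (D01 w 0)) :=
    hc.mono_left (nhdsWithin_mono _ Ioo_subset_Icc_self)
  have : (𝓝[Ioo (0 : ℝ) 1] 0).NeBot := by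
    rw [nhdsWithin_Ioo_eq_nhdsGT zero_lt_one]; infer_instance
  refine ge_of_tendsto hc' ?_
  filter_upwards [self_mem_nhdsWithin] with a ha using (h.w_deriv a ha).le

theorem D01_w_nonneg (h : IsConstitutive k w) {a : ℝ} (ha : a ∈ Icc (0 : ℝ) 1) : 0 ≤ D01 w a :=
  h.D01_w_zero_nonneg.trans (h.D01_w_monotoneOn (left_mem_Icc.2 zero_le_one) ha ha.1)

/-- If `w'(0)` vanished, `w` would grow at most quadratically and `w^{-1/2}` would not be
integrable. -/
theorem D01_w_zero_pos (h : IsConstitutive k w)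
    (hw : IntervalIntegrable (fun a => 1 / √(w a)) volume 0 1) : 0 < D01 w 0 := by
  refine h.D01_w_zero_nonneg.lt_of_ne fun h0 => ?_
  obtain ⟨C, hC⟩ := isCompact_Icc.exists_bound_of_continuousOn
    ((contDiffOn_D01 h.w_smooth).continuousOn_derivWithin (uniqueDiffOn_Icc zero_lt_one) (by norm_num))
  have hD : ∀ a ∈ Icc (0 : ℝ) 1, D01 w a ≤ C * a := by
    intro a ha
    have := (convex_Icc (0 : ℝ) 1).norm_image_sub_le_of_norm_hasDerivWithin_le
      (fun x hx => hasDerivWithinAt_D01 (contDiffOn_D01 h.w_smooth) hx) hC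
      (left_mem_Icc.2 zero_le_one) ha
    rw [← h0, sub_zero, sub_zero, Real.norm_eq_abs, Real.norm_eq_abs, abs_of_nonneg ha.1] at this
    exact (le_abs_self _).trans this
  have hW : ∀ a ∈ Ioc (0 : ℝ) 1, w a ≤ C * a ^ 2 := by
    intro a ha
    have hT := tangent_le_of_D01_D01_nonneg h.w_smooth h.w_convex (Ioc_subset_Icc_self ha)
      (left_mem_Icc.2 zero_le_one)
    rw [h.w_zero] at hT
    have := mul_le_mul_of_nonneg_right (hD a (Ioc_subset_Icc_self ha)) ha.1.le
    nlinarith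
  have hC0 : 0 < C := by
    have h1 := hW 1 ⟨one_pos, le_rfl⟩
    rw [h.w_one] at h1; linarith
  have hinv : IntervalIntegrable (fun a : ℝ => a⁻¹) volume 0 1 := by
    refine (hw.const_mul (√C)).mono_fun' (by fun_prop) ?_
    refine (ae_restrict_mem measurableSet_uIoc).mono fun a ha => ?_
    rw [uIoc_of_le zero_le_one] at ha
    have hwp := h.w_pos ha
    have : √(w a) ≤ √C * a := by
      rw [Real.sqrt_le_left (by have := ha.1; positivity), mul_pow, Real.sq_sqrt hC0.le]
      exact hW a ha
    have hs : 0 < √(w a) := Real.sqrt_pos.2 hwp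
    have ha0 := ha.1
    change ‖a⁻¹‖ ≤ √C * (1 / √(w a))
    rw [Real.norm_eq_abs, abs_of_pos (inv_pos.2 ha0), mul_one_div, le_div_iff₀ hs,
      inv_mul_le_iff₀ ha0]
    linarith
  rw [intervalIntegrable_inv_iff] at hinv
  simp at hinv

theorem cW_pos (h : IsConstitutive k w) : 0 < cW w := by
  refine intervalIntegral.intervalIntegral_pos_of_pos_on ?_ ?_ zero_lt_one
  · exact (h.sqrt_w_continuousOn.mono (by rw [uIcc_of_le zero_le_one])).intervalIntegrable
  · intro a ha
    exact Real.sqrt_pos.2 (h.w_pos (Ioo_subset_Ioc_self ha))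

theorem hasDerivAt_sqrt_w (h : IsConstitutive k w) {a : ℝ} (ha : a ∈ Ioo (0 : ℝ) 1) :
    HasDerivAt (fun x => √(w x)) (D01 w a / (2 * √(w a))) a :=
  (hasDerivAt_D01 h.w_contDiffOn_one ha).sqrt (h.w_pos (Ioo_subset_Ioc_self ha)).ne'

/-- The function `√w / |k'|`, whose slope controls the softening. -/
theorem hasDerivAt_sqrt_w_div (h : IsConstitutive k w) {a : ℝ} (ha : a ∈ Ioo (0 : ℝ) 1) :
    HasDerivAt (fun x => √(w x) / |D01 k x|)
      (D01 w a / (2 * √(w a)) / |D01 k a| + √(w a) * D01 (D01 k) a / (D01 k a) ^ 2) a := by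
  have hk := h.k_deriv a ha
  have h1 : HasDerivAt (fun x => √(w x) / (- D01 k x)) _ a :=
    (h.hasDerivAt_sqrt_w ha).div (hasDerivAt_D01 (contDiffOn_D01 h.k_smooth) ha).neg
      (by simpa using hk.ne)
  refine (h1.congr_of_eventuallyEq ?_).congr_deriv ?_
  · filter_upwards [Ioo_mem_nhds ha.1 ha.2] with x hx
    rw [h.abs_D01_k (Ioo_subset_Icc_self hx)]
  · rw [h.abs_D01_k (Ioo_subset_Icc_self ha)]
    have := hk.ne
    field_simp
    ring

theorem D01_sqrt_w_div (h : IsConstitutive k w) {a : ℝ} (ha : a ∈ Ioo (0 : ℝ) 1) :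
    D01 (fun x => √(w x) / |D01 k x|) a =
      D01 w a / (2 * √(w a)) / |D01 k a| + √(w a) * D01 (D01 k) a / (D01 k a) ^ 2 :=
  (h.hasDerivAt_sqrt_w_div ha).hasDerivWithinAt.derivWithin
    (uniqueDiffOn_Icc zero_lt_one a (Ioo_subset_Icc_self ha))

/-- Drop the nonnegative `k''` term. In what is left `w'` is at least `w'(0)`, `√w` is at most `1`,
and `|k'|` is at most `|k'(0)|`. The bound makes the infimum `rhoC` meaningful, and positive once
`w'(0) > 0`. -/
theorem le_softening (h : IsConstitutive k w) {a : ℝ} (ha : a ∈ Ioo (0 : ℝ) 1) :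
    D01 w 0 / (2 * cW w * (D01 k 0) ^ 2) ≤
      1 / (cW w * |D01 k a|) * D01 (fun x => √(w x) / |D01 k x|) a := by
  have hk := h.k_deriv a ha
  have ha' := Ioo_subset_Icc_self ha
  have hwp := h.w_pos (Ioo_subset_Ioc_self ha)
  have hs : 0 < √(w a) := Real.sqrt_pos.2 hwp
  have hs1 : √(w a) ≤ 1 := Real.sqrt_le_one.2 (h.w_le_one ha')
  have hc := h.cW_pos
  have hm := h.D01_w_monotoneOn (left_mem_Icc.2 zero_le_one) ha' ha.1.le
  have hkm := h.D01_k_monotoneOn (left_mem_Icc.2 zero_le_one) ha' ha.1.le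
  have hw0 := h.D01_w_zero_nonneg
  rw [h.D01_sqrt_w_div ha, h.abs_D01_k ha']
  have hkpos : 0 < - D01 k a := by linarith
  have hk0 : D01 k 0 ≠ 0 := (h.D01_k_neg (left_mem_Ico.2 zero_lt_one)).ne
  have hka := hk.ne
  calc D01 w 0 / (2 * cW w * (D01 k 0) ^ 2)
      ≤ D01 w a / (2 * cW w * (D01 k a) ^ 2 * √(w a)) := by
        have h2 : (D01 k a) ^ 2 ≤ (D01 k 0) ^ 2 := by nlinarith
        have h3 : 0 < (D01 k a) ^ 2 := by positivity
        refine div_le_div₀ (hw0.trans hm) hm (by positivity) ?_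
        calc 2 * cW w * (D01 k a) ^ 2 * √(w a) ≤ 2 * cW w * (D01 k a) ^ 2 * 1 := by gcongr
          _ ≤ 2 * cW w * (D01 k 0) ^ 2 := by rw [mul_one]; gcongr
    _ = 1 / (cW w * (- D01 k a)) * (D01 w a / (2 * √(w a)) / (- D01 k a)) := by
        have := hk.ne
        field_simp
    _ ≤ _ := by
        gcongr
        have := h.k_convex a ha
        have : 0 ≤ √(w a) * D01 (D01 k) a / (D01 k a) ^ 2 := by positivity
        linarith

theorem rhoC_pos (h : IsConstitutive k w)
    (hw : IntervalIntegrable (fun a => 1 / √(w a)) volume 0 1) : 0 < rhoC k w := by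
  have hk0 := h.D01_k_neg (left_mem_Ico.2 zero_lt_one)
  have hpos : 0 < D01 w 0 / (2 * cW w * (D01 k 0) ^ 2) := by
    have := h.D01_w_zero_pos hw
    have := h.cW_pos
    have : 0 < (D01 k 0) ^ 2 := by have := hk0.ne; positivity
    positivity
  refine hpos.trans_le (le_csInf ((nonempty_Ioo.2 zero_lt_one).image _) ?_)
  rintro _ ⟨a, ha, rfl⟩
  exact h.le_softening ha

theorem rhoC_le (h : IsConstitutive k w) {a : ℝ} (ha : a ∈ Ioo (0 : ℝ) 1) :
    rhoC k w ≤ 1 / (cW w * |D01 k a|) * D01 (fun x => √(w x) / |D01 k x|) a := by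
  refine csInf_le ⟨D01 w 0 / (2 * cW w * (D01 k 0) ^ 2), ?_⟩ (mem_image_of_mem _ ha)
  rintro _ ⟨a, ha, rfl⟩
  exact h.le_softening ha

end IsConstitutive

/-! ### The inner product of tensors -/

theorem ddot_comm (σ τ : M3s) : ddot σ τ = ddot τ σ := by
  simp only [ddot, mul_comm]

theorem ddot_sub_left (σ σ' τ : M3s) : ddot (σ - σ') τ = ddot σ τ - ddot σ' τ := by
  simp [ddot, sub_mul, Finset.sum_sub_distrib]

theorem ddot_smul_left (c : ℝ) (σ τ : M3s) : ddot (c • σ) τ = c * ddot σ τ := by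
  simp [ddot, Finset.mul_sum, mul_assoc]

theorem ddot_sub_right (σ τ τ' : M3s) : ddot σ (τ - τ') = ddot σ τ - ddot σ τ' := by
  simp [ddot, mul_sub, Finset.sum_sub_distrib]

theorem ddot_smul_right (c : ℝ) (σ τ : M3s) : ddot σ (c • τ) = c * ddot σ τ := by
  rw [ddot_comm, ddot_smul_left, ddot_comm]

theorem ddot_self_pos {σ : M3s} (h : σ ≠ 0) : 0 < ddot σ σ := by
  have h0 : 0 ≤ ddot σ σ :=
    Finset.sum_nonneg fun i _ => Finset.sum_nonneg fun j _ => mul_self_nonneg _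
  refine h0.lt_of_ne fun h1 => h ?_
  ext i j
  have h2 := (Finset.sum_eq_zero_iff_of_nonneg (fun i _ =>
    Finset.sum_nonneg fun j _ => mul_self_nonneg (σ.1 i j))).1 h1.symm i (Finset.mem_univ i)
  have h3 := (Finset.sum_eq_zero_iff_of_nonneg
    (fun j _ => mul_self_nonneg (σ.1 i j))).1 h2 j (Finset.mem_univ j)
  simpa using h3

theorem traction_eq_ddot (σ : M3s) (n d : V3) : traction σ n d = ddot σ (symProd n d) := by
  have h : ∑ i, ∑ j, σ.1 i j * (n j * d i) = ∑ i, ∑ j, σ.1 i j * (n i * d j) := by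
    rw [Finset.sum_comm]
    exact Finset.sum_congr rfl fun i _ => Finset.sum_congr rfl fun j _ => by rw [σ.2.apply i j]
  have h2 : ddot σ (symProd n d) =
      ((∑ i, ∑ j, σ.1 i j * (n i * d j)) + ∑ i, ∑ j, σ.1 i j * (n j * d i)) / 2 := by
    simp only [ddot, symProd, Matrix.of_apply, ← Finset.sum_add_distrib, Finset.sum_div]
    exact Finset.sum_congr rfl fun i _ => Finset.sum_congr rfl fun j _ => by ring
  rw [h2, ← h, traction]
  simp only [mul_assoc]
  ring

namespace Problem

variable {P : Problem}

namespace Standing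

theorem compliance_pos (hP : P.Standing) : 0 < ddot (P.A.symm P.s) P.s := by
  have hs : P.s ≠ 0 := by
    intro h
    have := hP.s_unit
    simp [h, ddot] at this
  have := hP.A_pos (P.A.symm P.s) (by simpa using hs)
  rwa [LinearEquiv.apply_symm_apply, ddot_comm] at this

theorem epsE_eq (hP : P.Standing) : P.epsE = P.σc * ddot (P.A.symm P.s) P.s := by
  have := hP.compliance_pos
  simp [epsE, stiffness]

theorem epsE_pos (hP : P.Standing) : 0 < P.epsE :=
  hP.epsE_eq ▸ mul_pos hP.σc_pos hP.compliance_pos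

/-- In this form the size condition can be compared with the derivative of `loadOf`. -/
theorem size_ratio_eq (hP : P.Standing) : P.L / P.cohesiveLength = P.L * P.σc * P.epsE / P.Gc := by
  have := hP.compliance_pos
  have := hP.Gc_pos
  have := hP.σc_pos
  rw [hP.epsE_eq, cohesiveLength, stiffness]
  field_simp

end Standing

/-! ### The reduced one-dimensional minimization -/

/-- The least energy among the states with maximal damage `b` on the mid-plane. -/
noncomputable def redEnergy (P : Problem) (t b : ℝ) : ℝ :=
  P.L ^ 3 * (P.k b * P.σc * t - P.k b ^ 2 * P.σc * P.epsE / 2) +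
    P.Gc * P.L ^ 2 / cW P.w * ∫ a in (0 : ℝ)..b, √(P.w a)

namespace Standing

theorem hasDerivAt_loadOf (hP : P.Standing) {a : ℝ} (ha : a ∈ Ioo (0 : ℝ) 1) :
    HasDerivAt P.loadOf (D01 P.k a * P.epsE + P.Gc / (cW P.w * P.σc * P.L) *
      D01 (fun x => √(P.w x) / |D01 P.k x|) a) a := by
  have h := hP.constitutive
  have h1 := h.hasDerivAt_sqrt_w_div ha
  rw [← h.D01_sqrt_w_div ha] at h1
  exact ((hasDerivAt_D01 h.k_contDiffOn_one ha).mul_const _).add (h1.const_mul _)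

/-- Since `k'` is nondecreasing and nonpositive, `k'(y) ≠ 0` keeps `|k'|` away from zero on all of
`[x, y]`. Thus `y = 1` is allowed exactly when `k'(1) ≠ 0`. -/
theorem continuousOn_loadOf (hP : P.Standing) {x y : ℝ} (hx : 0 ≤ x) (hy : y ≤ 1)
    (hk : D01 P.k y ≠ 0) : ContinuousOn P.loadOf (Icc x y) := by
  have h := hP.constitutive
  have hsub : Icc x y ⊆ Icc 0 1 := Icc_subset_Icc hx hy
  refine ((h.k_smooth.continuousOn.mono hsub).mul continuousOn_const).add
    (continuousOn_const.mul ((h.sqrt_w_continuousOn.mono hsub).div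
      ((contDiffOn_D01 h.k_smooth).continuousOn.mono hsub).abs ?_))
  intro a ha
  have hy' : y ∈ Icc (0 : ℝ) 1 := hsub ⟨ha.1.trans ha.2, le_rfl⟩
  have h1 := h.D01_k_monotoneOn (hsub ha) hy' ha.2
  have h2 := (h.D01_k_nonpos hy').lt_of_ne hk
  exact abs_ne_zero.2 (h1.trans_lt h2).ne

/-- The derivative of `loadOf` at `a` is `|k'(a)| Gc / (L σc)` times the difference between the
quantity whose infimum is `rhoC` and `L/ℓ_ch`. This is the only place where the size condition acts.
-/
theorem loadOf_mono (hP : P.Standing) (hρ : P.L / P.cohesiveLength ≤ rhoC P.k P.w) {x y : ℝ}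
    (hx : 0 ≤ x) (hxy : x ≤ y) (hy : y ≤ 1) (hk : D01 P.k y ≠ 0) : P.loadOf x ≤ P.loadOf y := by
  have h := hP.constitutive
  refine monotoneOn_of_deriv_nonneg (convex_Icc x y) (hP.continuousOn_loadOf hx hy hk) ?_ ?_
    (left_mem_Icc.2 hxy) (right_mem_Icc.2 hxy) hxy
  · intro a ha
    rw [interior_Icc] at ha
    exact (hP.hasDerivAt_loadOf
      ⟨hx.trans_lt ha.1, ha.2.trans_le hy⟩).differentiableAt.differentiableWithinAt
  · intro a ha
    rw [interior_Icc] at ha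
    have ha' : a ∈ Ioo (0 : ℝ) 1 := ⟨hx.trans_lt ha.1, ha.2.trans_le hy⟩
    rw [(hP.hasDerivAt_loadOf ha').deriv]
    have h1 := hρ.trans (h.rhoC_le ha')
    rw [hP.size_ratio_eq, h.abs_D01_k (Ioo_subset_Icc_self ha')] at h1
    have hk' := h.k_deriv a ha'
    have hG := hP.Gc_pos
    have hL := hP.L_pos
    have hσ := hP.σc_pos
    have hc := h.cW_pos
    have hk0 : 0 < - D01 P.k a := by linarith
    have h2 := mul_le_mul_of_nonneg_left h1
      (by positivity : 0 ≤ (- D01 P.k a) * P.Gc / (P.L * P.σc))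
    have e1 : (- D01 P.k a) * P.Gc / (P.L * P.σc) * (P.L * P.σc * P.epsE / P.Gc) =
      (- D01 P.k a) * P.epsE := by field_simp
    have e2 : ∀ X : ℝ, (- D01 P.k a) * P.Gc / (P.L * P.σc) * (1 / (cW P.w * (- D01 P.k a)) * X) =
      P.Gc / (cW P.w * P.σc * P.L) * X := by
      intro X
      have := hk'.ne
      field_simp
    rw [e1, e2] at h2
    linarith

theorem loadOf_zero (hP : P.Standing) : P.loadOf 0 = P.epsE := by
  have h := hP.constitutive
  simp [loadOf, h.k_zero, h.w_zero]

theorem loadOf_one (hP : P.Standing) :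
    P.loadOf 1 = P.Gc / (P.σc * P.L) * (1 / (cW P.w * |D01 P.k 1|)) := by
  have h := hP.constitutive
  simp only [loadOf, h.k_one, h.w_one, Real.sqrt_one]
  rw [zero_mul, zero_add, div_mul_div_comm, div_mul_div_comm]
  congr 1
  ring

/-- Every load beyond the elastic limit has a maximal damage. -/
theorem exists_isMaxDamage (hP : P.Standing) {t : ℝ} (ht : P.epsE < t) :
    ∃ ā, P.IsMaxDamage t ā := by
  have h := hP.constitutive
  have key : ∀ c : ℝ, 0 ≤ c → c ≤ 1 → D01 P.k c ≠ 0 → t < P.loadOf c →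
      ∃ ā, P.IsMaxDamage t ā := by
    intro c hc0 hc1 hk hlt
    obtain ⟨ā, hā, hāt⟩ := intermediate_value_Ioo hc0 (hP.continuousOn_loadOf le_rfl hc1 hk)
      ⟨hP.loadOf_zero.symm ▸ ht, hlt⟩
    exact ⟨ā, Or.inl ⟨⟨hā.1, hā.2.trans_le hc1⟩, hāt.symm⟩⟩
  by_cases hk1 : D01 P.k 1 = 0
  · have hC : 0 < P.Gc / (cW P.w * P.σc * P.L) := by
      have := hP.Gc_pos; have := hP.L_pos; have := hP.σc_pos; have := h.cW_pos
      positivity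
    set C := P.Gc / (cW P.w * P.σc * P.L) with hCdef
    have hwh : 0 < √(P.w (1 / 2)) := Real.sqrt_pos.2 (h.w_pos ⟨by norm_num, by norm_num⟩)
    have ht0 : 0 < t := hP.epsE_pos.trans ht
    have hc : Tendsto (D01 P.k) (𝓝[<] 1) (𝓝 0) := by
      have := (contDiffOn_D01 h.k_smooth).continuousOn 1 (right_mem_Icc.2 zero_le_one)
      rw [ContinuousWithinAt, hk1] at this
      rw [← nhdsWithin_Ioo_eq_nhdsLT (zero_lt_one' ℝ)]
      exact this.mono_left (nhdsWithin_mono _ Ioo_subset_Icc_self)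
    -- When `k'(1) = 0`, `loadOf` blows up at `1`. For `c` in `(1/2, 1)` one has `√w(c) ≥ √w(1/2)`,
    -- so this smallness of `|k'(c)|` already gives `loadOf c > t`.
    have hev : ∀ᶠ a in 𝓝[<] (1 : ℝ), - (C * √(P.w (1 / 2)) / t) < D01 P.k a :=
      hc.eventually_const_lt (by simp only [neg_lt_zero]; positivity)
    obtain ⟨c, hc1, hc2⟩ := (hev.and (Ioo_mem_nhdsLT (by norm_num : (1 / 2 : ℝ) < 1))).exists
    have hcI : c ∈ Icc (0 : ℝ) 1 := ⟨by linarith [hc2.1], hc2.2.le⟩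
    have hkc := h.D01_k_neg (a := c) ⟨hcI.1, hc2.2⟩
    refine key c hcI.1 hcI.2 hkc.ne ?_
    have h1 : 0 ≤ P.k c * P.epsE := mul_nonneg (h.k_nonneg hcI) hP.epsE_pos.le
    have h2 : √(P.w (1 / 2)) ≤ √(P.w c) :=
      Real.sqrt_le_sqrt (h.w_strictMonoOn.monotoneOn ⟨by norm_num, by norm_num⟩ hcI hc2.1.le)
    have h3 : t < C * (√(P.w c) / |D01 P.k c|) := by
      rw [h.abs_D01_k hcI, ← mul_div_assoc, lt_div_iff₀ (by linarith)]
      rw [neg_lt, lt_div_iff₀ ht0] at hc1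
      nlinarith [mul_le_mul_of_nonneg_left h2 hC.le]
    rw [loadOf]
    linarith
  · by_cases hlt : t < P.loadOf 1
    · exact key 1 zero_le_one le_rfl hk1 hlt
    · exact ⟨1, Or.inr ⟨rfl, hk1, by rw [← hP.loadOf_one]; exact not_lt.1 hlt⟩⟩

/-- The sign of the derivative is that of `loadOf b - t`, so the relation `t = loadOf ā` in
`IsMaxDamage` is the stationarity condition. -/
theorem hasDerivAt_redEnergy (hP : P.Standing) (t : ℝ) {b : ℝ} (hb : b ∈ Ioo (0 : ℝ) 1) :
    HasDerivAt (P.redEnergy t) (P.L ^ 3 * P.σc * |D01 P.k b| * (P.loadOf b - t)) b := by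
  have h := hP.constitutive
  have hk := hasDerivAt_D01 h.k_contDiffOn_one hb
  have hInt : HasDerivAt (fun b => ∫ a in (0 : ℝ)..b, √(P.w a)) (√(P.w b)) b := by
    have hcont : ContinuousOn (fun a => √(P.w a)) (Ioo 0 1) :=
      h.sqrt_w_continuousOn.mono Ioo_subset_Icc_self
    refine intervalIntegral.integral_hasDerivAt_right ?_
      (hcont.stronglyMeasurableAtFilter isOpen_Ioo b hb)
      (hcont.continuousAt (isOpen_Ioo.mem_nhds hb))
    refine (h.sqrt_w_continuousOn.mono ?_).intervalIntegrable
    rw [uIcc_of_le hb.1.le]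
    exact Icc_subset_Icc le_rfl hb.2.le
  refine (((((hk.mul_const P.σc).mul_const t).sub
    ((((hk.pow 2).mul_const P.σc).mul_const P.epsE).div_const 2)).const_mul (P.L ^ 3)).add
    (hInt.const_mul (P.Gc * P.L ^ 2 / cW P.w))).congr_deriv ?_
  have hG := hP.Gc_pos
  have hL := hP.L_pos
  have hσ := hP.σc_pos
  have hc := h.cW_pos
  have hk' := (h.k_deriv b hb).ne
  rw [loadOf, h.abs_D01_k (Ioo_subset_Icc_self hb)]
  field_simp
  ring

theorem continuousOn_redEnergy (hP : P.Standing) (t : ℝ) :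
    ContinuousOn (P.redEnergy t) (Icc 0 1) := by
  have h := hP.constitutive
  have hk := h.k_smooth.continuousOn
  have hInt : ContinuousOn (fun b => ∫ a in (0 : ℝ)..b, √(P.w a)) (Icc 0 1) := by
    have := intervalIntegral.continuousOn_primitive_interval
      (μ := volume) (f := fun a => √(P.w a)) (a := 0) (b := 1)
      (by rw [uIcc_of_le zero_le_one]; exact h.sqrt_w_continuousOn.integrableOn_Icc)
    rwa [uIcc_of_le zero_le_one] at this
  unfold redEnergy
  fun_prop

/-- The maximal damage of the localized response minimizes the reduced energy. -/
theorem redEnergy_le (hP : P.Standing) (hρ : P.L / P.cohesiveLength ≤ rhoC P.k P.w) {t ā b : ℝ}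
    (hā : P.IsMaxDamage t ā) (hb : b ∈ Icc (0 : ℝ) 1) : P.redEnergy t ā ≤ P.redEnergy t b := by
  have h := hP.constitutive
  have hā01 : ā ∈ Icc (0 : ℝ) 1 := by
    rcases hā with ⟨h1, -⟩ | ⟨rfl, -⟩
    · exact Ioo_subset_Icc_self h1
    · exact ⟨zero_le_one, le_rfl⟩
  have hkā : D01 P.k ā ≠ 0 := by
    rcases hā with ⟨h1, -⟩ | ⟨rfl, h1, -⟩
    · exact (h.k_deriv _ h1).ne
    · exact h1
  have htā : P.loadOf ā ≤ t := by
    rcases hā with ⟨-, h1⟩ | ⟨rfl, -, h1⟩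
    · exact h1.ge
    · rwa [hP.loadOf_one]
  have hcoef : ∀ c, 0 ≤ P.L ^ 3 * P.σc * |D01 P.k c| := fun c => by
    have := hP.L_pos; have := hP.σc_pos; positivity
  -- To the left of `ā`, `loadOf c ≤ loadOf ā ≤ t` and the reduced energy decreases; both cases of
  -- `IsMaxDamage` provide this. To the right, `loadOf c ≥ loadOf ā = t` if `ā < 1`, while for `ā =
  -- 1` there is nothing to the right.
  rcases le_total b ā with hba | hab
  · refine antitoneOn_of_deriv_nonpos (convex_Icc b ā)
      ((hP.continuousOn_redEnergy t).mono (Icc_subset_Icc hb.1 hā01.2)) ?_ ?_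
      (left_mem_Icc.2 hba) (right_mem_Icc.2 hba) hba
    · intro c hc
      rw [interior_Icc] at hc
      exact (hP.hasDerivAt_redEnergy t
        ⟨hb.1.trans_lt hc.1, hc.2.trans_le hā01.2⟩).differentiableAt.differentiableWithinAt
    · intro c hc
      rw [interior_Icc] at hc
      rw [(hP.hasDerivAt_redEnergy t ⟨hb.1.trans_lt hc.1, hc.2.trans_le hā01.2⟩).deriv]
      refine mul_nonpos_of_nonneg_of_nonpos (hcoef c) ?_
      have := hP.loadOf_mono hρ (hb.1.trans hc.1.le) hc.2.le hā01.2 hkā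
      linarith
  · rcases hā with ⟨h1, h2⟩ | ⟨rfl, -⟩
    · refine monotoneOn_of_deriv_nonneg (convex_Icc ā b)
        ((hP.continuousOn_redEnergy t).mono (Icc_subset_Icc hā01.1 hb.2)) ?_ ?_
        (left_mem_Icc.2 hab) (right_mem_Icc.2 hab) hab
      · intro c hc
        rw [interior_Icc] at hc
        exact (hP.hasDerivAt_redEnergy t
          ⟨h1.1.trans hc.1, hc.2.trans_le hb.2⟩).differentiableAt.differentiableWithinAt
      · intro c hc
        rw [interior_Icc] at hc
        have hc' : c ∈ Ioo (0 : ℝ) 1 := ⟨h1.1.trans hc.1, hc.2.trans_le hb.2⟩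
        rw [(hP.hasDerivAt_redEnergy t hc').deriv]
        refine mul_nonneg (hcoef c) ?_
        have := hP.loadOf_mono hρ hā01.1 hc.1.le hc'.2.le (h.k_deriv c hc').ne
        linarith
    · rw [le_antisymm hb.2 hab]

end Standing

end Problem

namespace Problem

variable {P : Problem}

/-! ### The profile of the phase field -/

/-- Half the width of the support of the profile with maximal damage `ā`. -/
noncomputable def halfWidth (P : Problem) (ā : ℝ) : ℝ := P.ℓ * ∫ β in (0 : ℝ)..ā, 1 / √(P.w β)

/-- The absolute value of the slope of the profile `a`. -/
noncomputable def slope (P : Problem) (a : ℝ → ℝ) (x : ℝ) : ℝ := √(P.w (a x)) / P.ℓ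

/-- The derivative of the profile `a`, off the origin. -/
noncomputable def profileDeriv (P : Problem) (a : ℝ → ℝ) (x : ℝ) : ℝ :=
  if 0 < x then - P.slope a x else P.slope a x

/-- The second derivative of the profile `a`, off the origin and the edges of its support. -/
noncomputable def profileDeriv₂ (P : Problem) (ā : ℝ) (a : ℝ → ℝ) (x : ℝ) : ℝ :=
  if |x| < P.halfWidth ā then D01 P.w (a x) / (2 * P.ℓ ^ 2) else 0

namespace Standing

theorem intervalIntegrable_inv_sqrt (hw : IntervalIntegrable (fun a => 1 / √(P.w a)) volume 0 1)
    {x y : ℝ} (hx : x ∈ Icc (0 : ℝ) 1) (hy : y ∈ Icc (0 : ℝ) 1) :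
    IntervalIntegrable (fun a => 1 / √(P.w a)) volume x y := by
  refine hw.mono_set ?_
  rw [uIcc_of_le zero_le_one]
  exact uIcc_subset_Icc hx hy

/-- Here `w ≤ 1` gives `w^{-1/2} ≥ 1`. This strict growth of the primitive determines the profile
uniquely and makes it Lipschitz. -/
theorem sub_le_integral_inv_sqrt (hP : P.Standing)
    (hw : IntervalIntegrable (fun a => 1 / √(P.w a)) volume 0 1)
    {x y : ℝ} (hx : 0 ≤ x) (hxy : x ≤ y) (hy : y ≤ 1) : y - x ≤ ∫ β in x..y, 1 / √(P.w β) := by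
  have h := hP.constitutive
  have h1 : ∫ _ in x..y, (1 : ℝ) = y - x := by simp
  rw [← h1]
  refine intervalIntegral.integral_mono_on_of_le_Ioo hxy (by simp)
    (intervalIntegrable_inv_sqrt hw ⟨hx, hxy.trans hy⟩ ⟨hx.trans hxy, hy⟩) fun β hβ => ?_
  have hβ' : β ∈ Ioc (0 : ℝ) 1 := ⟨hx.trans_lt hβ.1, hβ.2.le.trans hy⟩
  rw [le_div_iff₀ (Real.sqrt_pos.2 (h.w_pos hβ')), one_mul]
  exact Real.sqrt_le_one.2 (h.w_le_one (Ioc_subset_Icc_self hβ'))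

theorem halfWidth_pos (hP : P.Standing)
    (hw : IntervalIntegrable (fun a => 1 / √(P.w a)) volume 0 1) {ā : ℝ} (hā : ā ∈ Ioc (0 : ℝ) 1) :
    0 < P.halfWidth ā := by
  have h1 := hP.sub_le_integral_inv_sqrt hw le_rfl hā.1.le hā.2
  exact mul_pos hP.ℓ_pos (by linarith [hā.1])

/-- The condition `2ℓ c*_w ≤ L` enters here: the profile fits into the cube, so its slope vanishes
on the faces normal to `n`. -/
theorem halfWidth_le (hP : P.Standing)
    (hw : IntervalIntegrable (fun a => 1 / √(P.w a)) volume 0 1)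
    (hL : 2 * P.ℓ * cStar P.w ≤ P.L) {ā : ℝ} (hā : ā ∈ Icc (0 : ℝ) 1) :
    P.halfWidth ā ≤ P.L / 2 := by
  have h1 : ∫ β in (0 : ℝ)..ā, 1 / √(P.w β) ≤ cStar P.w := by
    have h2 := intervalIntegral.integral_add_adjacent_intervals
      (intervalIntegrable_inv_sqrt hw (left_mem_Icc.2 zero_le_one) hā)
      (intervalIntegrable_inv_sqrt hw hā (right_mem_Icc.2 zero_le_one))
    have h3 := hP.sub_le_integral_inv_sqrt hw hā.1 hā.2 le_rfl
    rw [cStar]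
    linarith [hā.2]
  have := mul_le_mul_of_nonneg_left h1 hP.ℓ_pos.le
  rw [halfWidth]
  linarith

/-- Since `w^{-1/2}` is integrable, `s ↦ ℓ ∫ₛ^ā w^{-1/2}` is continuous. It runs from the half-width
at `s = 0` to `0` at `s = ā`, and the intermediate value theorem inverts it. -/
theorem exists_isProfile
    (hw : IntervalIntegrable (fun a => 1 / √(P.w a)) volume 0 1) {ā : ℝ} (hā : ā ∈ Icc (0 : ℝ) 1) :
    ∃ a, P.IsProfile ā a := by
  have hcont : ContinuousOn (fun s => P.ℓ * ∫ β in s..ā, 1 / √(P.w β)) (Icc 0 ā) := by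
    have h1 := intervalIntegral.continuousOn_primitive_interval_left
      (μ := volume) (f := fun a => 1 / √(P.w a)) (a := 0) (b := ā)
      (by
        rw [uIcc_of_le hā.1, integrableOn_Icc_iff_integrableOn_Ioc,
          ← intervalIntegrable_iff_integrableOn_Ioc_of_le hā.1]
        exact intervalIntegrable_inv_sqrt hw (left_mem_Icc.2 zero_le_one) hā)
    rw [uIcc_of_le hā.1] at h1
    exact continuousOn_const.mul h1
  have key : ∀ x : ℝ, ∃ y, (|x| ≤ P.ℓ * ∫ β in (0 : ℝ)..ā, 1 / √(P.w β) →
      y ∈ Icc 0 ā ∧ |x| = P.ℓ * ∫ β in y..ā, 1 / √(P.w β)) ∧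
    (P.ℓ * ∫ β in (0 : ℝ)..ā, 1 / √(P.w β) ≤ |x| → y = 0) := by
    intro x
    rcases lt_or_ge (|x|) (P.ℓ * ∫ β in (0 : ℝ)..ā, 1 / √(P.w β)) with hx | hx
    · obtain ⟨y, hy, hyx⟩ := intermediate_value_Icc' hā.1 hcont
        (show |x| ∈ Icc _ _ from ⟨by simp, hx.le⟩)
      exact ⟨y, fun _ => ⟨hy, hyx.symm⟩, fun h => absurd hx h.not_gt⟩
    · exact ⟨0, fun h => ⟨left_mem_Icc.2 hā.1, le_antisymm h hx⟩, fun _ => rfl⟩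
  choose a ha using key
  exact ⟨a, ha⟩

end Standing

/-! ### Regularity of the profile, its differential equations, and convexity around it -/

namespace IsProfile

variable {ā : ℝ} {a : ℝ → ℝ}

theorem eq_zero (ha : P.IsProfile ā a) {x : ℝ} (hx : P.halfWidth ā ≤ |x|) : a x = 0 :=
  (ha x).2 hx

theorem mem_Icc (ha : P.IsProfile ā a) (hā : ā ∈ Icc (0 : ℝ) 1) (x : ℝ) : a x ∈ Icc 0 ā := by
  rcases le_total (|x|) (P.halfWidth ā) with hx | hx
  · exact ((ha x).1 hx).1
  · rw [ha.eq_zero hx]; exact left_mem_Icc.2 hā.1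

theorem mem_unit (ha : P.IsProfile ā a) (hā : ā ∈ Icc (0 : ℝ) 1) (x : ℝ) : a x ∈ Icc (0 : ℝ) 1 :=
  Icc_subset_Icc le_rfl hā.2 (ha.mem_Icc hā x)

/-- Truncating `|x|` at the half-width merges the two regimes of the profile into one implicit
equation. -/
theorem min_abs_eq (ha : P.IsProfile ā a) (x : ℝ) :
    min |x| (P.halfWidth ā) = P.ℓ * ∫ β in (a x)..ā, 1 / √(P.w β) := by
  rcases le_total (|x|) (P.halfWidth ā) with hx | hx
  · rw [min_eq_left hx]; exact ((ha x).1 hx).2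
  · rw [min_eq_right hx, ha.eq_zero hx]; rfl

/-- Subtracting the implicit equations at `x` and `y` leaves the integral of `w^{-1/2}` between `a
x` and `a y`, which is at least `|a x - a y|`. Evenness and Lipschitz continuity both follow. -/
theorem abs_sub_le (ha : P.IsProfile ā a) (hP : P.Standing)
    (hw : IntervalIntegrable (fun a => 1 / √(P.w a)) volume 0 1) (hā : ā ∈ Icc (0 : ℝ) 1)
    (x y : ℝ) : |a x - a y| ≤ P.ℓ⁻¹ * |min |x| (P.halfWidth ā) - min |y| (P.halfWidth ā)| := by
  wlog hxy : a x ≤ a y generalizing x y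
  · rw [abs_sub_comm, abs_sub_comm (min _ _)]
    exact this y x (le_of_not_ge hxy)
  have h1 : min |x| (P.halfWidth ā) - min |y| (P.halfWidth ā) =
      P.ℓ * ∫ β in (a x)..(a y), 1 / √(P.w β) := by
    rw [ha.min_abs_eq x, ha.min_abs_eq y, ← mul_sub, sub_eq_iff_eq_add.2
      (intervalIntegral.integral_add_adjacent_intervals
        (Standing.intervalIntegrable_inv_sqrt hw (ha.mem_unit hā x) (ha.mem_unit hā y))
        (Standing.intervalIntegrable_inv_sqrt hw (ha.mem_unit hā y) hā)).symm]
  have h2 := hP.sub_le_integral_inv_sqrt hw (ha.mem_unit hā x).1 hxy (ha.mem_unit hā y).2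
  have hl := hP.ℓ_pos
  have h3 : 0 ≤ ∫ β in (a x)..(a y), 1 / √(P.w β) := by linarith
  rw [h1, abs_mul, abs_of_pos hl, ← mul_assoc, inv_mul_cancel₀ hl.ne', one_mul, abs_of_nonneg h3,
    abs_sub_comm, abs_of_nonneg (by linarith)]
  exact h2

theorem even (ha : P.IsProfile ā a) (hP : P.Standing)
    (hw : IntervalIntegrable (fun a => 1 / √(P.w a)) volume 0 1) (hā : ā ∈ Icc (0 : ℝ) 1)
    (x : ℝ) : a (-x) = a x := by
  have := ha.abs_sub_le hP hw hā (-x) x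
  rw [abs_neg, sub_self, abs_zero, mul_zero] at this
  exact sub_eq_zero.1 (abs_eq_zero.1 (le_antisymm this (abs_nonneg _)))

theorem lipschitz (ha : P.IsProfile ā a) (hP : P.Standing)
    (hw : IntervalIntegrable (fun a => 1 / √(P.w a)) volume 0 1) (hā : ā ∈ Icc (0 : ℝ) 1) :
    LipschitzWith (Real.toNNReal P.ℓ⁻¹) a := by
  refine LipschitzWith.of_dist_le_mul fun x y => ?_
  have hl : 0 ≤ P.ℓ⁻¹ := inv_nonneg.2 hP.ℓ_pos.le
  rw [Real.coe_toNNReal _ hl, Real.dist_eq, Real.dist_eq]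
  refine (ha.abs_sub_le hP hw hā x y).trans (mul_le_mul_of_nonneg_left ?_ hl)
  exact (abs_min_sub_min_le_max _ _ _ _).trans
    (max_le (abs_abs_sub_abs_le x y) (by simp))

theorem continuous (ha : P.IsProfile ā a) (hP : P.Standing)
    (hw : IntervalIntegrable (fun a => 1 / √(P.w a)) volume 0 1) (hā : ā ∈ Icc (0 : ℝ) 1) :
    Continuous a := (ha.lipschitz hP hw hā).continuous

theorem at_zero (ha : P.IsProfile ā a) (hP : P.Standing)
    (hw : IntervalIntegrable (fun a => 1 / √(P.w a)) volume 0 1) (hā : ā ∈ Ioc (0 : ℝ) 1) :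
    a 0 = ā := by
  have hā' := Ioc_subset_Icc_self hā
  have h1 := ha.min_abs_eq 0
  rw [abs_zero, min_eq_left (hP.halfWidth_pos hw hā).le] at h1
  have h2 := hP.sub_le_integral_inv_sqrt hw (ha.mem_unit hā' 0).1 (ha.mem_Icc hā' 0).2 hā.2
  have h3 : ∫ β in (a 0)..ā, 1 / √(P.w β) = 0 := by
    rcases mul_eq_zero.1 h1.symm with h | h
    · exact absurd h hP.ℓ_pos.ne'
    · exact h
  linarith [(ha.mem_Icc hā' 0).2]

theorem mem_Ioo (ha : P.IsProfile ā a) (hā : ā ∈ Icc (0 : ℝ) 1) {x : ℝ}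
    (hx0 : 0 < |x|) (hx : |x| < P.halfWidth ā) : a x ∈ Ioo 0 ā := by
  have h1 := ha.min_abs_eq x
  rw [min_eq_left hx.le] at h1
  refine ⟨(ha.mem_Icc hā x).1.lt_of_ne fun h => ?_, (ha.mem_Icc hā x).2.lt_of_ne fun h => ?_⟩
  · rw [← h] at h1; exact hx.ne h1
  · rw [h, intervalIntegral.integral_same, mul_zero] at h1; exact hx0.ne' h1

/-- The profile locally inverts `s ↦ ℓ ∫ₛ^ā w^{-1/2}`, whose derivative is `-ℓ w^{-1/2}`. Hence `ℓ
a' = -√w(a)`. -/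
theorem hasDerivAt_of_pos (ha : P.IsProfile ā a) (hP : P.Standing)
    (hw : IntervalIntegrable (fun a => 1 / √(P.w a)) volume 0 1) (hā : ā ∈ Icc (0 : ℝ) 1) {x : ℝ}
    (hx0 : 0 < x) (hx : x < P.halfWidth ā) : HasDerivAt a (- P.slope a x) x := by
  have h := hP.constitutive
  have hm := ha.mem_Ioo hā (x := x) (by rwa [abs_of_pos hx0]) (by rwa [abs_of_pos hx0])
  have hm1 : a x ∈ Ioo (0 : ℝ) 1 := ⟨hm.1, hm.2.trans_le hā.2⟩
  have hs : 0 < √(P.w (a x)) := Real.sqrt_pos.2 (h.w_pos (Ioo_subset_Ioc_self hm1))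
  have hc : ContinuousOn (fun β => 1 / √(P.w β)) (Ioo 0 1) :=
    continuousOn_const.div (h.sqrt_w_continuousOn.mono Ioo_subset_Icc_self)
      fun β hβ => (Real.sqrt_pos.2 (h.w_pos (Ioo_subset_Ioc_self hβ))).ne'
  have hΨ : HasDerivAt (fun s => P.ℓ * ∫ β in s..ā, 1 / √(P.w β))
      (P.ℓ * (-(1 / √(P.w (a x))))) (a x) :=
    (intervalIntegral.integral_hasDerivAt_left
      (Standing.intervalIntegrable_inv_sqrt hw (ha.mem_unit hā x) hā)
      (hc.stronglyMeasurableAtFilter isOpen_Ioo _ hm1)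
      (hc.continuousAt (isOpen_Ioo.mem_nhds hm1))).const_mul _
  have hl := hP.ℓ_pos
  refine (HasDerivAt.of_local_left_inverse (ha.continuous hP hw hā).continuousAt hΨ
    (by simp only [mul_neg, neg_ne_zero]; positivity) ?_).congr_deriv ?_
  · filter_upwards [Ioo_mem_nhds hx0 hx] with y hy
    rw [← ha.min_abs_eq y, abs_of_pos hy.1, min_eq_left hy.2.le]
  · rw [slope]; field_simp

theorem slope_even (ha : P.IsProfile ā a) (hP : P.Standing)
    (hw : IntervalIntegrable (fun a => 1 / √(P.w a)) volume 0 1) (hā : ā ∈ Icc (0 : ℝ) 1)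
    (x : ℝ) : P.slope a (-x) = P.slope a x := by
  rw [slope, slope, ha.even hP hw hā]

theorem slope_eq_zero (ha : P.IsProfile ā a) (hP : P.Standing) {x : ℝ}
    (hx : P.halfWidth ā ≤ |x|) : P.slope a x = 0 := by
  rw [slope, ha.eq_zero hx, hP.constitutive.w_zero]; simp

theorem hasDerivAt (ha : P.IsProfile ā a) (hP : P.Standing)
    (hw : IntervalIntegrable (fun a => 1 / √(P.w a)) volume 0 1) (hā : ā ∈ Icc (0 : ℝ) 1) {x : ℝ}
    (hx0 : x ≠ 0) (hx : |x| ≠ P.halfWidth ā) : HasDerivAt a (P.profileDeriv a x) x := by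
  rcases lt_or_gt_of_ne hx with hx | hx
  · rcases lt_or_gt_of_ne hx0 with h0 | h0
    · rw [abs_of_neg h0] at hx
      have h1 := (ha.hasDerivAt_of_pos hP hw hā (x := -x) (by linarith) hx)
      have h2 := h1.scomp x (hasDerivAt_neg x)
      rw [profileDeriv, if_neg h0.not_gt]
      refine (h2.congr_deriv ?_).congr_of_eventuallyEq (Eventually.of_forall fun y => ?_)
      · rw [ha.slope_even hP hw hā]; simp
      · exact (ha.even hP hw hā y).symm
    · rw [abs_of_pos h0] at hx
      rw [profileDeriv, if_pos h0]
      exact ha.hasDerivAt_of_pos hP hw hā h0 hx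
  · have h0 : P.profileDeriv a x = 0 := by
      simp [profileDeriv, ha.slope_eq_zero hP hx.le]
    rw [h0]
    refine (hasDerivAt_const x (0 : ℝ)).congr_of_eventuallyEq ?_
    filter_upwards [(isOpen_lt continuous_const continuous_abs).mem_nhds hx] with y hy
    exact ha.eq_zero (le_of_lt hy)

theorem slope_continuous (ha : P.IsProfile ā a) (hP : P.Standing)
    (hw : IntervalIntegrable (fun a => 1 / √(P.w a)) volume 0 1) (hā : ā ∈ Icc (0 : ℝ) 1) :
    Continuous (P.slope a) :=
  (hP.constitutive.sqrt_w_continuousOn.comp_continuous (ha.continuous hP hw hā)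
    (ha.mem_unit hā)).div_const _

/-- Differentiating `ℓ a' = ∓√w(a)` once more cancels the factor `√w(a)` and leaves `2ℓ² a'' =
w'(a)`. -/
theorem hasDerivAt_profileDeriv (ha : P.IsProfile ā a) (hP : P.Standing)
    (hw : IntervalIntegrable (fun a => 1 / √(P.w a)) volume 0 1) (hā : ā ∈ Icc (0 : ℝ) 1) {x : ℝ}
    (hx0 : x ≠ 0) (hx : |x| ≠ P.halfWidth ā) :
    HasDerivAt (P.profileDeriv a) (P.profileDeriv₂ ā a x) x := by
  have h := hP.constitutive
  rcases lt_or_gt_of_ne hx with hx' | hx'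
  · have hm := ha.mem_Ioo hā (x := x) (abs_pos.2 hx0) hx'
    have hm1 : a x ∈ Ioo (0 : ℝ) 1 := ⟨hm.1, hm.2.trans_le hā.2⟩
    have hs : 0 < √(P.w (a x)) := Real.sqrt_pos.2 (h.w_pos (Ioo_subset_Ioc_self hm1))
    have hl := hP.ℓ_pos
    have h1 : HasDerivAt (P.slope a)
        (D01 P.w (a x) / (2 * √(P.w (a x))) * P.profileDeriv a x / P.ℓ) x :=
      ((h.hasDerivAt_sqrt_w hm1).comp x (ha.hasDerivAt hP hw hā hx0 hx)).div_const _
    rw [profileDeriv₂, if_pos hx']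
    rcases lt_or_gt_of_ne hx0 with h0 | h0
    · refine (h1.congr_of_eventuallyEq ?_).congr_deriv ?_
      · filter_upwards [Iio_mem_nhds h0] with y hy
        rw [profileDeriv, if_neg (not_lt.2 (le_of_lt hy))]
      · rw [profileDeriv, if_neg h0.not_gt, slope]; field_simp
    · refine (h1.neg.congr_of_eventuallyEq ?_).congr_deriv ?_
      · filter_upwards [Ioi_mem_nhds h0] with y hy
        rw [profileDeriv, if_pos (show (0 : ℝ) < y from hy)]; rfl
      · rw [profileDeriv, if_pos h0, slope]; field_simp
  · rw [profileDeriv₂, if_neg hx'.not_gt]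
    refine (hasDerivAt_const x (0 : ℝ)).congr_of_eventuallyEq ?_
    filter_upwards [(isOpen_lt continuous_const continuous_abs).mem_nhds hx'] with y hy
    simp [profileDeriv, ha.slope_eq_zero hP (le_of_lt hy)]

theorem profileDeriv_measurable (ha : P.IsProfile ā a) (hP : P.Standing)
    (hw : IntervalIntegrable (fun a => 1 / √(P.w a)) volume 0 1) (hā : ā ∈ Icc (0 : ℝ) 1) :
    Measurable (P.profileDeriv a) := by
  have hm := (ha.slope_continuous hP hw hā).measurable
  exact Measurable.ite measurableSet_Ioi hm.neg hm

theorem abs_profileDeriv_le (ha : P.IsProfile ā a) (hP : P.Standing) (hā : ā ∈ Icc (0 : ℝ) 1)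
    (x : ℝ) : |P.profileDeriv a x| ≤ P.ℓ⁻¹ := by
  have h1 : |P.slope a x| ≤ P.ℓ⁻¹ := by
    have hl := hP.ℓ_pos
    rw [slope, abs_of_nonneg (by positivity), div_eq_mul_inv]
    exact mul_le_of_le_one_left (by positivity)
      (Real.sqrt_le_one.2 (hP.constitutive.w_le_one (ha.mem_unit hā x)))
  rw [profileDeriv]
  split_ifs
  · rwa [abs_neg]
  · exact h1

theorem profileDeriv_sq (a : ℝ → ℝ) (x : ℝ) : P.profileDeriv a x ^ 2 = P.slope a x ^ 2 := by
  rw [profileDeriv]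
  split_ifs <;> ring

theorem profileDeriv₂_measurable (ha : P.IsProfile ā a) (hP : P.Standing)
    (hw : IntervalIntegrable (fun a => 1 / √(P.w a)) volume 0 1) (hā : ā ∈ Icc (0 : ℝ) 1) :
    Measurable (P.profileDeriv₂ ā a) := by
  have hc : Continuous fun x => D01 P.w (a x) :=
    (contDiffOn_D01 hP.constitutive.w_smooth).continuousOn.comp_continuous
      (ha.continuous hP hw hā) (ha.mem_unit hā)
  exact Measurable.ite (measurableSet_lt continuous_abs.measurable measurable_const)
    (hc.measurable.div_const _) measurable_const

theorem exists_abs_profileDeriv₂_le (ha : P.IsProfile ā a) (hP : P.Standing)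
    (hā : ā ∈ Icc (0 : ℝ) 1) : ∃ C, ∀ x, |P.profileDeriv₂ ā a x| ≤ C := by
  have h := hP.constitutive
  refine ⟨D01 P.w 1 / (2 * P.ℓ ^ 2), fun x => ?_⟩
  have hl := hP.ℓ_pos
  have h1 := h.D01_w_nonneg (right_mem_Icc.2 zero_le_one)
  rw [profileDeriv₂]
  split_ifs
  · have h2 := h.D01_w_nonneg (ha.mem_unit hā x)
    rw [abs_of_nonneg (by positivity)]
    gcongr
    exact h.D01_w_monotoneOn (ha.mem_unit hā x) (right_mem_Icc.2 zero_le_one) (ha.mem_unit hā x).2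
  · rw [abs_zero]; positivity

theorem intervalIntegrable_of_bdd {f : ℝ → ℝ} (hf : Measurable f) {C : ℝ} (hC : ∀ x, |f x| ≤ C)
    (x y : ℝ) : IntervalIntegrable f volume x y :=
  (intervalIntegrable_const (c := C)).mono_fun hf.aestronglyMeasurable
    (ae_of_all _ fun z => (hC z).trans (le_abs_self C))

/-- Integration by parts against the derivative of the profile. -/
theorem integral_by_parts (ha : P.IsProfile ā a) (hP : P.Standing)
    (hw : IntervalIntegrable (fun a => 1 / √(P.w a)) volume 0 1) (hā : ā ∈ Icc (0 : ℝ) 1)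
    {M : ℝ} (hM : 0 < M) {B B' : ℝ → ℝ} (hB : Continuous B) {S : Set ℝ} (hS : S.Countable)
    (hB' : ∀ x ∉ S, HasDerivAt B (B' x) x) (hi : ∀ x y, IntervalIntegrable B' volume x y) :
    ∫ x in (-M)..M, (P.profileDeriv₂ ā a x * B x + P.profileDeriv a x * B' x) =
      2 * P.slope a 0 * B 0 - P.slope a M * (B M + B (-M)) := by
  have hS' : (S ∪ {0, P.halfWidth ā, -P.halfWidth ā}).Countable :=
    hS.union ((Set.toFinite _).countable)
  obtain ⟨C, hC⟩ := ha.exists_abs_profileDeriv₂_le hP hā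
  have hInt : ∀ x y, IntervalIntegrable
      (fun x => P.profileDeriv₂ ā a x * B x + P.profileDeriv a x * B' x) volume x y := by
    intro x y
    refine ((intervalIntegrable_of_bdd (ha.profileDeriv₂_measurable hP hw hā) hC x y).mul_continuousOn
      hB.continuousOn).add ?_
    rw [intervalIntegrable_iff]
    exact (intervalIntegrable_iff.1 (hi x y)).bdd_mul (c := P.ℓ⁻¹)
      (ha.profileDeriv_measurable hP hw hā).aestronglyMeasurable
      (ae_of_all _ (ha.abs_profileDeriv_le hP hā))
  have hd : ∀ x ∉ S ∪ {0, P.halfWidth ā, -P.halfWidth ā}, x ≠ 0 ∧ |x| ≠ P.halfWidth ā ∧ x ∉ S := by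
    intro x hx
    simp only [mem_union, mem_insert_iff, mem_singleton_iff, not_or] at hx
    refine ⟨hx.2.1, fun h => ?_, hx.1⟩
    rcases abs_choice x with h' | h' <;> rw [h'] at h
    · exact hx.2.2.1 h
    · exact hx.2.2.2 (by linarith)
  have hsl := ha.slope_continuous hP hw hā
  -- On each side of the origin `a'` is replaced by `∓slope`, which is continuous up to the origin.
  -- The two halves then leave the term `2 slope(0) B(0)`, the jump of `a'`.
  have h1 : ∫ x in (0 : ℝ)..M, (P.profileDeriv₂ ā a x * B x + P.profileDeriv a x * B' x) =
      (- P.slope a M * B M) - (- P.slope a 0 * B 0) := by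
    refine integral_eq_of_hasDerivAt_off_countable_of_le (fun x => - P.slope a x * B x) _ hM.le hS'
      (hsl.neg.mul hB).continuousOn ?_ (hInt _ _)
    intro x hx
    obtain ⟨hx0, hxR, hxS⟩ := hd x hx.2
    refine (((ha.hasDerivAt_profileDeriv hP hw hā hx0 hxR).mul
      (hB' x hxS)).congr_of_eventuallyEq ?_)
    filter_upwards [Ioi_mem_nhds hx.1.1] with y hy
    simp [profileDeriv, if_pos (show (0 : ℝ) < y from hy)]
  have h2 : ∫ x in (-M)..0, (P.profileDeriv₂ ā a x * B x + P.profileDeriv a x * B' x) =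
      (P.slope a 0 * B 0) - (P.slope a (-M) * B (-M)) := by
    refine integral_eq_of_hasDerivAt_off_countable_of_le (fun x => P.slope a x * B x) _
      (by linarith) hS' (hsl.mul hB).continuousOn ?_ (hInt _ _)
    intro x hx
    obtain ⟨hx0, hxR, hxS⟩ := hd x hx.2
    refine (((ha.hasDerivAt_profileDeriv hP hw hā hx0 hxR).mul
      (hB' x hxS)).congr_of_eventuallyEq ?_)
    filter_upwards [Iio_mem_nhds hx.1.2] with y hy
    simp [profileDeriv, if_neg (not_lt.2 (le_of_lt (show y < 0 from hy)))]
  rw [← intervalIntegral.integral_add_adjacent_intervals (hInt (-M) 0) (hInt 0 M), h1, h2,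
    ha.slope_even hP hw hā]
  ring

/-- The energy of the profile. -/
theorem integral_w (ha : P.IsProfile ā a) (hP : P.Standing)
    (hw : IntervalIntegrable (fun a => 1 / √(P.w a)) volume 0 1) (hā : ā ∈ Ioc (0 : ℝ) 1)
    {M : ℝ} (hM : P.halfWidth ā ≤ M) :
    ∫ x in (-M)..M, P.w (a x) / P.ℓ = 2 * ∫ β in (0 : ℝ)..ā, √(P.w β) := by
  have h := hP.constitutive
  have hā' := Ioc_subset_Icc_self hā
  have hR := hP.halfWidth_pos hw hā
  have hl := hP.ℓ_pos
  have hc : Continuous fun x => P.w (a x) / P.ℓ :=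
    (h.w_smooth.continuousOn.comp_continuous (ha.continuous hP hw hā') (ha.mem_unit hā')).div_const _
  have hW : ContinuousOn (fun b => ∫ a in (0 : ℝ)..b, √(P.w a)) (Icc 0 1) := by
    have := intervalIntegral.continuousOn_primitive_interval
      (μ := volume) (f := fun a => √(P.w a)) (a := 0) (b := 1)
      (by rw [uIcc_of_le zero_le_one]; exact h.sqrt_w_continuousOn.integrableOn_Icc)
    rwa [uIcc_of_le zero_le_one] at this
  -- By `ℓ a' = -√w(a)`, the integrand is the derivative of `-∫₀^{a(x)} √w`. At the right end `a =
  -- 0`, and at the left end `a = ā`.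
  have h1 : ∫ x in (0 : ℝ)..M, P.w (a x) / P.ℓ =
      (- ∫ β in (0 : ℝ)..(a M), √(P.w β)) - (- ∫ β in (0 : ℝ)..(a 0), √(P.w β)) := by
    refine integral_eq_of_hasDerivAt_off_countable_of_le
      (fun x => - ∫ β in (0 : ℝ)..(a x), √(P.w β)) _ (hR.le.trans hM)
      (countable_singleton (P.halfWidth ā))
      (hW.comp_continuous (ha.continuous hP hw hā') (ha.mem_unit hā')).neg.continuousOn ?_
      (hc.intervalIntegrable _ _)
    intro x hx
    have hx0 : 0 < x := hx.1.1
    have hxR : x ≠ P.halfWidth ā := hx.2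
    rcases lt_or_gt_of_ne hxR with hlt | hlt
    · have hm := ha.mem_Ioo hā' (x := x) (by rwa [abs_of_pos hx0]) (by rwa [abs_of_pos hx0])
      have hm1 : a x ∈ Ioo (0 : ℝ) 1 := ⟨hm.1, hm.2.trans_le hā.2⟩
      have hcont : ContinuousOn (fun a => √(P.w a)) (Ioo 0 1) :=
        h.sqrt_w_continuousOn.mono Ioo_subset_Icc_self
      have hInt : HasDerivAt (fun b => ∫ a in (0 : ℝ)..b, √(P.w a)) (√(P.w (a x))) (a x) := by
        refine intervalIntegral.integral_hasDerivAt_right ?_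
          (hcont.stronglyMeasurableAtFilter isOpen_Ioo _ hm1)
          (hcont.continuousAt (isOpen_Ioo.mem_nhds hm1))
        refine (h.sqrt_w_continuousOn.mono ?_).intervalIntegrable
        rw [uIcc_of_le hm.1.le]
        exact Icc_subset_Icc le_rfl hm1.2.le
      refine (hInt.comp x (ha.hasDerivAt_of_pos hP hw hā' hx0 hlt)).neg.congr_deriv ?_
      rw [slope, mul_neg, neg_neg, ← mul_div_assoc, Real.mul_self_sqrt (h.w_nonneg (ha.mem_unit hā' x))]
    · have hx' : P.halfWidth ā ≤ |x| := by rw [abs_of_pos hx0]; exact hlt.le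
      rw [ha.eq_zero hx', h.w_zero, zero_div]
      refine (hasDerivAt_const x (0 : ℝ)).congr_of_eventuallyEq ?_
      filter_upwards [Ioi_mem_nhds hlt] with y hy
      rw [ha.eq_zero ((le_of_lt hy).trans (le_abs_self y))]
      simp
  have h2 : ∫ x in (-M)..0, P.w (a x) / P.ℓ = ∫ x in (0 : ℝ)..M, P.w (a x) / P.ℓ := by
    have := intervalIntegral.integral_comp_neg (a := 0) (b := M) fun x => P.w (a x) / P.ℓ
    simpa only [ha.even hP hw hā', neg_zero] using this.symm
  rw [← intervalIntegral.integral_add_adjacent_intervals (hc.intervalIntegrable (-M) 0)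
    (hc.intervalIntegrable 0 M), h2, h1, ha.at_zero hP hw hā,
    ha.eq_zero (hM.trans (le_abs_self M)), intervalIntegral.integral_same]
  ring

/-- The convexity inequality for the phase-field energy density around the profile. -/
theorem energy_density_le (ha : P.IsProfile ā a) (hP : P.Standing) (hā : ā ∈ Icc (0 : ℝ) 1)
    (x : ℝ) {β γ : ℝ} (hβ : β ∈ Icc (0 : ℝ) 1) :
    2 * (P.w (a x) / P.ℓ) + 2 * P.ℓ * (P.profileDeriv₂ ā a x * β + P.profileDeriv a x * γ) -
        2 * P.ℓ * (P.profileDeriv₂ ā a x * a x + P.profileDeriv a x * P.profileDeriv a x) ≤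
      P.w β / P.ℓ + P.ℓ * γ ^ 2 := by
  have h := hP.constitutive
  have hl := hP.ℓ_pos
  -- Equipartition: both parts of the profile's energy density are equal, hence the factor `2` in
  -- front of `w(a)/ℓ`.
  have h1 : P.ℓ * P.profileDeriv a x ^ 2 = P.w (a x) / P.ℓ := by
    rw [profileDeriv_sq, slope, div_pow, Real.sq_sqrt (h.w_nonneg (ha.mem_unit hā x))]
    field_simp
  -- Inside the support this is the tangent inequality for `w` at `a x`. Outside it, `a` and
  -- `profileDeriv₂` both vanish and `w ≥ 0` suffices.
  have h2 : P.w (a x) / P.ℓ + 2 * P.ℓ * P.profileDeriv₂ ā a x * (β - a x) ≤ P.w β / P.ℓ := by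
    rw [profileDeriv₂]
    split_ifs with hx
    · have := div_le_div_of_nonneg_right
        (tangent_le_of_D01_D01_nonneg h.w_smooth h.w_convex (ha.mem_unit hā x) hβ) hl.le
      refine le_trans (le_of_eq ?_) this
      field_simp
    · rw [ha.eq_zero (not_lt.1 hx), h.w_zero]
      have := h.w_nonneg hβ
      simp only [zero_div, mul_zero, zero_mul, add_zero]
      positivity
  nlinarith [mul_nonneg hl.le (sq_nonneg (γ - P.profileDeriv a x))]

end IsProfile

end Problem

/-! ### Coordinates adapted to the cube -/

section Coordinates

variable (b : OrthonormalBasis (Fin 3) ℝ V3) (L : ℝ)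

/-- The coordinates along the frame `b`; the normal coordinate is the last one. -/
noncomputable def frame : (ℝ × ℝ) × ℝ ≃ᵐ V3 :=
  MeasurableEquiv.prodComm.trans
    (((MeasurableEquiv.refl ℝ).prodCongr MeasurableEquiv.finTwoArrow.symm).trans
      ((MeasurableEquiv.piFinSuccAbove (fun _ : Fin 3 => ℝ) 0).symm.trans
        ((MeasurableEquiv.toLp 2 (Fin 3 → ℝ)).trans b.measurableEquiv.symm)))

theorem frame_apply (y : (ℝ × ℝ) × ℝ) :
    frame b y = y.1.1 • b 1 + y.1.2 • b 2 + y.2 • b 0 := by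
  have h : frame b y = b.repr.symm (WithLp.toLp 2 ![y.2, y.1.1, y.1.2]) := by
    change b.repr.symm _ = _
    congr 1
    ext i
    fin_cases i <;> rfl
  rw [h, ← b.sum_repr_symm, Fin.sum_univ_three]
  simp
  abel

theorem measurePreserving_frame : MeasurePreserving (frame b) volume volume := by
  have h1 : MeasurePreserving (MeasurableEquiv.prodComm : (ℝ × ℝ) × ℝ ≃ᵐ ℝ × (ℝ × ℝ))
      volume volume := Measure.measurePreserving_swap
  have h2 : MeasurePreserving
      ((MeasurableEquiv.refl ℝ).prodCongr (MeasurableEquiv.finTwoArrow (α := ℝ)).symm)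
      volume volume := (MeasurePreserving.id volume).prod (volume_preserving_finTwoArrow ℝ).symm
  have h3 : MeasurePreserving (MeasurableEquiv.toLp 2 (Fin 3 → ℝ)) volume volume :=
    PiLp.volume_preserving_toLp (Fin 3)
  exact h1.trans (h2.trans ((volume_preserving_piFinSuccAbove (fun _ : Fin 3 => ℝ) 0).symm.trans
    (h3.trans b.measurePreserving_measurableEquiv.symm)))

theorem inner_frame_zero (y : (ℝ × ℝ) × ℝ) : inner ℝ (b 0) (frame b y) = y.2 := by
  simp [frame_apply, inner_add_right, inner_smul_right, b.inner_eq_ite]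

theorem inner_frame_one (y : (ℝ × ℝ) × ℝ) : inner ℝ (b 1) (frame b y) = y.1.1 := by
  simp [frame_apply, inner_add_right, inner_smul_right, b.inner_eq_ite]

theorem inner_frame_two (y : (ℝ × ℝ) × ℝ) : inner ℝ (b 2) (frame b y) = y.1.2 := by
  simp [frame_apply, inner_add_right, inner_smul_right, b.inner_eq_ite]

/-- The open interval of length `L` centred at the origin. -/
abbrev side (L : ℝ) : Set ℝ := Ioo (-(L / 2)) (L / 2)

theorem frame_mem_cube {y : (ℝ × ℝ) × ℝ} :
    frame b y ∈ cube b L ↔ y ∈ (side L ×ˢ side L) ×ˢ side L := by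
  simp only [cube, mem_ofPred_eq, Fin.forall_fin_succ, Fin.succ_zero_eq_one, Fin.succ_one_eq_two,
    inner_frame_zero, mem_prod, abs_lt, mem_Ioo, IsEmpty.forall_iff, and_true]
  have h1 := inner_frame_one b y
  have h2 := inner_frame_two b y
  rw [← h1, ← h2]
  tauto

theorem frame_preimage_cube : frame b ⁻¹' cube b L = (side L ×ˢ side L) ×ˢ side L := by
  ext y; exact frame_mem_cube b L

theorem isOpen_cube : IsOpen (cube b L) := by
  have : cube b L = ⋂ i, {x | |inner ℝ (b i) x| < L / 2} := by ext; simp [cube]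
  rw [this]
  exact isOpen_iInter_of_finite fun i => isOpen_lt (by fun_prop) continuous_const

theorem measurableSet_cube : MeasurableSet (cube b L) := (isOpen_cube b L).measurableSet

theorem volume_side (L : ℝ) : volume (side L) = ENNReal.ofReal L := by
  rw [Real.volume_Ioo]; ring_nf

theorem volume_cube : volume (cube b L) = ENNReal.ofReal L * ENNReal.ofReal L * ENNReal.ofReal L := by
  rw [← (measurePreserving_frame b).measure_preimage (measurableSet_cube b L).nullMeasurableSet,
    frame_preimage_cube]
  rw [Measure.volume_eq_prod, Measure.prod_prod, Measure.volume_eq_prod, Measure.prod_prod,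
    volume_side]

instance isFiniteMeasure_restrict_cube : IsFiniteMeasure (volume.restrict (cube b L)) :=
  ⟨by
    rw [Measure.restrict_apply_univ, volume_cube]
    exact ENNReal.mul_lt_top (ENNReal.mul_lt_top ENNReal.ofReal_lt_top ENNReal.ofReal_lt_top)
      ENNReal.ofReal_lt_top⟩

theorem volume_real_cube (hL : 0 ≤ L) : volume.real (cube b L) = L ^ 3 := by
  rw [measureReal_def, volume_cube]
  simp [ENNReal.toReal_ofReal hL]
  ring

theorem setIntegral_cube (f : V3 → ℝ) :
    ∫ x in cube b L, f x = ∫ y in (side L ×ˢ side L) ×ˢ side L, f (frame b y) := by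
  rw [← frame_preimage_cube b L]
  exact ((measurePreserving_frame b).setIntegral_preimage_emb
    (frame b).measurableEmbedding f _).symm

theorem integrableOn_cube_iff (f : V3 → ℝ) :
    IntegrableOn f (cube b L) ↔
      IntegrableOn (fun y => f (frame b y)) ((side L ×ˢ side L) ×ˢ side L) := by
  rw [← frame_preimage_cube b L]
  exact ((measurePreserving_frame b).integrableOn_comp_preimage
    (frame b).measurableEmbedding).symm

/-- Fubini's theorem on the cube. -/
theorem setIntegral_cube_eq {f : V3 → ℝ} (hf : IntegrableOn f (cube b L)) :
    ∫ x in cube b L, f x =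
      ∫ y in side L ×ˢ side L, ∫ r in side L, f (frame b (y, r)) := by
  rw [setIntegral_cube, Measure.volume_eq_prod, setIntegral_prod]
  rwa [← Measure.volume_eq_prod, ← integrableOn_cube_iff]

theorem setIntegral_square_const (hL : 0 ≤ L) (c : ℝ) :
    ∫ _ in side L ×ˢ side L, c = L ^ 2 * c := by
  rw [setIntegral_const, measureReal_def, Measure.volume_eq_prod, Measure.prod_prod, volume_side,
    smul_eq_mul, ENNReal.toReal_mul, ENNReal.toReal_ofReal hL]
  ring

/-- The integral over the cube of a function of the normal coordinate. -/
theorem setIntegral_cube_normal (hL : 0 ≤ L) (f : ℝ → ℝ) :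
    ∫ x in cube b L, f (inner ℝ (b 0) x) = L ^ 2 * ∫ r in (-(L / 2))..(L / 2), f r := by
  rw [setIntegral_cube]
  simp only [inner_frame_zero]
  have := setIntegral_prod_mul (μ := (volume : Measure (ℝ × ℝ))) (ν := (volume : Measure ℝ))
    (fun _ => (1 : ℝ)) f (side L ×ˢ side L) (side L)
  simp only [one_mul] at this
  rw [Measure.volume_eq_prod, this, setIntegral_square_const L hL, mul_one,
    intervalIntegral.integral_of_le (by linarith), integral_Ioc_eq_integral_Ioo]

theorem ae_inner_ne (c : ℝ) : ∀ᵐ x : V3, inner ℝ (b 0) x ≠ c := by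
  have h : MeasurableSet {x : V3 | inner ℝ (b 0) x = c} := by
    exact (isClosed_eq (by fun_prop) continuous_const).measurableSet
  rw [ae_iff]
  simp only [ne_eq, not_not]
  rw [← (measurePreserving_frame b).measure_preimage h.nullMeasurableSet]
  have : frame b ⁻¹' {x : V3 | inner ℝ (b 0) x = c} = univ ×ˢ {c} := by
    ext y; simp [inner_frame_zero]
  rw [this, Measure.volume_eq_prod, Measure.prod_prod]
  simp

/-! ### The mid-plane -/

theorem midPlaneArea_eq : midPlaneArea b L =
    Measure.map (fun y => frame b (y, 0)) (volume.restrict (side L ×ˢ side L)) := by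
  have h : (fun y : ℝ × ℝ => frame b (y, 0)) = fun y => y.1 • b 1 + y.2 • b 2 := by
    funext y; simp [frame_apply]
  rw [h]; rfl

theorem measurable_frame_plane (r : ℝ) : Measurable fun y : ℝ × ℝ => frame b (y, r) :=
  (frame b).measurable.comp (by fun_prop)

theorem measurableEmbedding_plane : MeasurableEmbedding fun y : ℝ × ℝ => frame b (y, 0) :=
  (frame b).measurableEmbedding.comp (measurableEmbedding_prod_mk_right 0)

theorem integral_midPlaneArea (f : V3 → ℝ) :
    ∫ x, f x ∂midPlaneArea b L = ∫ y in side L ×ˢ side L, f (frame b (y, 0)) := by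
  rw [midPlaneArea_eq]
  exact (measurableEmbedding_plane b).integral_map f

theorem midPlaneArea_univ :
    midPlaneArea b L univ = ENNReal.ofReal L * ENNReal.ofReal L := by
  rw [midPlaneArea_eq, Measure.map_apply (measurable_frame_plane b 0) MeasurableSet.univ,
    preimage_univ, Measure.restrict_apply_univ, Measure.volume_eq_prod, Measure.prod_prod,
    volume_side]

instance isFiniteMeasure_midPlaneArea : IsFiniteMeasure (midPlaneArea b L) :=
  ⟨by
    rw [midPlaneArea_univ]
    exact ENNReal.mul_lt_top ENNReal.ofReal_lt_top ENNReal.ofReal_lt_top⟩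

theorem ae_midPlaneArea (hL : 0 < L) :
    ∀ᵐ x ∂midPlaneArea b L, x ∈ cube b L ∧ inner ℝ (b 0) x = 0 := by
  rw [midPlaneArea_eq, (measurableEmbedding_plane b).ae_map_iff]
  have hm : MeasurableSet (side L ×ˢ side L) := measurableSet_Ioo.prod measurableSet_Ioo
  refine (ae_restrict_mem hm).mono fun y hy => ⟨?_, inner_frame_zero b _⟩
  rw [frame_mem_cube]
  exact ⟨hy, by constructor <;> simp <;> linarith⟩

theorem midPlaneArea_restrict_cube (hL : 0 < L) :
    (midPlaneArea b L).restrict (cube b L) = midPlaneArea b L :=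
  Measure.restrict_eq_self_of_ae_mem ((ae_midPlaneArea b L hL).mono fun _ h => h.1)

end Coordinates

/-! ### Integration by parts against test functions -/

theorem IsTest.integrable {Ω : Set V3} {φ : V3 → ℝ} (hφ : IsTest Ω φ) : Integrable φ :=
  hφ.1.continuous.integrable_of_hasCompactSupport hφ.2.1

theorem IsTest.continuous_fderiv_apply {Ω : Set V3} {φ : V3 → ℝ} (hφ : IsTest Ω φ) (v : V3) :
    Continuous fun x => fderiv ℝ φ x v :=
  (hφ.1.continuous_fderiv (by simp)).clm_apply continuous_const

theorem IsTest.hasCompactSupport_fderiv_apply {Ω : Set V3} {φ : V3 → ℝ} (hφ : IsTest Ω φ) (v : V3) :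
    HasCompactSupport fun x => fderiv ℝ φ x v :=
  hφ.2.1.fderiv_apply (𝕜 := ℝ) v

theorem IsTest.integrable_fderiv_apply {Ω : Set V3} {φ : V3 → ℝ} (hφ : IsTest Ω φ) (v : V3) :
    Integrable fun x => fderiv ℝ φ x v :=
  (hφ.continuous_fderiv_apply v).integrable_of_hasCompactSupport (hφ.hasCompactSupport_fderiv_apply v)

theorem IsTest.differentiable {Ω : Set V3} {φ : V3 → ℝ} (hφ : IsTest Ω φ) : Differentiable ℝ φ :=
  hφ.1.differentiable (by simp)

theorem IsTest.eq_zero {Ω : Set V3} {φ : V3 → ℝ} (hφ : IsTest Ω φ) {x : V3} (hx : x ∉ Ω) :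
    φ x = 0 := image_eq_zero_of_notMem_tsupport fun h => hx (hφ.2.2 h)

theorem IsTest.fderiv_apply_eq_zero {Ω : Set V3} {φ : V3 → ℝ} (hφ : IsTest Ω φ) {x : V3}
    (hx : x ∉ Ω) (v : V3) : fderiv ℝ φ x v = 0 := by
  have h : x ∉ tsupport (fderiv ℝ φ) := fun h => hx (hφ.2.2 (tsupport_fderiv_subset ℝ h))
  rw [image_eq_zero_of_notMem_tsupport h]; rfl

theorem IsTest.setIntegral_mul {Ω : Set V3} {φ : V3 → ℝ} (hφ : IsTest Ω φ) (f : V3 → ℝ) :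
    ∫ x in Ω, f x * φ x = ∫ x, f x * φ x :=
  setIntegral_eq_integral_of_forall_compl_eq_zero fun x hx => by rw [hφ.eq_zero hx, mul_zero]

theorem IsTest.setIntegral_mul_fderiv {Ω : Set V3} {φ : V3 → ℝ} (hφ : IsTest Ω φ) (f : V3 → ℝ)
    (v : V3) : ∫ x in Ω, f x * fderiv ℝ φ x v = ∫ x, f x * fderiv ℝ φ x v :=
  setIntegral_eq_integral_of_forall_compl_eq_zero fun x hx => by
    rw [hφ.fderiv_apply_eq_zero hx, mul_zero]

/-- Integration by parts for Lipschitz functions. -/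
theorem IsTest.integral_mul_fderiv {Ω : Set V3} {φ : V3 → ℝ} (hφ : IsTest Ω φ) {f : V3 → ℝ}
    {C : NNReal} (hf : LipschitzWith C f) {f' : V3 → ℝ} {v : V3}
    (hf' : ∀ᵐ x, HasLineDerivAt ℝ f (f' x) x v) :
    ∫ x in Ω, f x * fderiv ℝ φ x v = - ∫ x in Ω, f' x * φ x := by
  obtain ⟨D, hD⟩ := (hφ.1.of_le (by norm_num)).lipschitzWith_of_hasCompactSupport hφ.2.1 one_ne_zero
  have h := hf.integral_lineDeriv_mul_eq (μ := volume) hD hφ.2.1 v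
  rw [hφ.setIntegral_mul, hφ.setIntegral_mul_fderiv]
  have h1 : ∫ x, lineDeriv ℝ f x v * φ x = ∫ x, f' x * φ x :=
    integral_congr_ae (hf'.mono fun x hx => by simp only [hx.lineDeriv])
  have h2 : ∀ x, lineDeriv ℝ φ x (-v) * f x = - (f x * fderiv ℝ φ x v) := fun x => by
    rw [(hφ.differentiable x).lineDeriv_eq_fderiv]
    simp; ring
  rw [← h1, h]
  simp only [h2, integral_neg, neg_neg]

/-- The distributional derivative of the characteristic function of a half-space. -/
theorem IsTest.integral_halfSpace (b : OrthonormalBasis (Fin 3) ℝ V3) {L : ℝ} {φ : V3 → ℝ}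
    (hφ : IsTest (cube b L) φ) (v : V3) :
    ∫ x in cube b L, (if 0 < inner ℝ (b 0) x then (1 : ℝ) else 0) * fderiv ℝ φ x v =
      - (inner ℝ (b 0) v * ∫ x, φ x ∂midPlaneArea b L) := by
  set χ : V3 → ℝ := fun x => if 0 < inner ℝ (b 0) x then (1 : ℝ) else 0 with hχ
  have hχm : Measurable χ :=
    Measurable.ite (isOpen_lt continuous_const (by fun_prop)).measurableSet measurable_const
      measurable_const
  have hχb : ∀ x, ‖χ x‖ ≤ 1 := fun x => by simp only [hχ]; split_ifs <;> simp
  have hInt : ∀ v, Integrable fun x => χ x * fderiv ℝ φ x v := fun v =>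
    (hφ.integrable_fderiv_apply v).bdd_mul (c := 1) hχm.aestronglyMeasurable (ae_of_all _ hχb)
  -- The characteristic function does not change along directions tangent to the plane.
  have htan : ∀ v, inner ℝ (b 0) v = (0 : ℝ) → ∫ x, χ x * fderiv ℝ φ x v = 0 := by
    intro v hv
    have := integral_bilinear_hasLineDerivAt_right_eq_neg_left_of_integrable (μ := volume)
      (f := χ) (f' := fun _ => 0) (g := φ) (g' := fun x => fderiv ℝ φ x v) (v := v)
      (B := ContinuousLinearMap.mul ℝ ℝ) (by simp) (by simpa using hInt v)
      (by simpa using hφ.integrable.bdd_mul (c := 1) hχm.aestronglyMeasurable (ae_of_all _ hχb))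
      (fun x _ => by
        have : ∀ t : ℝ, χ (x + t • v) = χ x := fun t => by
          simp [hχ, inner_add_right, inner_smul_right, hv]
        simp only [HasLineDerivAt, this]
        exact hasDerivAt_const _ _)
      (fun x _ => (hφ.differentiable x).hasFDerivAt.hasLineDerivAt v)
    simpa using this
  -- On each line along the normal, the integral of the derivative of `φ` over the half-line is
  -- minus its value on the plane.
  have hnor : ∫ x, χ x * fderiv ℝ φ x (b 0) = - ∫ x, φ x ∂midPlaneArea b L := by
    rw [integral_midPlaneArea, setIntegral_eq_integral_of_forall_compl_eq_zero, ← integral_neg,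
      ← (measurePreserving_frame b).integral_comp (frame b).measurableEmbedding,
      Measure.volume_eq_prod, integral_prod]
    · refine integral_congr_ae (ae_of_all _ fun y => ?_)
      simp only
      set ψ : ℝ → ℝ := fun r => φ (frame b (y, r)) with hψ
      have haff : ∀ r, HasDerivAt (fun r => frame b (y, r)) (b 0) r := by
        intro r
        simp only [frame_apply]
        simpa using ((hasDerivAt_id r).smul_const (b 0)).const_add (y.1 • b 1 + y.2 • b 2)
      have hder : ∀ r, HasDerivAt ψ (fderiv ℝ φ (frame b (y, r)) (b 0)) r := fun r =>
        (hφ.differentiable _).hasFDerivAt.comp_hasDerivAt r (haff r)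
      have hsm : ContDiff ℝ 1 ψ := by
        have : ContDiff ℝ 1 fun r : ℝ => frame b (y, r) := by
          simp only [frame_apply]; fun_prop
        exact (hφ.1.of_le (by norm_num)).comp this
      have hcs : HasCompactSupport ψ := by
        refine hφ.2.1.comp_isClosedEmbedding (f := φ) (g := fun r => frame b (y, r)) ?_
        refine Isometry.isClosedEmbedding (Isometry.of_dist_eq fun r s => ?_)
        rw [dist_eq_norm, frame_apply, frame_apply, add_sub_add_left_eq_sub, ← sub_smul, norm_smul,
          b.norm_eq_one, mul_one, dist_eq_norm]
      have h1 := hcs.integral_Ioi_deriv_eq hsm 0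
      rw [← h1, ← integral_indicator measurableSet_Ioi]
      refine integral_congr_ae (ae_of_all _ fun r => ?_)
      simp only [hχ, inner_frame_zero, indicator, mem_Ioi, (hder r).deriv]
      split_ifs <;> simp
    · rw [← Measure.volume_eq_prod]
      exact ((measurePreserving_frame b).integrable_comp_emb (frame b).measurableEmbedding).2
        (hInt (b 0))
    · intro y hy
      refine hφ.eq_zero fun h => hy ?_
      rw [frame_mem_cube] at h
      exact h.1
  rw [hφ.setIntegral_mul_fderiv]
  have hv : v = inner ℝ (b 0) v • b 0 + (v - inner ℝ (b 0) v • b 0) := by abel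
  have h0 : inner ℝ (b 0) (v - inner ℝ (b 0) v • b 0) = (0 : ℝ) := by
    simp [inner_sub_right, inner_smul_right]
  have hexp : ∀ x, χ x * fderiv ℝ φ x v = inner ℝ (b 0) v * (χ x * fderiv ℝ φ x (b 0)) +
      χ x * fderiv ℝ φ x (v - inner ℝ (b 0) v • b 0) := fun x => by
    rw [map_sub, map_smul, smul_eq_mul]; ring
  refine (integral_congr_ae (ae_of_all _ hexp)).trans ?_
  rw [integral_add ((hInt _).const_mul _) (hInt _), integral_const_mul, hnor, htan _ h0]
  ring

/-! ### Integrals against measures with density -/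

/-- Passing to the positive part only increases the integral. Signed integrable lower bounds can
therefore be compared with the `[0, ∞]`-valued energies without integrability of the energy
densities. -/
theorem ofReal_integral_le_lintegral {α : Type*} [MeasurableSpace α] {μ : Measure α} {f : α → ℝ}
    (hf : Integrable f μ) : ENNReal.ofReal (∫ x, f x ∂μ) ≤ ∫⁻ x, ENNReal.ofReal (f x) ∂μ := by
  have h1 : ∫ x, f x ∂μ ≤ ∫ x, max (f x) 0 ∂μ :=
    integral_mono hf hf.pos_part fun x => le_max_left _ _
  refine (ENNReal.ofReal_le_ofReal h1).trans (le_of_eq ?_)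
  rw [ofReal_integral_eq_lintegral_ofReal hf.pos_part (ae_of_all _ fun x => le_max_right _ _)]
  refine lintegral_congr fun x => ?_
  rw [ENNReal.ofReal_max]
  simp

theorem integrable_variation_withDensityᵥ {μ : Measure V3} {f : V3 → ℝ} (hf : Integrable f μ)
    {φ : V3 → ℝ} (hφ : Continuous φ) (hφc : HasCompactSupport φ) :
    VectorMeasure.Integrable (μ.withDensityᵥ f) φ := by
  obtain ⟨C, hC⟩ := hφ.bounded_above_of_compact_support hφc
  rw [VectorMeasure.Integrable, Measure.variation_withDensityᵥ hf]
  have : IsFiniteMeasure (μ.withDensity fun x => ‖f x‖ₑ) := ⟨by simpa using! hf.2⟩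
  exact Integrable.of_bound hφ.aestronglyMeasurable C (ae_of_all _ hC)

/-- The signed measure is the difference of the measures with densities the positive and negative
parts of `f`, and `φ` is bounded. -/
theorem integral_withDensityᵥ {μ : Measure V3} {f : V3 → ℝ} (hf : Integrable f μ)
    {φ : V3 → ℝ} (hφ : Continuous φ) (hφc : HasCompactSupport φ) :
    (μ.withDensityᵥ f).integral φ (ContinuousLinearMap.lsmul ℝ ℝ) = ∫ x, f x * φ x ∂μ := by
  obtain ⟨C, hC⟩ := hφ.bounded_above_of_compact_support hφc
  have hflip : (ContinuousLinearMap.lsmul ℝ ℝ : ℝ →L[ℝ] ℝ →L[ℝ] ℝ) =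
      (ContinuousLinearMap.lsmul ℝ ℝ : ℝ →L[ℝ] ℝ →L[ℝ] ℝ).flip := by
    ext; simp
  have := isFiniteMeasure_withDensity_ofReal hf.2
  have := isFiniteMeasure_withDensity_ofReal hf.neg.2
  have hfn : AEMeasurable (fun x => ENNReal.ofReal (-f x)) μ := hf.neg.aemeasurable.ennreal_ofReal
  have hi : ∀ ν : Measure V3, ∀ [IsFiniteMeasure ν], Integrable φ ν := fun ν _ =>
    Integrable.of_bound hφ.aestronglyMeasurable C (ae_of_all _ hC)
  rw [withDensityᵥ_eq_withDensity_pos_part_sub_withDensity_neg_part hf,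
    VectorMeasure.integral_sub_vectorMeasure, hflip, VectorMeasure.integral_toSignedMeasure,
    VectorMeasure.integral_toSignedMeasure,
    integral_withDensity_eq_integral_toReal_smul₀ hf.aemeasurable.ennreal_ofReal (by simp),
    integral_withDensity_eq_integral_toReal_smul₀ hfn (by simp),
    ← integral_sub]
  · refine integral_congr_ae (ae_of_all _ fun x => ?_)
    simp only [smul_eq_mul, ENNReal.toReal_ofReal', ← sub_mul]
    rw [max_zero_sub_max_neg_zero_eq_self]
  · simp only [ENNReal.toReal_ofReal', smul_eq_mul]
    exact (hf.pos_part).mul_bdd hφ.aestronglyMeasurable (ae_of_all _ hC)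
  · simp only [ENNReal.toReal_ofReal', smul_eq_mul]
    exact (hf.neg.pos_part).mul_bdd hφ.aestronglyMeasurable (ae_of_all _ hC)
  · rw [VectorMeasure.Integrable, Measure.variation_toSignedMeasure]; exact hi _
  · rw [VectorMeasure.Integrable, Measure.variation_toSignedMeasure]; exact hi _

/-! ### The density of a tensor-valued measure -/

namespace TensorMeasure

variable (q : TensorMeasure)

instance isFiniteMeasure_dom : IsFiniteMeasure q.dom := by
  refine ⟨?_⟩
  simp only [dom, Measure.finsetSum_apply]
  refine ENNReal.sum_lt_top.2 fun i _ => ENNReal.sum_lt_top.2 fun j _ => ?_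
  simp only [SignedMeasure.totalVariation, Measure.add_apply]
  exact ENNReal.add_lt_top.2 ⟨measure_lt_top _ _, measure_lt_top _ _⟩

theorem totalVariation_le_dom (i j : Fin 3) : (q.comp i j).totalVariation ≤ q.dom := by
  rw [dom]
  refine le_trans ?_ (Finset.single_le_sum (f := fun i => ∑ j, (q.comp i j).totalVariation)
    (fun _ _ => bot_le) (Finset.mem_univ i))
  exact Finset.single_le_sum (f := fun j => (q.comp i j).totalVariation)
    (fun _ _ => bot_le) (Finset.mem_univ j)

/-- Every component is absolutely continuous with respect to `dom`, which contains its total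
variation as a summand, so Radon–Nikodym applies. -/
theorem withDensityᵥ_density (i j : Fin 3) :
    q.dom.withDensityᵥ ((q.comp i j).rnDeriv q.dom) = q.comp i j := by
  refine SignedMeasure.withDensityᵥ_rnDeriv_eq _ _ ?_
  rw [SignedMeasure.absolutelyContinuous_ennreal_iff]
  rw [show q.dom.toENNRealVectorMeasure.ennrealToMeasure = q.dom from
    VectorMeasure.equivMeasure.right_inv q.dom]
  exact Measure.absolutelyContinuous_of_le (q.totalVariation_le_dom i j)

theorem integrable_ddot_density (σ : M3s) : Integrable (fun x => ddot σ (q.density x)) q.dom := by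
  simp only [ddot, density, Matrix.of_apply]
  exact integrable_finsetSum _ fun i _ => integrable_finsetSum _ fun j _ =>
    (SignedMeasure.integrable_rnDeriv _ _).const_mul _

theorem setIntegral_ddot_density (σ : M3s) {S : Set V3} (hS : MeasurableSet S) :
    ∫ x in S, ddot σ (q.density x) ∂q.dom = ∑ i, ∑ j, σ.1 i j * q.comp i j S := by
  have hi : ∀ i j, Integrable (fun x => σ.1 i j * (q.comp i j).rnDeriv q.dom x)
      (q.dom.restrict S) := fun i j =>
    ((SignedMeasure.integrable_rnDeriv _ _).const_mul _).integrableOn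
  simp only [ddot, density, Matrix.of_apply]
  rw [integral_finsetSum _ fun i _ => integrable_finsetSum _ fun j _ => hi i j]
  refine Finset.sum_congr rfl fun i _ => ?_
  rw [integral_finsetSum _ fun j _ => hi i j]
  refine Finset.sum_congr rfl fun j _ => ?_
  rw [integral_const_mul, ← withDensityᵥ_apply (SignedMeasure.integrable_rnDeriv _ _) hS,
    q.withDensityᵥ_density]

end TensorMeasure

theorem le_supportFun {K : Set M3s} {σ : M3s} (hσ : σ ∈ K) (p : M3s) :
    ENNReal.ofReal (ddot σ p) ≤ supportFun K p :=
  le_iSup₂ (f := fun σ (_ : σ ∈ K) => ENNReal.ofReal (ddot σ p)) σ hσ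

/-! ### Precise representatives -/

theorem preciseRep_eq_of_tendsto {β : V3 → ℝ} {x : V3} {a : ℝ}
    (h : Tendsto (fun r => ⨍ y in Metric.ball x r, β y) (𝓝[>] (0 : ℝ)) (𝓝 a)) :
    preciseRep β x = a := by
  rw [preciseRep, if_pos ⟨a, h⟩, h.limUnder_eq]

theorem eventually_ball_subset {Ω : Set V3} (hΩ : IsOpen Ω) {x : V3} (hx : x ∈ Ω) :
    ∀ᶠ r in 𝓝[>] (0 : ℝ), 0 < r ∧ Metric.ball x r ⊆ Ω := by
  obtain ⟨ε, hε, hsub⟩ := Metric.isOpen_iff.1 hΩ x hx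
  filter_upwards [Ioo_mem_nhdsGT hε] with r hr
  exact ⟨hr.1, (Metric.ball_subset_ball hr.2.le).trans hsub⟩

/-- Averages over small balls stay in the interval. The conclusion holds at every point of `Ω`, as
it must, because `p` may charge sets of zero volume. -/
theorem preciseRep_mem_Icc {Ω : Set V3} (hΩ : IsOpen Ω) {β : V3 → ℝ} {b : ℝ} (hb : 0 ≤ b)
    (hi : IntegrableOn β Ω) (hβ : ∀ᵐ x ∂volume.restrict Ω, 0 ≤ β x ∧ β x ≤ b) {x : V3}
    (hx : x ∈ Ω) : preciseRep β x ∈ Icc 0 b := by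
  by_cases h : ∃ a, Tendsto (fun r => ⨍ y in Metric.ball x r, β y) (𝓝[>] (0 : ℝ)) (𝓝 a)
  · obtain ⟨a, ha⟩ := h
    rw [preciseRep_eq_of_tendsto ha]
    refine isClosed_Icc.mem_of_tendsto ha ?_
    filter_upwards [eventually_ball_subset hΩ hx] with r hr
    refine (convex_Icc 0 b).set_average_mem isClosed_Icc (Metric.measure_ball_pos _ _ hr.1).ne'
      measure_ball_lt_top.ne ?_ (hi.mono_set hr.2)
    exact ae_mono (Measure.restrict_mono hr.2 le_rfl) hβ
  -- Where the averages do not converge, the default value `0` also lies in the interval.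
  · rw [preciseRep, if_neg h]
    exact left_mem_Icc.2 hb

namespace Problem

variable {P : Problem}

theorem isOpen_Ω (P : Problem) : IsOpen P.Ω := isOpen_cube _ _

theorem measurableSet_Ω (P : Problem) : MeasurableSet P.Ω := P.isOpen_Ω.measurableSet

instance isFiniteMeasure_restrict_Ω (P : Problem) : IsFiniteMeasure (volume.restrict P.Ω) :=
  isFiniteMeasure_restrict_cube _ _

/-! ### Lower bound of the elastic and nonlinear energies -/

namespace State

variable (z : P.State)

theorem integrable_e (i j : Fin 3) : Integrable (fun x => (z.e x).1 i j) (volume.restrict P.Ω) :=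
  (z.e_memLp i j).integrable (by norm_num)

theorem integrable_α : IntegrableOn z.α P.Ω :=
  z.α_memLp.integrable (by norm_num)

theorem integrable_ddot_e (σ : M3s) :
    Integrable (fun x => ddot σ (z.e x)) (volume.restrict P.Ω) :=
  integrable_finsetSum _ fun i _ => integrable_finsetSum _ fun j _ =>
    (z.integrable_e i j).const_mul _

/-- Testing `E = e + p` with a constant stress turns the elastic and nonlinear linear terms into a
quantity that the load prescribes when `σ = s`. -/
theorem integral_ddot_e_add (σ : M3s) :
    (∫ x in P.Ω, ddot σ (z.e x)) + ∑ i, ∑ j, σ.1 i j * z.p.comp i j P.Ω =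
      ∑ i, ∑ j, σ.1 i j * z.E.comp i j P.Ω := by
  have h1 : ∫ x in P.Ω, ddot σ (z.e x) = ∑ i, ∑ j, σ.1 i j * ∫ x in P.Ω, (z.e x).1 i j := by
    have hi : ∀ i j, Integrable (fun x => σ.1 i j * (z.e x).1 i j) (volume.restrict P.Ω) :=
      fun i j => (z.integrable_e i j).const_mul _
    simp only [ddot]
    refine (integral_finsetSum Finset.univ
      (fun i _ => integrable_finsetSum _ fun j _ => hi i j)).trans ?_
    refine Finset.sum_congr rfl fun i _ => ?_
    refine (integral_finsetSum Finset.univ (fun j _ => hi i j)).trans ?_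
    exact Finset.sum_congr rfl fun j _ => integral_const_mul _ _
  rw [h1, ← Finset.sum_add_distrib]
  refine Finset.sum_congr rfl fun i _ => ?_
  rw [← Finset.sum_add_distrib]
  refine Finset.sum_congr rfl fun j _ => ?_
  rw [z.decomposition i j, add_apply,
    withDensityᵥ_apply (z.integrable_e i j) P.measurableSet_Ω,
    Measure.restrict_restrict P.measurableSet_Ω, inter_self]
  ring

end State

namespace Standing

/-- The inequality of Fenchel for the elastic energy density and a stress parallel to `s`. -/
theorem elastic_density_le (hP : P.Standing) (κ : ℝ) (ε : M3s) :
    κ * ddot P.s ε - κ ^ 2 * ddot (P.A.symm P.s) P.s / 2 ≤ ddot (P.A ε) ε / 2 := by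
  -- The quadratic form is expanded around `κ A⁻¹ s`, the strain produced by the stress `κ s`.
  have h0 : 0 ≤ ddot (P.A (ε - κ • P.A.symm P.s)) (ε - κ • P.A.symm P.s) := by
    by_cases h : ε - κ • P.A.symm P.s = 0
    · rw [h]; simp [ddot]
    · exact (hP.A_pos _ h).le
  rw [map_sub, map_smul, LinearEquiv.apply_symm_apply, ddot_sub_left, ddot_sub_right,
    ddot_sub_right, ddot_smul_left, ddot_smul_left, ddot_smul_right, ddot_smul_right,
    hP.A_symm ε (P.A.symm P.s), LinearEquiv.apply_symm_apply, ddot_comm ε P.s,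
    ddot_comm P.s (P.A.symm P.s)] at h0
  nlinarith

theorem elastic_le (hP : P.Standing) (z : P.State) (κ : ℝ) :
    ENNReal.ofReal (κ * (∫ x in P.Ω, ddot P.s (z.e x)) -
        P.L ^ 3 * (κ ^ 2 * ddot (P.A.symm P.s) P.s / 2)) ≤
      ∫⁻ x in P.Ω, ENNReal.ofReal (ddot (P.A (z.e x)) (z.e x) / 2) := by
  have hi : Integrable (fun x => κ * ddot P.s (z.e x) - κ ^ 2 * ddot (P.A.symm P.s) P.s / 2)
      (volume.restrict P.Ω) :=
    ((z.integrable_ddot_e P.s).const_mul κ).sub (integrable_const _)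
  refine le_trans (le_of_eq ?_) ((ofReal_integral_le_lintegral hi).trans
    (lintegral_mono fun x => ENNReal.ofReal_le_ofReal (hP.elastic_density_le κ (z.e x))))
  rw [integral_sub ((z.integrable_ddot_e P.s).const_mul κ) (integrable_const _), integral_const_mul,
    integral_const, measureReal_restrict_apply_univ, Ω, volume_real_cube _ _ hP.L_pos.le,
    smul_eq_mul]

/-- Pointwise, `k(α) ≥ k(b)` because `α ≤ b` and `k` decreases, and the support function is at least
`σc s · p` because `σc s` belongs to the closed set `K`. -/
theorem nonlinear_le (hP : P.Standing) (z : P.State) {b : ℝ} (hb : b ∈ Icc (0 : ℝ) 1)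
    (hα : ∀ᵐ x ∂volume.restrict P.Ω, 0 ≤ z.α x ∧ z.α x ≤ b) :
    ENNReal.ofReal (P.k b * P.σc * ∑ i, ∑ j, P.s.1 i j * z.p.comp i j P.Ω) ≤
      ∫⁻ x in P.Ω, ENNReal.ofReal (P.k (preciseRep z.α x)) *
        supportFun P.K (z.p.density x) ∂z.p.dom := by
  have h := hP.constitutive
  rw [← z.p.setIntegral_ddot_density P.s P.measurableSet_Ω, ← integral_const_mul]
  refine (ofReal_integral_le_lintegral
    ((z.p.integrable_ddot_density P.s).const_mul _).integrableOn).trans ?_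
  refine setLIntegral_mono' P.measurableSet_Ω fun x hx => ?_
  have hr := preciseRep_mem_Icc P.isOpen_Ω hb.1 z.integrable_α hα hx
  have hk := h.k_antitoneOn ⟨hr.1, hr.2.trans hb.2⟩ hb hr.2
  rw [mul_assoc, ENNReal.ofReal_mul (h.k_nonneg hb), ← ddot_smul_left]
  refine mul_le_mul' (ENNReal.ofReal_le_ofReal hk) (le_supportFun ?_ _)
  exact hP.K_closed.frontier_subset hP.σc_mem

end Standing

end Problem

open scoped Convolution

/-! ### Mollification -/

/-- The mollification of `f` by the bump function `ρ`. -/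
noncomputable def mollify (ρ : ContDiffBump (0 : V3)) (f : V3 → ℝ) (x : V3) : ℝ :=
  ∫ t, ρ.normed volume (x - t) * f t

section Mollify

variable (ρ : ContDiffBump (0 : V3)) {f : V3 → ℝ}

theorem mollify_eq_convolution_right (f : V3 → ℝ) :
    mollify ρ f = f ⋆[ContinuousLinearMap.mul ℝ ℝ, volume] ρ.normed volume := by
  funext x
  simp only [mollify, convolution, ContinuousLinearMap.mul_apply', mul_comm]

theorem mollify_eq_convolution_left (f : V3 → ℝ) :
    mollify ρ f = ρ.normed volume ⋆[ContinuousLinearMap.lsmul ℝ ℝ, volume] f := by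
  funext x
  rw [convolution_lsmul_swap]
  rfl

theorem integrable_normed_sub_mul (hf : Integrable f) (x : V3) :
    Integrable fun t => ρ.normed volume (x - t) * f t := by
  obtain ⟨C, hC⟩ := (ρ.continuous_normed (μ := volume)).bounded_above_of_compact_support
    ρ.hasCompactSupport_normed
  exact hf.bdd_mul (c := C) ((ρ.continuous_normed (μ := volume)).comp
    (continuous_const.sub continuous_id)).aestronglyMeasurable (ae_of_all _ fun t => hC _)

theorem integral_normed_sub (x : V3) : ∫ t, ρ.normed volume (x - t) = 1 := by
  rw [integral_sub_left_eq_self (fun t => ρ.normed volume t) volume x, ρ.integral_normed]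

theorem integrable_normed_sub (x : V3) : Integrable fun t => ρ.normed volume (x - t) :=
  ρ.integrable_normed.comp_sub_left x

theorem mollify_mem_Icc (hf : Integrable f) {b : ℝ} (hb : ∀ᵐ t, f t ∈ Icc 0 b) (x : V3) :
    mollify ρ f x ∈ Icc 0 b := by
  refine ⟨integral_nonneg_of_ae (hb.mono fun t ht => mul_nonneg (ρ.nonneg_normed _) ht.1), ?_⟩
  calc mollify ρ f x ≤ ∫ t, ρ.normed volume (x - t) * b :=
        integral_mono_ae (integrable_normed_sub_mul ρ hf x)
          ((integrable_normed_sub ρ x).mul_const b)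
          (hb.mono fun t ht => mul_le_mul_of_nonneg_left ht.2 (ρ.nonneg_normed _))
    _ = b := by rw [integral_mul_const, integral_normed_sub, one_mul]

theorem contDiff_mollify (hf : Integrable f) : ContDiff ℝ 1 (mollify ρ f) := by
  rw [mollify_eq_convolution_right]
  exact ρ.hasCompactSupport_normed.contDiff_convolution_right _ hf.locallyIntegrable
    (ρ.contDiff_normed (n := 1))

theorem fderiv_mollify_apply (hf : Integrable f) (x v : V3) :
    fderiv ℝ (mollify ρ f) x v = ∫ t, f t * fderiv ℝ (ρ.normed volume) (x - t) v := by
  have hρ : ContDiff ℝ 1 (ρ.normed volume) := ρ.contDiff_normed (n := 1)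
  have hc : HasCompactSupport (ρ.normed volume) := ρ.hasCompactSupport_normed
  rw [mollify_eq_convolution_right, (hc.hasFDerivAt_convolution_right
    (ContinuousLinearMap.mul ℝ ℝ) hf.locallyIntegrable hρ x).fderiv,
    convolution_precompR_apply _ hf.locallyIntegrable (hc.fderiv ℝ)
      (hρ.continuous_fderiv one_ne_zero)]
  rfl

/-- Mollification is symmetric. -/
theorem integral_mul_mollify {g : V3 → ℝ} (hf : Integrable f) (hg : Integrable g) :
    ∫ x, f x * mollify ρ g x = ∫ x, g x * mollify ρ f x := by
  obtain ⟨C, hC⟩ := (ρ.continuous_normed (μ := volume)).bounded_above_of_compact_support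
    ρ.hasCompactSupport_normed
  have h1 : ∀ x, f x * mollify ρ g x = ∫ t, ρ.normed volume (x - t) * (f x * g t) := fun x => by
    rw [mollify, ← integral_const_mul]
    exact integral_congr_ae (ae_of_all _ fun t => by ring)
  have h2 : ∀ t, g t * mollify ρ f t = ∫ x, ρ.normed volume (x - t) * (f x * g t) := fun t => by
    rw [mollify, ← integral_const_mul]
    refine integral_congr_ae (ae_of_all _ fun x => ?_)
    simp only
    rw [← ρ.normed_neg, neg_sub]; ring
  simp only [h1, h2]
  refine integral_integral_swap ?_
  refine (hf.mul_prod hg).bdd_mul (c := C) ?_ (ae_of_all _ fun t => hC _)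
  exact ((ρ.continuous_normed (μ := volume)).comp
    (continuous_fst.sub continuous_snd)).aestronglyMeasurable

/-- The derivative of a mollification is the mollification of the weak derivative. -/
theorem fderiv_mollify_eq {Ω : Set V3} (hΩ : MeasurableSet Ω) {β : V3 → ℝ} {g : V3 → V3}
    (hβ : IntegrableOn β Ω) (hg : IntegrableOn g Ω) (hw : IsWeakGradient Ω β g) {x : V3}
    (hx : Metric.closedBall x ρ.rOut ⊆ Ω) (v : V3) :
    fderiv ℝ (mollify ρ (Ω.indicator β)) x v =
      mollify ρ (Ω.indicator fun y => inner ℝ v (g y)) x := by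
  -- The kernel centred at `x` is supported in a closed ball contained in `Ω`, hence is admissible
  -- in the definition of the weak gradient.
  set φ : V3 → ℝ := fun y => ρ.normed volume (x - y) with hφ
  have hρ : ContDiff ℝ ∞ (ρ.normed volume) := ρ.contDiff_normed (n := ⊤)
  have hsupp : tsupport φ ⊆ Metric.closedBall x ρ.rOut := by
    refine closure_minimal ?_ Metric.isClosed_closedBall
    intro y hy
    have : x - y ∈ Function.support (ρ.normed volume) := hy
    rw [ρ.support_normed_eq, Metric.mem_ball, dist_zero_right] at this
    rw [Metric.mem_closedBall, dist_comm, dist_eq_norm]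
    exact this.le
  have htest : IsTest Ω φ :=
    ⟨hρ.comp (contDiff_const.sub contDiff_id),
      HasCompactSupport.of_support_subset_isCompact (isCompact_closedBall x ρ.rOut)
        ((subset_tsupport _).trans hsupp), hsupp.trans hx⟩
  have hpd : ∀ i y, partialD i φ y =
      - fderiv ℝ (ρ.normed volume) (x - y) (EuclideanSpace.single i 1) := by
    intro i y
    have h1 : HasFDerivAt φ (-(fderiv ℝ (ρ.normed volume) (x - y))) y := by
      have := ((hρ.differentiable (by simp)) (x - y)).hasFDerivAt.comp y
        ((hasFDerivAt_const x y).sub (hasFDerivAt_id y))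
      refine this.congr_fderiv ?_
      ext; simp
    rw [partialD, h1.fderiv]; rfl
  have hβ' : Integrable (Ω.indicator β) := hβ.integrable_indicator hΩ
  have hgi : ∀ i, IntegrableOn (fun y => g y i) Ω := fun i =>
    (EuclideanSpace.proj (𝕜 := ℝ) i).integrable_comp hg
  have hind : ∀ (h k : V3 → ℝ), ∫ t, Ω.indicator h t * k t = ∫ t in Ω, h t * k t := by
    intro h k
    rw [← integral_indicator hΩ]
    refine integral_congr_ae (ae_of_all _ fun t => ?_)
    by_cases ht : t ∈ Ω <;> simp [ht]
  have hcoord : ∀ i, fderiv ℝ (mollify ρ (Ω.indicator β)) x (EuclideanSpace.single i 1) =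
      ∫ t in Ω, g t i * φ t := by
    intro i
    have h1 := hw φ htest i
    rw [fderiv_mollify_apply ρ hβ', hind, ← neg_eq_iff_eq_neg.2 h1, ← integral_neg]
    refine integral_congr_ae (ae_of_all _ fun t => ?_)
    simp only [hpd]; ring
  have hv : v = ∑ i, v i • EuclideanSpace.single i (1 : ℝ) := by
    ext j; simp [Pi.single_apply]
  have hφb : ∃ C, ∀ t, ‖φ t‖ ≤ C :=
    htest.1.continuous.bounded_above_of_compact_support htest.2.1
  obtain ⟨C, hC⟩ := hφb
  have hInt : ∀ i, Integrable (fun t => v i * (g t i * φ t)) (volume.restrict Ω) := fun i =>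
    ((hgi i).mul_bdd htest.1.continuous.aestronglyMeasurable (ae_of_all _ hC)).const_mul _
  calc fderiv ℝ (mollify ρ (Ω.indicator β)) x v
      = ∑ i, v i * ∫ t in Ω, g t i * φ t := by
        conv_lhs => rw [hv]
        rw [map_sum]
        exact Finset.sum_congr rfl fun i _ => by rw [map_smul, smul_eq_mul, hcoord]
    _ = ∫ t in Ω, ∑ i, v i * (g t i * φ t) := by
        rw [integral_finsetSum _ fun i _ => hInt i]
        exact Finset.sum_congr rfl fun i _ => (integral_const_mul _ _).symm
    _ = ∫ t in Ω, inner ℝ v (g t) * φ t := by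
        refine integral_congr_ae (ae_of_all _ fun t => ?_)
        simp only [PiLp.inner_apply, Finset.sum_mul, RCLike.inner_apply, conj_trivial]
        exact Finset.sum_congr rfl fun i _ => by ring
    _ = mollify ρ (Ω.indicator fun y => inner ℝ v (g y)) x := by
        rw [← hind]
        simp only [mollify, hφ, mul_comm]

end Mollify

/-- A sequence of bump functions shrinking to the origin. -/
noncomputable def bump (m : ℕ) : ContDiffBump (0 : V3) where
  rIn := 1 / (m + 1) / 2
  rOut := 1 / (m + 1)
  rIn_pos := by positivity
  rIn_lt_rOut := half_lt_self (by positivity)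

theorem tendsto_bump_rOut : Tendsto (fun m => (bump m).rOut) atTop (𝓝 0) :=
  tendsto_one_div_add_atTop_nhds_zero_nat

theorem bump_rOut_le (m : ℕ) : (bump m).rOut ≤ 2 * (bump m).rIn := by
  simp only [bump]; linarith

theorem ae_tendsto_mollify {f : V3 → ℝ} (hf : Integrable f) :
    ∀ᵐ x, Tendsto (fun m => mollify (bump m) f x) atTop (𝓝 (f x)) := by
  simp only [mollify_eq_convolution_left]
  exact ContDiffBump.ae_convolution_tendsto_right_of_locallyIntegrable tendsto_bump_rOut
    (Eventually.of_forall bump_rOut_le) hf.locallyIntegrable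

/-- Where the precise representative attains the maximum of the function, the mollifications
converge to it. -/
theorem tendsto_mollify_of_preciseRep {Ω : Set V3} (hΩ : IsOpen Ω) {β : V3 → ℝ} {b : ℝ} (hb : 0 < b)
    (hi : IntegrableOn β Ω) (hβ : ∀ᵐ x ∂volume.restrict Ω, 0 ≤ β x ∧ β x ≤ b) {x : V3}
    (hx : x ∈ Ω) (hrep : preciseRep β x = b) :
    Tendsto (fun m => mollify (bump m) (Ω.indicator β) x) atTop (𝓝 b) := by
  -- Since `b > 0`, the value `b` is not the default `0`, so the averages do converge.
  have hlim : Tendsto (fun r => ⨍ y in Metric.ball x r, β y) (𝓝[>] (0 : ℝ)) (𝓝 b) := by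
    by_cases h : ∃ a, Tendsto (fun r => ⨍ y in Metric.ball x r, β y) (𝓝[>] (0 : ℝ)) (𝓝 a)
    · obtain ⟨a, ha⟩ := h
      rwa [← hrep, preciseRep_eq_of_tendsto ha]
    · rw [preciseRep, if_neg h] at hrep
      exact absurd hrep hb.ne
  -- As `β ≤ b`, the mean of `|β - b|` is `b` minus the mean of `β`. Convergence of the averages to
  -- the maximum thus makes `x` a Lebesgue point.
  have hosc : Tendsto (fun r => ⨍ y in Metric.ball x r, ‖Ω.indicator β y - b‖) (𝓝[>] (0 : ℝ))
      (𝓝 0) := by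
    have h1 : Tendsto (fun r => b - ⨍ y in Metric.ball x r, β y) (𝓝[>] (0 : ℝ)) (𝓝 0) := by
      simpa using hlim.const_sub b
    refine h1.congr' ?_
    filter_upwards [eventually_ball_subset hΩ hx] with r hr
    have hne : volume (Metric.ball x r) ≠ 0 := (Metric.measure_ball_pos _ _ hr.1).ne'
    have hfin : volume (Metric.ball x r) ≠ ⊤ := measure_ball_lt_top.ne
    have hib : IntegrableOn β (Metric.ball x r) := hi.mono_set hr.2
    have h2 : ⨍ y in Metric.ball x r, ‖Ω.indicator β y - b‖ =
        ⨍ y in Metric.ball x r, (b - β y) := by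
      refine setAverage_congr_fun Metric.isOpen_ball.measurableSet ?_
      have h3 : ∀ᵐ y ∂volume.restrict (Metric.ball x r), 0 ≤ β y ∧ β y ≤ b :=
        ae_mono (Measure.restrict_mono hr.2 le_rfl) hβ
      rw [ae_restrict_iff' Metric.isOpen_ball.measurableSet] at h3
      filter_upwards [h3] with y hy hyb
      rw [indicator_of_mem (hr.2 hyb), Real.norm_eq_abs, abs_sub_comm,
        abs_of_nonneg (by linarith [(hy hyb).2])]
    have hpos : 0 < volume.real (Metric.ball x r) := ENNReal.toReal_pos hne hfin
    have hconst : IntegrableOn (fun _ : V3 => b) (Metric.ball x r) := integrableOn_const hfin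
    rw [h2, setAverage_eq, setAverage_eq, integral_sub hconst hib, setIntegral_const, smul_eq_mul,
      smul_eq_mul, smul_eq_mul]
    field_simp
  have hbump : Tendsto (fun m => (bump m).rOut) atTop (𝓝[>] 0) :=
    tendsto_nhdsWithin_iff.2 ⟨tendsto_bump_rOut, Eventually.of_forall fun m => (bump m).rOut_pos⟩
  -- The constant `2 ^ dim` bounds the kernel times the volume of its supporting ball, because `rOut
  -- ≤ 2 rIn`.
  refine tendsto_integral_smul_of_tendsto_average_norm_sub (μ := volume)
    (a := fun m => Metric.ball x (bump m).rOut) (f := Ω.indicator β)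
    (g := fun m t => (bump m).normed volume (x - t)) (2 ^ Module.finrank ℝ V3)
    (hosc.comp hbump) ?_ ?_ ?_ ?_
  · exact Eventually.of_forall fun m => (hi.integrable_indicator hΩ.measurableSet).integrableOn
  · simp only [integral_normed_sub]
    exact tendsto_const_nhds
  · refine Eventually.of_forall fun m y hy => ?_
    have : x - y ∈ Function.support ((bump m).normed volume) := hy
    rw [ContDiffBump.support_normed_eq, Metric.mem_ball, dist_zero_right] at this
    rwa [Metric.mem_ball, dist_comm, dist_eq_norm]
  · refine Eventually.of_forall fun m y => ?_
    rw [abs_of_nonneg (ContDiffBump.nonneg_normed _ _)]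
    refine ((bump m).normed_le_div_measure_closedBall_rOut volume 2 (bump_rOut_le m) _).trans
      (le_of_eq ?_)
    rw [measureReal_def, measureReal_def, Measure.addHaar_closedBall_eq_addHaar_ball,
      Measure.addHaar_ball_center volume x]

theorem cube_subset_closedBall (b : OrthonormalBasis (Fin 3) ℝ V3) (L : ℝ) :
    cube b L ⊆ Metric.closedBall 0 (3 * (L / 2)) := by
  intro x hx
  rw [mem_closedBall_zero_iff, ← b.sum_repr' x]
  refine (norm_sum_le _ _).trans ?_
  have : ∀ i, ‖inner ℝ (b i) x • b i‖ ≤ L / 2 := fun i => by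
    rw [norm_smul, b.norm_eq_one, mul_one]
    exact (hx i).le
  calc ∑ i, ‖inner ℝ (b i) x • b i‖ ≤ ∑ _i : Fin 3, L / 2 := Finset.sum_le_sum fun i _ => this i
    _ = 3 * (L / 2) := by simp

theorem integrableOn_cube_of_continuous {E : Type*} [NormedAddCommGroup E]
    (b : OrthonormalBasis (Fin 3) ℝ V3) (L : ℝ) {f : V3 → E}
    (hf : Continuous f) : IntegrableOn f (cube b L) :=
  (hf.locallyIntegrable.integrableOn_isCompact (isCompact_closedBall 0 _)).mono_set
    (cube_subset_closedBall b L)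

theorem closedBall_subset_cube (b : OrthonormalBasis (Fin 3) ℝ V3) {L L' r : ℝ}
    (hr : r < (L - L') / 2) {x : V3} (hx : x ∈ cube b L') : Metric.closedBall x r ⊆ cube b L := by
  intro y hy i
  have h1 : |inner ℝ (b i) (y - x)| ≤ r := by
    refine (abs_real_inner_le_norm _ _).trans ?_
    rw [b.norm_eq_one, one_mul, ← dist_eq_norm]
    exact hy
  have h2 := hx i
  have h3 : inner ℝ (b i) y = inner ℝ (b i) x + inner ℝ (b i) (y - x) := by
    rw [inner_sub_right]; ring
  rw [h3]
  refine (abs_add_le _ _).trans_lt ?_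
  linarith

theorem cube_subset_cube (b : OrthonormalBasis (Fin 3) ℝ V3) {L L' : ℝ} (h : L' ≤ L) :
    cube b L' ⊆ cube b L := fun x hx i => (hx i).trans_le (by linarith)

/-! ### Integration by parts against the profile for competitors in `H¹` -/

namespace Problem

variable {P : Problem}

namespace State

variable (z : P.State)

theorem integrable_g : IntegrableOn z.g P.Ω := z.g_memLp.integrable (by norm_num)

theorem integrable_inner_g : IntegrableOn (fun x => inner ℝ P.n (z.g x)) P.Ω :=
  (innerSL ℝ P.n).integrable_comp z.integrable_g

end State

namespace IsProfile

variable {ā : ℝ} {a : ℝ → ℝ}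

theorem integrableOn_profileDeriv₂_mul (ha : P.IsProfile ā a) (hP : P.Standing)
    (hw : IntervalIntegrable (fun a => 1 / √(P.w a)) volume 0 1) (hā : ā ∈ Icc (0 : ℝ) 1)
    {S : Set V3} {f : V3 → ℝ} (hf : IntegrableOn f S) :
    IntegrableOn (fun x => P.profileDeriv₂ ā a (inner ℝ P.n x) * f x) S := by
  obtain ⟨C, hC⟩ := ha.exists_abs_profileDeriv₂_le hP hā
  exact hf.bdd_mul (c := C) ((ha.profileDeriv₂_measurable hP hw hā).comp
    (by fun_prop)).aestronglyMeasurable (ae_of_all _ fun x => hC _)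

theorem integrableOn_profileDeriv_mul (ha : P.IsProfile ā a) (hP : P.Standing)
    (hw : IntervalIntegrable (fun a => 1 / √(P.w a)) volume 0 1) (hā : ā ∈ Icc (0 : ℝ) 1)
    {S : Set V3} {f : V3 → ℝ} (hf : IntegrableOn f S) :
    IntegrableOn (fun x => P.profileDeriv a (inner ℝ P.n x) * f x) S :=
  hf.bdd_mul (c := P.ℓ⁻¹) ((ha.profileDeriv_measurable hP hw hā).comp
    (by fun_prop)).aestronglyMeasurable (ae_of_all _ fun x => ha.abs_profileDeriv_le hP hā _)

theorem slope_nonneg (hP : P.Standing) (a : ℝ → ℝ) (x : ℝ) : 0 ≤ P.slope a x :=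
  div_nonneg (Real.sqrt_nonneg _) hP.ℓ_pos.le

/-- Integration by parts on a cube against the derivative of the profile, for smooth functions. -/
theorem le_integral_cube_of_contDiff (ha : P.IsProfile ā a) (hP : P.Standing)
    (hw : IntervalIntegrable (fun a => 1 / √(P.w a)) volume 0 1) (hā : ā ∈ Icc (0 : ℝ) 1)
    {M : ℝ} (hM : 0 < M) {B : V3 → ℝ} (hB : ContDiff ℝ 1 B) (hB1 : ∀ x, B x ≤ 1) :
    2 * P.slope a 0 * (∫ y in side M ×ˢ side M, B (frame P.b (y, 0))) -
        M ^ 2 * (2 * P.slope a (M / 2)) ≤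
      ∫ x in cube P.b M, (P.profileDeriv₂ ā a (inner ℝ P.n x) * B x +
        P.profileDeriv a (inner ℝ P.n x) * fderiv ℝ B x P.n) := by
  have hD : Continuous fun x => fderiv ℝ B x P.n :=
    (hB.continuous_fderiv one_ne_zero).clm_apply continuous_const
  have hframe : Continuous fun y : ℝ × ℝ => frame P.b (y, 0) := by
    simp only [frame_apply]; fun_prop
  have hframe' : ∀ y : ℝ × ℝ, Continuous fun r : ℝ => frame P.b (y, r) := fun y => by
    simp only [frame_apply]; fun_prop
  have hInt := (ha.integrableOn_profileDeriv₂_mul hP hw hā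
      (integrableOn_cube_of_continuous P.b M hB.continuous)).add
    (ha.integrableOn_profileDeriv_mul hP hw hā (integrableOn_cube_of_continuous P.b M hD))
  have hmid : IntegrableOn (fun y => B (frame P.b (y, 0))) (side M ×ˢ side M) := by
    refine ((hB.continuous.comp hframe).locallyIntegrable.integrableOn_isCompact
      (isCompact_Icc.prod isCompact_Icc : IsCompact
        (Icc (-(M / 2)) (M / 2) ×ˢ Icc (-(M / 2)) (M / 2)))).mono_set ?_
    exact prod_mono Ioo_subset_Icc_self Ioo_subset_Icc_self
  -- The one-dimensional integration by parts is applied on each line along the normal, where only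
  -- the normal derivative of `B` enters.
  have hinner : ∀ y : ℝ × ℝ, ∫ r in side M, (P.profileDeriv₂ ā a r * B (frame P.b (y, r)) +
      P.profileDeriv a r * fderiv ℝ B (frame P.b (y, r)) P.n) =
      2 * P.slope a 0 * B (frame P.b (y, 0)) - P.slope a (M / 2) *
        (B (frame P.b (y, M / 2)) + B (frame P.b (y, -(M / 2)))) := by
    intro y
    rw [← integral_Ioc_eq_integral_Ioo, ← intervalIntegral.integral_of_le (by linarith)]
    refine ha.integral_by_parts hP hw hā (by linarith) (hB.continuous.comp (hframe' y))
      countable_empty (fun r _ => ?_) fun r s => (hD.comp (hframe' y)).intervalIntegrable r s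
    refine ((hB.differentiable one_ne_zero) _).hasFDerivAt.comp_hasDerivAt r ?_
    simp only [frame_apply, n]
    simpa using ((hasDerivAt_id r).smul_const (P.b 0)).const_add (y.1 • P.b 1 + y.2 • P.b 2)
  have hfub := setIntegral_cube_eq P.b M hInt
  simp only [Pi.add_apply, n, inner_frame_zero] at hfub
  simp only [n] at hinner ⊢
  rw [hfub]
  have hm : MeasurableSet (side M ×ˢ side M) := measurableSet_Ioo.prod measurableSet_Ioo
  have hInt' : IntegrableOn (fun y => ∫ r in side M,
      (P.profileDeriv₂ ā a r * B (frame P.b (y, r)) +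
        P.profileDeriv a r * fderiv ℝ B (frame P.b (y, r)) (P.b 0))) (side M ×ˢ side M) := by
    have h1 := (integrableOn_cube_iff P.b M _).1 hInt
    rw [IntegrableOn, Measure.volume_eq_prod, ← Measure.prod_restrict] at h1
    have h2 := h1.integral_prod_left
    simp only [Pi.add_apply, n, inner_frame_zero] at h2
    exact h2
  have hc : IntegrableOn (fun _ : ℝ × ℝ => 2 * P.slope a (M / 2)) (side M ×ˢ side M) := by
    refine integrableOn_const ?_
    rw [Measure.volume_eq_prod, Measure.prod_prod, volume_side]
    exact ENNReal.mul_ne_top ENNReal.ofReal_ne_top ENNReal.ofReal_ne_top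
  rw [← integral_const_mul, ← setIntegral_square_const M hM.le, ← integral_sub (hmid.const_mul _) hc]
  -- The values of `B` on the two faces are bounded only by `1`; the factor `slope(M/2)` will vanish
  -- in the limit.
  refine integral_mono ((hmid.const_mul _).sub hc) hInt' fun y => ?_
  simp only
  rw [hinner y]
  have hs := slope_nonneg hP a (M / 2)
  nlinarith [mul_le_mul_of_nonneg_left (hB1 (frame P.b (y, M / 2))) hs,
    mul_le_mul_of_nonneg_left (hB1 (frame P.b (y, -(M / 2)))) hs]

/-- Integration by parts on a smaller cube, for a competitor with maximum on the mid-plane. -/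
theorem le_integral_cube (ha : P.IsProfile ā a) (hP : P.Standing)
    (hw : IntervalIntegrable (fun a => 1 / √(P.w a)) volume 0 1) (hā : ā ∈ Ioc (0 : ℝ) 1)
    (z : P.State) (hα : ∀ᵐ x ∂volume.restrict P.Ω, 0 ≤ z.α x ∧ z.α x ≤ ā)
    (hΓ : ∀ᵐ x ∂midPlaneArea P.b P.L, preciseRep z.α x = ā) {M : ℝ} (hM : 0 < M) (hML : M < P.L) :
    M ^ 2 * (2 * P.slope a 0 * ā) - M ^ 2 * (2 * P.slope a (M / 2)) ≤
      ∫ x in cube P.b M, (P.profileDeriv₂ ā a (inner ℝ P.n x) * z.α x +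
        P.profileDeriv a (inner ℝ P.n x) * inner ℝ P.n (z.g x)) := by
  have hā' := Ioc_subset_Icc_self hā
  have hsub : cube P.b M ⊆ P.Ω := cube_subset_cube P.b hML.le
  set β : V3 → ℝ := P.Ω.indicator z.α with hβdef
  set γ : V3 → ℝ := P.Ω.indicator fun x => inner ℝ P.n (z.g x) with hγdef
  have hβ : Integrable β := z.integrable_α.integrable_indicator P.measurableSet_Ω
  have hγ : Integrable γ := z.integrable_inner_g.integrable_indicator P.measurableSet_Ω
  have hβ01 : ∀ᵐ x, β x ∈ Icc 0 ā := by
    rw [ae_restrict_iff' P.measurableSet_Ω] at hα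
    filter_upwards [hα] with x hx
    by_cases h : x ∈ P.Ω
    · rw [hβdef, indicator_of_mem h]; exact hx h
    · rw [hβdef, indicator_of_notMem h]; exact left_mem_Icc.2 hā'.1
  have hmol : ∀ m x, mollify (bump m) β x ∈ Icc 0 ā := fun m x => mollify_mem_Icc _ hβ hβ01 x
  have hmeas : MeasurableSet (cube P.b M) := measurableSet_cube _ _
  -- convergence of the volume term with `β`
  have hlim1 : Tendsto (fun m => ∫ x in cube P.b M,
      P.profileDeriv₂ ā a (inner ℝ P.n x) * mollify (bump m) β x) atTop
      (𝓝 (∫ x in cube P.b M, P.profileDeriv₂ ā a (inner ℝ P.n x) * z.α x)) := by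
    obtain ⟨C, hC⟩ := ha.exists_abs_profileDeriv₂_le hP hā'
    refine tendsto_integral_of_dominated_convergence (fun _ => C * 1) (fun m => ?_)
      (integrable_const _) (fun m => ae_of_all _ fun x => ?_) ?_
    · exact (ha.integrableOn_profileDeriv₂_mul hP hw hā' (integrableOn_cube_of_continuous P.b M
        (contDiff_mollify _ hβ).continuous)).aestronglyMeasurable
    · rw [norm_mul]
      have h1 := hmol m x
      refine mul_le_mul (hC _) ?_ (norm_nonneg _) ((abs_nonneg _).trans (hC 0))
      rw [Real.norm_eq_abs, abs_of_nonneg h1.1]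
      exact h1.2.trans hā.2
    · filter_upwards [ae_restrict_of_ae (ae_tendsto_mollify hβ), ae_restrict_mem hmeas] with x hx hxM
      have : z.α x = β x := by rw [hβdef, indicator_of_mem (hsub hxM)]
      rw [this]
      exact hx.const_mul _
  -- convergence of the volume term with the gradient
  set f : V3 → ℝ := (cube P.b M).indicator fun x => P.profileDeriv a (inner ℝ P.n x) with hfdef
  have hfm : Measurable f :=
    ((ha.profileDeriv_measurable hP hw hā').comp (by fun_prop)).indicator hmeas
  have hfb : ∀ x, |f x| ≤ P.ℓ⁻¹ := by
    intro x
    by_cases h : x ∈ cube P.b M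
    · rw [hfdef, indicator_of_mem h]; exact ha.abs_profileDeriv_le hP hā' _
    · rw [hfdef, indicator_of_notMem h, abs_zero]; exact inv_nonneg.2 hP.ℓ_pos.le
  have hf : Integrable f := by
    refine IntegrableOn.integrable_indicator ?_ hmeas
    have := ha.integrableOn_profileDeriv_mul hP hw hā' (S := cube P.b M) (f := fun _ => 1)
      (integrable_const _)
    simpa using this
  have hfmol : ∀ m x, |mollify (bump m) f x| ≤ P.ℓ⁻¹ := by
    intro m x
    rw [mollify, ← Real.norm_eq_abs]
    refine (norm_integral_le_integral_norm _).trans ?_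
    calc ∫ t, ‖(bump m).normed volume (x - t) * f t‖
        ≤ ∫ t, (bump m).normed volume (x - t) * P.ℓ⁻¹ := by
          refine integral_mono (integrable_normed_sub_mul _ hf x).norm
            ((integrable_normed_sub _ x).mul_const _) fun t => ?_
          simp only
          rw [norm_mul, Real.norm_eq_abs, abs_of_nonneg (ContDiffBump.nonneg_normed _ _)]
          exact mul_le_mul_of_nonneg_left (hfb t) (ContDiffBump.nonneg_normed _ _)
      _ = P.ℓ⁻¹ := by rw [integral_mul_const, integral_normed_sub, one_mul]
  have hind : ∀ g : V3 → ℝ, ∫ x, f x * g x =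
      ∫ x in cube P.b M, P.profileDeriv a (inner ℝ P.n x) * g x := by
    intro g
    rw [← integral_indicator hmeas]
    refine integral_congr_ae (ae_of_all _ fun x => ?_)
    by_cases h : x ∈ cube P.b M <;> simp [hfdef, h]
  have hlim2 : Tendsto (fun m => ∫ x in cube P.b M,
      P.profileDeriv a (inner ℝ P.n x) * mollify (bump m) γ x) atTop
      (𝓝 (∫ x in cube P.b M, P.profileDeriv a (inner ℝ P.n x) * inner ℝ P.n (z.g x))) := by
    have h1 : ∫ x in cube P.b M, P.profileDeriv a (inner ℝ P.n x) * inner ℝ P.n (z.g x) =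
        ∫ x, γ x * f x := by
      simp only [mul_comm (γ _)]
      rw [hind]
      refine setIntegral_congr_fun hmeas fun x hx => ?_
      simp only [hγdef, indicator_of_mem (hsub hx)]
    rw [h1]
    -- The mollification is moved from the gradient, which is merely integrable, to the bounded
    -- function `f`. Its mollifications are bounded by `1/ℓ`, so `|γ|/ℓ` dominates.
    simp only [← hind, integral_mul_mollify _ hf hγ]
    refine tendsto_integral_of_dominated_convergence (fun x => ‖γ x‖ * P.ℓ⁻¹) (fun m => ?_)
      (hγ.norm.mul_const _) (fun m => ae_of_all _ fun x => ?_) ?_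
    · exact hγ.aestronglyMeasurable.mul (contDiff_mollify _ hf).continuous.aestronglyMeasurable
    · rw [norm_mul]
      exact mul_le_mul_of_nonneg_left (hfmol m x) (norm_nonneg _)
    · filter_upwards [ae_tendsto_mollify hf] with x hx using hx.const_mul _
  -- convergence on the mid-plane
  have hlim3 : Tendsto (fun m => ∫ y in side M ×ˢ side M,
      mollify (bump m) β (frame P.b (y, 0))) atTop (𝓝 (M ^ 2 * ā)) := by
    rw [← setIntegral_square_const M hM.le]
    have hframe : Continuous fun y : ℝ × ℝ => frame P.b (y, 0) := by
      simp only [frame_apply]; fun_prop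
    refine tendsto_integral_of_dominated_convergence (fun _ => 1) (fun m => ?_) ?_
      (fun m => ae_of_all _ fun y => ?_) ?_
    · exact ((contDiff_mollify _ hβ).continuous.comp hframe).aestronglyMeasurable
    · refine integrableOn_const ?_
      rw [Measure.volume_eq_prod, Measure.prod_prod, volume_side]
      exact ENNReal.mul_ne_top ENNReal.ofReal_ne_top ENNReal.ofReal_ne_top
    · have h1 := hmol m (frame P.b (y, 0))
      rw [Real.norm_eq_abs, abs_of_nonneg h1.1]
      exact h1.2.trans hā.2
    · have hΓ' := hΓ
      rw [midPlaneArea_eq, (measurableEmbedding_plane P.b).ae_map_iff] at hΓ'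
      have hss : side M ×ˢ side M ⊆ side P.L ×ˢ side P.L :=
        prod_mono (Ioo_subset_Ioo (by linarith) (by linarith))
          (Ioo_subset_Ioo (by linarith) (by linarith))
      filter_upwards [ae_mono (Measure.restrict_mono hss le_rfl) hΓ',
        ae_restrict_mem (measurableSet_Ioo.prod measurableSet_Ioo)] with y hy hyM
      refine tendsto_mollify_of_preciseRep P.isOpen_Ω hā.1 z.integrable_α hα ?_ hy
      refine (frame_mem_cube P.b P.L).2 ⟨hss hyM, ?_⟩
      constructor <;> simp only <;> linarith [hP.L_pos]
  -- the inequality for the mollified functions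
  have hev : ∀ᶠ m in atTop, 2 * P.slope a 0 *
      (∫ y in side M ×ˢ side M, mollify (bump m) β (frame P.b (y, 0))) -
        M ^ 2 * (2 * P.slope a (M / 2)) ≤
      (∫ x in cube P.b M, P.profileDeriv₂ ā a (inner ℝ P.n x) * mollify (bump m) β x) +
      ∫ x in cube P.b M, P.profileDeriv a (inner ℝ P.n x) * mollify (bump m) γ x := by
    -- For radii below `(L - M)/2`, balls centred in the smaller cube stay in `Ω`, where
    -- differentiation and mollification commute.
    filter_upwards [tendsto_bump_rOut.eventually_lt_const
      (show (0 : ℝ) < (P.L - M) / 2 by linarith)] with m hm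
    have hC1 := contDiff_mollify (bump m) hβ
    have hD : Continuous fun x => fderiv ℝ (mollify (bump m) β) x P.n :=
      (hC1.continuous_fderiv one_ne_zero).clm_apply continuous_const
    refine (ha.le_integral_cube_of_contDiff hP hw hā' hM hC1
      fun x => (hmol m x).2.trans hā.2).trans (le_of_eq ?_)
    rw [integral_add (ha.integrableOn_profileDeriv₂_mul hP hw hā'
        (integrableOn_cube_of_continuous P.b M hC1.continuous))
      (ha.integrableOn_profileDeriv_mul hP hw hā' (integrableOn_cube_of_continuous P.b M hD))]
    congr 1
    refine setIntegral_congr_fun hmeas fun x hx => ?_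
    rw [fderiv_mollify_eq (bump m) P.measurableSet_Ω z.integrable_α z.integrable_g z.gradient
      (closedBall_subset_cube P.b hm hx)]
  have hfinal := le_of_tendsto_of_tendsto ((hlim3.const_mul _).sub_const _) (hlim1.add hlim2) hev
  rw [integral_add (ha.integrableOn_profileDeriv₂_mul hP hw hā' (z.integrable_α.mono_set hsub))
    (ha.integrableOn_profileDeriv_mul hP hw hā' (z.integrable_inner_g.mono_set hsub))]
  linarith

/-- Integration by parts on the whole cube. -/
theorem le_integral_Ω (ha : P.IsProfile ā a) (hP : P.Standing)
    (hw : IntervalIntegrable (fun a => 1 / √(P.w a)) volume 0 1) (hā : ā ∈ Ioc (0 : ℝ) 1)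
    (hL : P.halfWidth ā ≤ P.L / 2)
    (z : P.State) (hα : ∀ᵐ x ∂volume.restrict P.Ω, 0 ≤ z.α x ∧ z.α x ≤ ā)
    (hΓ : ∀ᵐ x ∂midPlaneArea P.b P.L, preciseRep z.α x = ā) :
    P.L ^ 2 * (2 * P.slope a 0 * ā) ≤
      ∫ x in P.Ω, (P.profileDeriv₂ ā a (inner ℝ P.n x) * z.α x +
        P.profileDeriv a (inner ℝ P.n x) * inner ℝ P.n (z.g x)) := by
  have hā' := Ioc_subset_Icc_self hā
  have hLp := hP.L_pos
  -- Cubes increasing to `Ω`; the `2` in the denominator keeps the first side positive.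
  set M : ℕ → ℝ := fun m => P.L - P.L / (m + 2) with hMdef
  have hM : ∀ m, 0 < M m ∧ M m < P.L := by
    intro m
    have h1 : P.L / (m + 2) < P.L := div_lt_self hLp (by have : (0:ℝ) ≤ m := m.cast_nonneg; linarith)
    have h2 : 0 < P.L / (m + 2) := by positivity
    exact ⟨by simp only [hMdef]; linarith, by simp only [hMdef]; linarith⟩
  have hMlim : Tendsto M atTop (𝓝 P.L) := by
    have h1 : Tendsto (fun m : ℕ => P.L / ((m : ℝ) + 2)) atTop (𝓝 0) :=
      tendsto_const_nhds.div_atTop (tendsto_atTop_add_const_right _ _ tendsto_natCast_atTop_atTop)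
    simpa using h1.const_sub P.L
  have hMmono : Monotone M := by
    intro m m' h
    simp only [hMdef]
    gcongr
  have hunion : ⋃ m, cube P.b (M m) = P.Ω := by
    refine Subset.antisymm (iUnion_subset fun m => cube_subset_cube P.b (hM m).2.le) ?_
    intro x hx
    have hev : ∀ i, ∀ᶠ m in atTop, |inner ℝ (P.b i) x| < M m / 2 := fun i =>
      (hMlim.div_const 2).eventually_const_lt (hx i)
    obtain ⟨m, hm⟩ := (eventually_all.2 hev).exists
    exact mem_iUnion.2 ⟨m, hm⟩
  have hInt : IntegrableOn (fun x => P.profileDeriv₂ ā a (inner ℝ P.n x) * z.α x +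
      P.profileDeriv a (inner ℝ P.n x) * inner ℝ P.n (z.g x)) P.Ω :=
    (ha.integrableOn_profileDeriv₂_mul hP hw hā' z.integrable_α).add
      (ha.integrableOn_profileDeriv_mul hP hw hā' z.integrable_inner_g)
  have hlim := tendsto_setIntegral_of_monotone (μ := volume)
    (fun m => measurableSet_cube P.b (M m)) (fun m m' h => cube_subset_cube P.b (hMmono h))
    (by rw [hunion]; exact hInt)
  rw [hunion] at hlim
  -- The terms on the faces disappear because the profile vanishes from the half-width on, which is
  -- at most `L/2`.
  have hslope : Tendsto (fun m => P.slope a (M m / 2)) atTop (𝓝 0) := by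
    have h0 : P.slope a (P.L / 2) = 0 := ha.slope_eq_zero hP (hL.trans (le_abs_self _))
    rw [← h0]
    exact ((ha.slope_continuous hP hw hā').tendsto _).comp (hMlim.div_const 2)
  have hlhs : Tendsto (fun m => M m ^ 2 * (2 * P.slope a 0 * ā) - M m ^ 2 * (2 * P.slope a (M m / 2)))
      atTop (𝓝 (P.L ^ 2 * (2 * P.slope a 0 * ā) - P.L ^ 2 * (2 * 0))) :=
    ((hMlim.pow 2).mul_const _).sub ((hMlim.pow 2).mul (hslope.const_mul 2))
  rw [mul_zero, mul_zero, sub_zero] at hlhs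
  exact le_of_tendsto_of_tendsto' hlhs hlim fun m =>
    ha.le_integral_cube hP hw hā z hα hΓ (hM m).1 (hM m).2

/-- The profile itself turns the inequality of `le_integral_Ω` into an equality, so in the
linearized energy the competitor's linear terms are at least those of the profile. -/
theorem integral_by_parts_self (ha : P.IsProfile ā a) (hP : P.Standing)
    (hw : IntervalIntegrable (fun a => 1 / √(P.w a)) volume 0 1) (hā : ā ∈ Ioc (0 : ℝ) 1)
    (hL : P.halfWidth ā ≤ P.L / 2) :
    ∫ x in P.Ω, (P.profileDeriv₂ ā a (inner ℝ P.n x) * a (inner ℝ P.n x) +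
        P.profileDeriv a (inner ℝ P.n x) * P.profileDeriv a (inner ℝ P.n x)) =
      P.L ^ 2 * (2 * P.slope a 0 * ā) := by
  have hā' := Ioc_subset_Icc_self hā
  rw [Ω, n, setIntegral_cube_normal P.b P.L hP.L_pos.le
    (fun r => P.profileDeriv₂ ā a r * a r + P.profileDeriv a r * P.profileDeriv a r),
    ha.integral_by_parts hP hw hā' (by linarith [hP.L_pos]) (ha.continuous hP hw hā')
      (S := {0, P.halfWidth ā, -P.halfWidth ā}) (Set.toFinite _).countable ?_
      (intervalIntegrable_of_bdd (ha.profileDeriv_measurable hP hw hā')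
        (ha.abs_profileDeriv_le hP hā')),
    ha.slope_eq_zero hP (hL.trans (le_abs_self _)), ha.at_zero hP hw hā]
  · ring
  · intro x hx
    simp only [mem_insert_iff, mem_singleton_iff, not_or] at hx
    refine ha.hasDerivAt hP hw hā' hx.1 fun h => ?_
    rcases abs_choice x with h' | h' <;> rw [h'] at h
    · exact hx.2.1 h
    · exact hx.2.2 (by linarith)

theorem continuous_w_comp (ha : P.IsProfile ā a) (hP : P.Standing)
    (hw : IntervalIntegrable (fun a => 1 / √(P.w a)) volume 0 1) (hā : ā ∈ Icc (0 : ℝ) 1) :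
    Continuous fun r => P.w (a r) / P.ℓ :=
  (hP.constitutive.w_smooth.continuousOn.comp_continuous (ha.continuous hP hw hā)
    (ha.mem_unit hā)).div_const _

end IsProfile

/-! ### Lower bounds for the phase-field energy and for the total energy -/

namespace Standing

/-- Lower bound of the phase-field energy of the states with maximal damage `b`. -/
theorem phaseField_le (hP : P.Standing)
    (hw : IntervalIntegrable (fun a => 1 / √(P.w a)) volume 0 1)
    (hL : 2 * P.ℓ * cStar P.w ≤ P.L) (z : P.State) {b : ℝ} (hb : b ∈ Icc (0 : ℝ) 1)
    (hα : ∀ᵐ x ∂volume.restrict P.Ω, 0 ≤ z.α x ∧ z.α x ≤ b)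
    (hΓ : ∀ᵐ x ∂midPlaneArea P.b P.L, preciseRep z.α x = b) :
    ENNReal.ofReal (P.Gc * P.L ^ 2 / cW P.w * ∫ a in (0 : ℝ)..b, √(P.w a)) ≤
      ∫⁻ x in P.Ω, ENNReal.ofReal
        (P.Gc / (4 * cW P.w) * (P.w (z.α x) / P.ℓ + P.ℓ * ‖z.g x‖ ^ 2)) := by
  -- For `b = 0` the bound is zero; otherwise the profile has positive width.
  rcases hb.1.eq_or_lt with rfl | hb0
  · simp
  have hb' : b ∈ Ioc (0 : ℝ) 1 := ⟨hb0, hb.2⟩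
  obtain ⟨a, ha⟩ := exists_isProfile hw hb
  have hR := hP.halfWidth_le hw hL hb
  have hc : 0 ≤ P.Gc / (4 * cW P.w) := by
    have := hP.Gc_pos; have := hP.constitutive.cW_pos; positivity
  set X : V3 → ℝ := fun x => P.profileDeriv₂ b a (inner ℝ P.n x) * z.α x +
    P.profileDeriv a (inner ℝ P.n x) * inner ℝ P.n (z.g x) with hX
  set Y : V3 → ℝ := fun x => P.profileDeriv₂ b a (inner ℝ P.n x) * a (inner ℝ P.n x) +
    P.profileDeriv a (inner ℝ P.n x) * P.profileDeriv a (inner ℝ P.n x) with hY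
  set W : V3 → ℝ := fun x => P.w (a (inner ℝ P.n x)) / P.ℓ with hW
  have hXi : IntegrableOn X P.Ω :=
    (ha.integrableOn_profileDeriv₂_mul hP hw hb z.integrable_α).add
      (ha.integrableOn_profileDeriv_mul hP hw hb z.integrable_inner_g)
  have hYi : IntegrableOn Y P.Ω := by
    refine (ha.integrableOn_profileDeriv₂_mul hP hw hb (integrableOn_cube_of_continuous _ _
      ((ha.continuous hP hw hb).comp (by fun_prop)))).add
      (ha.integrableOn_profileDeriv_mul hP hw hb ?_)
    have := ha.integrableOn_profileDeriv_mul hP hw hb (S := cube P.b P.L) (f := fun _ => 1)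
      (integrable_const _)
    simpa using this
  have hWi : IntegrableOn W P.Ω := integrableOn_cube_of_continuous _ _
    ((ha.continuous_w_comp hP hw hb).comp (by fun_prop))
  have hlow : Integrable (fun x => P.Gc / (4 * cW P.w) *
      (2 * W x + 2 * P.ℓ * X x - 2 * P.ℓ * Y x)) (volume.restrict P.Ω) :=
    (((hWi.const_mul 2).add (hXi.const_mul (2 * P.ℓ))).sub (hYi.const_mul (2 * P.ℓ))).const_mul _
  refine le_trans (ENNReal.ofReal_le_ofReal ?_) ((ofReal_integral_le_lintegral hlow).trans
    (lintegral_mono_ae ?_))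
  · have e1 : ∫ x in P.Ω, W x = P.L ^ 2 * (2 * ∫ β in (0 : ℝ)..b, √(P.w β)) := by
      rw [hW, Ω, n, setIntegral_cube_normal P.b P.L hP.L_pos.le (fun r => P.w (a r) / P.ℓ),
        ha.integral_w hP hw hb' hR]
    have e2 := ha.integral_by_parts_self hP hw hb' hR
    have e3 := ha.le_integral_Ω hP hw hb' hR z hα hΓ
    have hWX : IntegrableOn (fun x => 2 * W x + 2 * P.ℓ * X x) P.Ω :=
      (hWi.const_mul 2).add (hXi.const_mul (2 * P.ℓ))
    rw [integral_const_mul, integral_sub hWX (hYi.const_mul (2 * P.ℓ)), integral_add (hWi.const_mul 2) (hXi.const_mul (2 * P.ℓ)),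
      integral_const_mul, integral_const_mul, integral_const_mul, e1, e2]
    have hl := hP.ℓ_pos
    have h1 := mul_le_mul_of_nonneg_left e3 (by positivity : 0 ≤ 2 * P.ℓ)
    calc P.Gc * P.L ^ 2 / cW P.w * ∫ a in (0 : ℝ)..b, √(P.w a)
        = P.Gc / (4 * cW P.w) * (2 * (P.L ^ 2 * (2 * ∫ β in (0 : ℝ)..b, √(P.w β)))) := by
          have := hP.constitutive.cW_pos
          field_simp
          ring
      _ ≤ _ := mul_le_mul_of_nonneg_left (by linarith) hc
  · filter_upwards [hα] with x hx
    refine ENNReal.ofReal_le_ofReal (mul_le_mul_of_nonneg_left ?_ hc)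
    refine (ha.energy_density_le hP hb (inner ℝ P.n x) (β := z.α x) (γ := inner ℝ P.n (z.g x))
      ⟨hx.1, hx.2.trans hb.2⟩).trans ?_
    -- Only the normal component of the gradient is kept, since the profile depends on the normal
    -- coordinate alone.
    have h1 : inner ℝ P.n (z.g x) ^ 2 ≤ ‖z.g x‖ ^ 2 := by
      rw [sq_le_sq, abs_norm]
      refine (abs_real_inner_le_norm _ _).trans ?_
      rw [n, P.b.norm_eq_one, one_mul]
    gcongr
    exact hP.ℓ_pos.le

/-- The reduced energy bounds the energy of every competitor from below. -/
theorem redEnergy_le_energy (hP : P.Standing)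
    (hw : IntervalIntegrable (fun a => 1 / √(P.w a)) volume 0 1)
    (hL : 2 * P.ℓ * cStar P.w ≤ P.L) (z : P.State) {t b : ℝ} (hb : b ∈ Icc (0 : ℝ) 1)
    (ht : P.HasAverageStrain t z)
    (hα : ∀ᵐ x ∂volume.restrict P.Ω, 0 ≤ z.α x ∧ z.α x ≤ b)
    (hΓ : ∀ᵐ x ∂midPlaneArea P.b P.L, preciseRep z.α x = b) :
    ENNReal.ofReal (P.redEnergy t b) ≤ P.energy z := by
  -- The multiplier is the one appearing in the nonlinear bound, so that the strains `e` and `p`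
  -- enter the sum only through the prescribed average strain.
  have h1 := hP.elastic_le z (P.k b * P.σc)
  have h2 := hP.nonlinear_le z hb hα
  have h3 := hP.phaseField_le hw hL z hb hα hΓ
  refine le_trans ?_ (add_le_add (add_le_add h1 h2) h3)
  -- The separate elastic and nonlinear bounds may be negative; subadditivity of `ENNReal.ofReal`
  -- needs no sign.
  refine le_trans (ENNReal.ofReal_le_ofReal (le_of_eq ?_))
    (ENNReal.ofReal_add_le.trans (add_le_add ENNReal.ofReal_add_le le_rfl))
  have h4 := z.integral_ddot_e_add P.s
  have h5 : ∑ i, ∑ j, P.s.1 i j * z.E.comp i j P.Ω = P.L ^ 3 * t := by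
    rw [← ht]
    have := hP.L_pos
    field_simp
  rw [redEnergy, hP.epsE_eq]
  rw [h5] at h4
  linear_combination -P.k b * P.σc * h4

end Standing

end Problem

/-! ### Test functions determine integrable functions -/

theorem ae_eq_of_integral_test {Ω : Set V3} (hΩ : IsOpen Ω) {f g : V3 → ℝ} (hf : IntegrableOn f Ω)
    (hg : IntegrableOn g Ω)
    (h : ∀ φ, IsTest Ω φ → ∫ x in Ω, f x * φ x = ∫ x in Ω, g x * φ x) :
    f =ᵐ[volume.restrict Ω] g := by
  have h0 : ∀ᵐ x, x ∈ Ω → f x - g x = 0 := by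
    refine hΩ.ae_eq_zero_of_integral_contDiff_smul_eq_zero (hf.sub hg).locallyIntegrableOn ?_
    intro φ h1 h2 h3
    have hφ : IsTest Ω φ := ⟨h1, h2, h3⟩
    obtain ⟨C, hC⟩ := h1.continuous.bounded_above_of_compact_support h2
    have h4 := h φ hφ
    have hi : ∀ {k : V3 → ℝ}, IntegrableOn k Ω → IntegrableOn (fun x => k x * φ x) Ω := fun hk =>
      hk.mul_bdd h1.continuous.aestronglyMeasurable (ae_of_all _ hC)
    have h5 := hφ.setIntegral_mul (fun x => f x - g x)
    simp only [smul_eq_mul, mul_comm (φ _)]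
    rw [← h5]
    simp only [sub_mul]
    rw [integral_sub (hi hf) (hi hg), h4, sub_self]
  rw [EventuallyEq, ae_restrict_iff' hΩ.measurableSet]
  filter_upwards [h0] with x hx hxΩ using sub_eq_zero.1 (hx hxΩ)

theorem preciseRep_eq_of_continuous {Ω : Set V3} (hΩ : IsOpen Ω) {β f : V3 → ℝ} (hf : Continuous f)
    (hβ : β =ᵐ[volume.restrict Ω] f) {x : V3} (hx : x ∈ Ω) : preciseRep β x = f x := by
  refine preciseRep_eq_of_tendsto (Metric.tendsto_nhds.2 fun ε hε => ?_)
  obtain ⟨δ, hδ, hδ'⟩ := Metric.continuous_iff.1 hf x (ε / 2) (half_pos hε)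
  filter_upwards [eventually_ball_subset hΩ hx, Ioo_mem_nhdsGT hδ] with r hr hrδ
  have h1 : ∀ᵐ y ∂volume.restrict (Metric.ball x r), β y = f y :=
    ae_mono (Measure.restrict_mono hr.2 le_rfl) hβ
  have hfi : IntegrableOn f (Metric.ball x r) :=
    (hf.locallyIntegrable.integrableOn_isCompact (isCompact_closedBall x r)).mono_set
      Metric.ball_subset_closedBall
  have h2 : ⨍ y in Metric.ball x r, β y ∈ Metric.closedBall (f x) (ε / 2) := by
    refine (convex_closedBall _ _).set_average_mem Metric.isClosed_closedBall
      (Metric.measure_ball_pos _ _ hr.1).ne' measure_ball_lt_top.ne ?_ (hfi.congr (h1.mono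
        fun y hy => hy.symm))
    filter_upwards [h1, ae_restrict_mem Metric.isOpen_ball.measurableSet] with y hy hyb
    rw [hy]
    exact (hδ' y ((Metric.mem_ball.1 hyb).trans hrδ.2)).le
  exact (Metric.mem_closedBall.1 h2).trans_lt (half_lt_self hε)

namespace Problem

variable {P : Problem}

theorem IsMaxDamage.mem_Ioc {t ā : ℝ} (h : P.IsMaxDamage t ā) : ā ∈ Ioc (0 : ℝ) 1 := by
  rcases h with ⟨h, -⟩ | ⟨rfl, -⟩
  · exact Ioo_subset_Ioc_self h
  · exact ⟨one_pos, le_rfl⟩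

/-! ### Sign and energy of the displacement jump -/

namespace Standing

/-- For unit vectors, pairing `n ⊙ d₀` with `n ⊗ d₀` gives `(1 + (n · d₀)²)/2 > 0`. -/
theorem symProd_ne_zero (hP : P.Standing) : symProd P.n P.d₀ ≠ 0 := by
  intro h
  have hn : ‖P.n‖ = 1 := P.b.norm_eq_one 0
  have hd := hP.d₀_unit
  have h1 : ∀ i j, (P.n i * P.d₀ j + P.d₀ i * P.n j) / 2 = 0 := fun i j => by
    have := congrArg (fun M : M3s => M.1 i j) h
    simpa [symProd] using this
  have h2 : ∑ i, ∑ j, (P.n i * P.d₀ j + P.d₀ i * P.n j) / 2 * (P.n i * P.d₀ j) = 0 :=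
    Finset.sum_eq_zero fun i _ => Finset.sum_eq_zero fun j _ => by rw [h1, zero_mul]
  have hn2 : ∑ i, P.n i ^ 2 = 1 := by
    rw [← EuclideanSpace.real_norm_sq_eq, hn, one_pow]
  have hd2 : ∑ i, P.d₀ i ^ 2 = 1 := by
    rw [← EuclideanSpace.real_norm_sq_eq, hd, one_pow]
  have h3 : ∑ i, ∑ j, (P.n i * P.d₀ j + P.d₀ i * P.n j) / 2 * (P.n i * P.d₀ j) =
      ((∑ i, P.n i ^ 2) * (∑ j, P.d₀ j ^ 2) + (∑ i, P.n i * P.d₀ i) ^ 2) / 2 := by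
    simp only [Fin.sum_univ_three]
    ring
  rw [h3, hn2, hd2] at h2
  nlinarith [sq_nonneg (∑ i, P.n i * P.d₀ i)]

/-- With `ν = n ⊙ d₀`, small multiples `δν` lie in `K`, and the normal-cone inequality at `δν` gives
`σc s·ν ≥ δ ν·ν > 0`. This makes the division in `jump` legitimate. -/
theorem traction_pos (hP : P.Standing) : 0 < traction P.s P.n P.d₀ := by
  rw [traction_eq_ddot]
  set ν := symProd P.n P.d₀ with hν
  have hcont : Tendsto (fun δ : ℝ => δ • ν) (𝓝[>] 0) (𝓝 0) := by
    have : Continuous fun δ : ℝ => δ • ν := by fun_prop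
    have h := this.tendsto 0
    rw [zero_smul] at h
    exact h.mono_left nhdsWithin_le_nhds
  obtain ⟨δ, hδK, hδ⟩ := ((hcont.eventually (mem_interior_iff_mem_nhds.1 hP.K_zero)).and
    self_mem_nhdsWithin).exists
  have h1 := hP.normal _ hδK
  rw [ddot_sub_left, ddot_smul_left, ddot_smul_left] at h1
  have h2 := mul_pos (show 0 < δ from hδ) (ddot_self_pos hP.symProd_ne_zero)
  have h3 := hP.σc_pos
  exact pos_of_mul_pos_right (a := P.σc) (by linarith) h3.le

/-- The normal-cone condition says exactly that the supremum in the direction `n ⊙ d₀` is attained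
at `σc s`. The nonlinear bound is therefore sharp. -/
theorem supportFun_smul (hP : P.Standing) {c : ℝ} (hc : 0 ≤ c) :
    supportFun P.K (c • symProd P.n P.d₀) =
      ENNReal.ofReal (c * (P.σc * traction P.s P.n P.d₀)) := by
  refine le_antisymm (iSup₂_le fun τ hτ => ENNReal.ofReal_le_ofReal ?_) ?_
  · have h1 := hP.normal τ hτ
    rw [ddot_sub_left, ddot_smul_left] at h1
    rw [ddot_smul_right, traction_eq_ddot]
    exact mul_le_mul_of_nonneg_left (by linarith) hc
  · refine le_trans (le_of_eq ?_)
      (le_supportFun (hP.K_closed.frontier_subset hP.σc_mem) (c • symProd P.n P.d₀))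
    rw [ddot_smul_right, ddot_smul_left, traction_eq_ddot]

theorem jump_pos (hP : P.Standing) {t ā : ℝ} (ht : P.epsE < t) (hā : ā ∈ Ioc (0 : ℝ) 1) :
    0 < P.jump t ā := by
  have h1 := hP.constitutive.k_le_one (Ioc_subset_Icc_self hā)
  have h2 : P.k ā * P.epsE ≤ P.epsE := mul_le_of_le_one_left hP.epsE_pos.le h1
  exact div_pos (mul_pos hP.L_pos (by linarith)) hP.traction_pos

theorem jump_mul_traction (hP : P.Standing) (t ā : ℝ) :
    P.jump t ā * traction P.s P.n P.d₀ = P.L * (t - P.k ā * P.epsE) :=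
  div_mul_cancel₀ _ hP.traction_pos.ne'

end Standing

/-! ### The nonlinear strain of the localized response -/

theorem locPlastic_apply (P : Problem) (hL : 0 < P.L) (t ā : ℝ) (i j : Fin 3) :
    (P.locPlastic t ā).comp i j P.Ω =
      P.L ^ 2 * (P.jump t ā * (symProd P.n P.d₀).1 i j) := by
  simp only [locPlastic]
  rw [withDensityᵥ_apply (integrable_const _) P.measurableSet_Ω, Ω,
    midPlaneArea_restrict_cube P.b P.L hL, integral_midPlaneArea, setIntegral_square_const _ hL.le]

theorem locPlastic_carried (P : Problem) (hL : 0 < P.L) (t ā : ℝ) (i j : Fin 3) :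
    ((P.locPlastic t ā).comp i j).restrict P.Ω = (P.locPlastic t ā).comp i j := by
  ext S hS
  rw [VectorMeasure.restrict_apply _ P.measurableSet_Ω hS]
  simp only [locPlastic]
  rw [withDensityᵥ_apply (integrable_const _) (hS.inter P.measurableSet_Ω),
    withDensityᵥ_apply (integrable_const _) hS, ← Measure.restrict_restrict hS, Ω,
    midPlaneArea_restrict_cube P.b P.L hL]

theorem locPlastic_dom (P : Problem) (t ā : ℝ) :
    (P.locPlastic t ā).dom =
      ENNReal.ofReal (∑ i, ∑ j, |P.jump t ā * (symProd P.n P.d₀).1 i j|) • midPlaneArea P.b P.L := by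
  have h1 : ∀ i j, ((P.locPlastic t ā).comp i j).totalVariation =
      ENNReal.ofReal |P.jump t ā * (symProd P.n P.d₀).1 i j| • midPlaneArea P.b P.L := by
    intro i j
    rw [SignedMeasure.totalVariation_eq_variation]
    simp only [locPlastic]
    rw [Measure.variation_withDensityᵥ (integrable_const _), withDensity_const,
      Real.enorm_eq_ofReal_abs]
  simp only [TensorMeasure.dom, h1]
  rw [ENNReal.ofReal_sum_of_nonneg fun i _ => Finset.sum_nonneg fun j _ => abs_nonneg _,
    Finset.sum_smul]
  refine Finset.sum_congr rfl fun i _ => ?_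
  rw [ENNReal.ofReal_sum_of_nonneg fun j _ => abs_nonneg _, Finset.sum_smul]

namespace Standing

theorem locPlastic_mass_pos (hP : P.Standing) {t ā : ℝ} (hJ : 0 < P.jump t ā) :
    0 < ∑ i, ∑ j, |P.jump t ā * (symProd P.n P.d₀).1 i j| := by
  have h0 : 0 ≤ ∑ i, ∑ j, |P.jump t ā * (symProd P.n P.d₀).1 i j| :=
    Finset.sum_nonneg fun i _ => Finset.sum_nonneg fun j _ => abs_nonneg _
  refine h0.lt_of_ne fun h => hP.symProd_ne_zero ?_
  ext i j
  have h2 := (Finset.sum_eq_zero_iff_of_nonneg (fun i _ =>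
    Finset.sum_nonneg fun j _ => abs_nonneg _)).1 h.symm i (Finset.mem_univ i)
  have h3 := (Finset.sum_eq_zero_iff_of_nonneg (fun j _ => abs_nonneg _)).1 h2 j (Finset.mem_univ j)
  rw [abs_eq_zero] at h3
  simpa [hJ.ne'] using h3

/-- The tensor is constant along the mid-plane; the denominator normalizes by the constant density
of `dom` with respect to area. -/
theorem locPlastic_density (hP : P.Standing) {t ā : ℝ} (hJ : 0 < P.jump t ā) :
    ∀ᵐ x ∂(P.locPlastic t ā).dom, (P.locPlastic t ā).density x =
      (P.jump t ā / ∑ i, ∑ j, |P.jump t ā * (symProd P.n P.d₀).1 i j|) • symProd P.n P.d₀ := by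
  set C := ∑ i, ∑ j, |P.jump t ā * (symProd P.n P.d₀).1 i j| with hC
  have hCpos : 0 < C := hP.locPlastic_mass_pos hJ
  have hcomp : ∀ i j, ∀ᵐ x ∂(P.locPlastic t ā).dom,
      ((P.locPlastic t ā).comp i j).rnDeriv (P.locPlastic t ā).dom x =
        P.jump t ā / C * (symProd P.n P.d₀).1 i j := by
    intro i j
    refine (SignedMeasure.integrable_rnDeriv _ _).ae_eq_of_withDensityᵥ_eq (integrable_const _) ?_
    rw [TensorMeasure.withDensityᵥ_density]
    ext S hS
    rw [withDensityᵥ_apply (integrable_const _) hS, setIntegral_const, locPlastic_dom,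
      measureReal_ennreal_smul_apply, ← hC, ENNReal.toReal_ofReal hCpos.le]
    simp only [locPlastic]
    rw [withDensityᵥ_apply (integrable_const _) hS, setIntegral_const, smul_eq_mul, smul_eq_mul]
    field_simp
  have hall := ae_all_iff.2 fun i => ae_all_iff.2 fun j => hcomp i j
  filter_upwards [hall] with x hx
  ext i j
  simpa [TensorMeasure.density] using hx i j

/-- The nonlinear energy of a state whose nonlinear strain is that of the localized response. -/
theorem nonlinear_eq (hP : P.Standing) {t ā : ℝ} (hā : ā ∈ Icc (0 : ℝ) 1) (hJ : 0 < P.jump t ā)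
    {β : V3 → ℝ} (hβ : ∀ᵐ x ∂midPlaneArea P.b P.L, preciseRep β x = ā) :
    ∫⁻ x in P.Ω, ENNReal.ofReal (P.k (preciseRep β x)) *
        supportFun P.K ((P.locPlastic t ā).density x) ∂(P.locPlastic t ā).dom =
      ENNReal.ofReal (P.L ^ 2 * (P.k ā * P.σc * (P.jump t ā * traction P.s P.n P.d₀))) := by
  have hLp := hP.L_pos
  have hk := hP.constitutive.k_nonneg hā
  have hτ := hP.traction_pos
  have hσ := hP.σc_pos
  have hCpos := hP.locPlastic_mass_pos hJ
  have hden := hP.locPlastic_density hJ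
  have hdom := P.locPlastic_dom t ā
  set C := ∑ i, ∑ j, |P.jump t ā * (symProd P.n P.d₀).1 i j| with hC
  have hβ' : ∀ᵐ x ∂(P.locPlastic t ā).dom, preciseRep β x = ā := by
    rw [hdom]; exact Measure.ae_smul_measure hβ _
  have hres : (P.locPlastic t ā).dom.restrict P.Ω = (P.locPlastic t ā).dom := by
    rw [hdom, Measure.restrict_smul, Ω, midPlaneArea_restrict_cube P.b P.L hLp]
  rw [hres]
  have hcong : ∫⁻ x, ENNReal.ofReal (P.k (preciseRep β x)) *
        supportFun P.K ((P.locPlastic t ā).density x) ∂(P.locPlastic t ā).dom =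
      ∫⁻ _, ENNReal.ofReal (P.k ā * (P.jump t ā / C * (P.σc * traction P.s P.n P.d₀)))
        ∂(P.locPlastic t ā).dom := by
    refine lintegral_congr_ae ?_
    filter_upwards [hβ', hden] with x h1 h2
    rw [h1, h2, hP.supportFun_smul (by positivity), ← ENNReal.ofReal_mul hk]
  rw [hcong, lintegral_const, hdom, Measure.smul_apply, midPlaneArea_univ, smul_eq_mul,
    ← ENNReal.ofReal_mul hLp.le, ← ENNReal.ofReal_mul hCpos.le, ← ENNReal.ofReal_mul (by positivity)]
  congr 1
  field_simp

end Standing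

/-! ### The strain of the localized response -/

/-- The uniform elastic strain of the localized response. -/
noncomputable def locElastic (P : Problem) (ā : ℝ) : M3s := (P.k ā * P.σc) • P.A.symm P.s

theorem locDisp_apply (P : Problem) (t ā : ℝ) (x : V3) (i : Fin 3) :
    P.locDisp t ā x i = (∑ k, (P.locElastic ā).1 i k * x k) +
      P.jump t ā * P.d₀ i * (if 0 < inner ℝ P.n x then (1 : ℝ) else 0) := by
  simp only [locDisp, locElastic, PiLp.add_apply, Pi.smul_apply, smul_eq_mul, Matrix.mulVec,
    dotProduct, PiLp.smul_apply, Submodule.coe_smul, Matrix.smul_apply, Finset.mul_sum, mul_assoc]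
  split_ifs <;> simp

/-- The linear part is integrated by parts as a Lipschitz function, and the jump part through the
half-space formula. Symmetrizing in `i` and `j` turns `d₀ ⊗ n` into `n ⊙ d₀`. -/
theorem integral_locDisp (P : Problem) (t ā : ℝ) {φ : V3 → ℝ} (hφ : IsTest P.Ω φ) (i j : Fin 3) :
    - ∫ x in P.Ω, (P.locDisp t ā x i * partialD j φ x + P.locDisp t ā x j * partialD i φ x) / 2 =
      (∫ x in P.Ω, (P.locElastic ā).1 i j * φ x) +
        P.jump t ā * (symProd P.n P.d₀).1 i j * ∫ x, φ x ∂midPlaneArea P.b P.L := by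
  set T := (P.locElastic ā).1 with hT
  have hTs : ∀ i j, T i j = T j i := fun i j => ((P.locElastic ā).2.apply i j).symm
  set χ : V3 → ℝ := fun x => if 0 < inner ℝ P.n x then (1 : ℝ) else 0 with hχ
  have hχm : Measurable χ :=
    Measurable.ite (isOpen_lt continuous_const (by fun_prop)).measurableSet measurable_const
      measurable_const
  have hχb : ∀ x, ‖χ x‖ ≤ 1 := fun x => by simp only [hχ]; split_ifs <;> simp
  set lin : Fin 3 → V3 →L[ℝ] ℝ := fun i => ∑ k, T i k • EuclideanSpace.proj (𝕜 := ℝ) k with hlin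
  have hlin' : ∀ i x, lin i x = ∑ k, T i k * x k := fun i x => by
    simp [hlin]
  have hlinint : ∀ i j, Integrable fun x => lin i x * partialD j φ x := fun i j =>
    ((lin i).continuous.mul (hφ.continuous_fderiv_apply _)).integrable_of_hasCompactSupport
      (hφ.hasCompactSupport_fderiv_apply _).mul_left
  have hχint : ∀ j, Integrable fun x => χ x * partialD j φ x := fun j =>
    (hφ.integrable_fderiv_apply _).bdd_mul (c := 1) hχm.aestronglyMeasurable (ae_of_all _ hχb)
  have h1 : ∀ i j, ∫ x in P.Ω, lin i x * partialD j φ x = - ∫ x in P.Ω, T i j * φ x := by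
    intro i j
    refine hφ.integral_mul_fderiv (lin i).lipschitz (ae_of_all _ fun x => ?_)
    have h := (lin i).hasFDerivAt (x := x) |>.hasLineDerivAt (EuclideanSpace.single j (1 : ℝ))
    have e : lin i (EuclideanSpace.single j (1 : ℝ)) = T i j := by
      rw [hlin']; simp
    rwa [e] at h
  have h2 : ∀ j, ∫ x in P.Ω, χ x * partialD j φ x =
      - (P.n j * ∫ x, φ x ∂midPlaneArea P.b P.L) := by
    intro j
    have h := IsTest.integral_halfSpace P.b hφ (EuclideanSpace.single j (1 : ℝ))
    have e : inner ℝ (P.b 0) (EuclideanSpace.single j (1 : ℝ)) = P.n j := by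
      simp [EuclideanSpace.inner_single_right, n]
    rwa [e] at h
  have h3 : ∀ i j, ∫ x in P.Ω, P.locDisp t ā x i * partialD j φ x =
      - (∫ x in P.Ω, T i j * φ x) -
        P.jump t ā * P.d₀ i * P.n j * ∫ x, φ x ∂midPlaneArea P.b P.L := by
    intro i j
    have e : ∀ x, P.locDisp t ā x i * partialD j φ x =
        lin i x * partialD j φ x + P.jump t ā * P.d₀ i * (χ x * partialD j φ x) := fun x => by
      rw [locDisp_apply, hlin']; ring
    simp only [e]
    rw [integral_add (hlinint i j).integrableOn ((hχint j).const_mul _).integrableOn, h1,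
      integral_const_mul (P.jump t ā * P.d₀ i), h2]
    ring
  have hInt : ∀ i j, IntegrableOn (fun x => P.locDisp t ā x i * partialD j φ x) P.Ω := by
    intro i j
    have e : (fun x => P.locDisp t ā x i * partialD j φ x) = fun x =>
        lin i x * partialD j φ x + P.jump t ā * P.d₀ i * (χ x * partialD j φ x) := by
      funext x; rw [locDisp_apply, hlin']; ring
    rw [e]
    exact ((hlinint i j).add ((hχint j).const_mul _)).integrableOn
  rw [integral_div, integral_add (hInt i j) (hInt j i), h3, h3]
  simp only [hTs j i, symProd, Matrix.of_apply]
  ring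

theorem integral_add_locPlastic (P : Problem) (t ā : ℝ) {e : V3 → ℝ}
    (he : IntegrableOn e P.Ω) {φ : V3 → ℝ} (hφ : IsTest P.Ω φ) (i j : Fin 3) :
    VectorMeasure.integral ((volume.restrict P.Ω).withDensityᵥ e + (P.locPlastic t ā).comp i j) φ
        (ContinuousLinearMap.lsmul ℝ ℝ) =
      (∫ x in P.Ω, e x * φ x) +
        P.jump t ā * (symProd P.n P.d₀).1 i j * ∫ x, φ x ∂midPlaneArea P.b P.L := by
  have hc := hφ.1.continuous
  have h1 : VectorMeasure.Integrable ((P.locPlastic t ā).comp i j) φ :=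
    integrable_variation_withDensityᵥ (integrable_const _) hc hφ.2.1
  have h2 : VectorMeasure.integral ((P.locPlastic t ā).comp i j) φ
      (ContinuousLinearMap.lsmul ℝ ℝ) =
      P.jump t ā * (symProd P.n P.d₀).1 i j * ∫ x, φ x ∂midPlaneArea P.b P.L :=
    (integral_withDensityᵥ (integrable_const _) hc hφ.2.1).trans (integral_const_mul _ _)
  rw [VectorMeasure.integral_add_vectorMeasure (integrable_variation_withDensityᵥ he hc hφ.2.1) h1,
    integral_withDensityᵥ he hc hφ.2.1, h2]

/-! ### The gradient of the phase field of the localized response -/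

/-- The phase field is Lipschitz and the chain rule holds off three planes, a null set. -/
theorem IsProfile.isWeakGradient {ā : ℝ} {a : ℝ → ℝ} (ha : P.IsProfile ā a) (hP : P.Standing)
    (hw : IntervalIntegrable (fun a => 1 / √(P.w a)) volume 0 1) (hā : ā ∈ Icc (0 : ℝ) 1) :
    IsWeakGradient P.Ω (fun x => a (inner ℝ P.n x))
      (fun x => P.profileDeriv a (inner ℝ P.n x) • P.n) := by
  intro φ hφ i
  have hlip := (ha.lipschitz hP hw hā).comp (innerSL ℝ P.n).lipschitz
  have h := hφ.integral_mul_fderiv hlip (v := EuclideanSpace.single i (1 : ℝ))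
    (f' := fun x => P.profileDeriv a (inner ℝ P.n x) * P.n i) ?_
  · simpa [partialD] using h
  · filter_upwards [ae_inner_ne P.b 0, ae_inner_ne P.b (P.halfWidth ā),
      ae_inner_ne P.b (-P.halfWidth ā)] with x h0 h1 h2
    have hd := ha.hasDerivAt hP hw hā (x := inner ℝ P.n x) h0 fun h => by
      rcases abs_choice (inner ℝ P.n x) with h' | h' <;> rw [h'] at h
      · exact h1 h
      · exact h2 (by rw [← h, neg_neg]; rfl)
    have h3 := (hd.comp_hasFDerivAt x (innerSL ℝ P.n).hasFDerivAt).hasLineDerivAt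
      (EuclideanSpace.single i (1 : ℝ))
    have e : (P.profileDeriv a (inner ℝ P.n x) • innerSL ℝ P.n) (EuclideanSpace.single i (1 : ℝ)) =
        P.profileDeriv a (inner ℝ P.n x) * P.n i := by
      simp [EuclideanSpace.inner_single_right]
    rw [← e]
    exact h3

/-! ### Existence of the localized response -/

theorem integrableOn_locDisp (P : Problem) (t ā : ℝ) : IntegrableOn (P.locDisp t ā) P.Ω := by
  refine IntegrableOn.add ?_ ?_
  · refine integrableOn_cube_of_continuous P.b P.L ?_
    have h : Continuous fun x : V3 => (P.A.symm P.s).1.mulVec (WithLp.ofLp x) :=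
      Continuous.matrix_mulVec continuous_const (PiLp.continuous_ofLp 2 _)
    exact (PiLp.continuous_toLp 2 _).comp (h.const_smul (P.k ā * P.σc))
  · have hm : Measurable fun x : V3 => (if 0 < inner ℝ P.n x then P.jump t ā else 0) • P.d₀ :=
      (Measurable.ite (isOpen_lt continuous_const (by fun_prop)).measurableSet measurable_const
        measurable_const).smul_const _
    refine Integrable.of_bound hm.aestronglyMeasurable ‖P.jump t ā • P.d₀‖ (ae_of_all _ fun x => ?_)
    split_ifs
    · exact le_rfl
    · simp

theorem exists_isLocalizedResponse (hP : P.Standing)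
    (hw : IntervalIntegrable (fun a => 1 / √(P.w a)) volume 0 1) {t : ℝ} (ht : P.epsE < t) :
    ∃ z : P.State, P.IsLocalizedResponse t z := by
  obtain ⟨ā, hāt⟩ := hP.exists_isMaxDamage ht
  have hā := hāt.mem_Ioc
  have hā' := Ioc_subset_Icc_self hā
  obtain ⟨a, ha⟩ := Standing.exists_isProfile hw hā'
  have hn : ‖P.n‖ = 1 := P.b.norm_eq_one 0
  refine ⟨{
    u := P.locDisp t ā
    p := P.locPlastic t ā
    α := fun x => a (inner ℝ P.n x)
    E := {
      comp := fun i j => (volume.restrict P.Ω).withDensityᵥ (fun _ => (P.locElastic ā).1 i j) +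
        (P.locPlastic t ā).comp i j
      symm := fun i j => by
        rw [(P.locPlastic t ā).symm i j, (P.locElastic ā).2.apply i j] }
    e := fun _ => P.locElastic ā
    g := fun x => P.profileDeriv a (inner ℝ P.n x) • P.n
    u_integrable := P.integrableOn_locDisp t ā
    strain := fun φ hφ i j => ?_
    p_carried := P.locPlastic_carried hP.L_pos t ā
    e_memLp := fun i j => memLp_const _
    decomposition := fun i j => rfl
    α_memLp := ?_
    g_memLp := ?_
    gradient := ha.isWeakGradient hP hw hā' }, ā, a, hāt, ha, EventuallyEq.rfl, rfl, EventuallyEq.rfl⟩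
  -- The strain measure is defined as `e + p`, so the compatibility to check is that it is the
  -- distributional strain of the displacement.
  · rw [P.integral_locDisp t ā hφ, integral_add_locPlastic P t ā (integrable_const _) hφ]
  · refine MemLp.of_bound ((ha.continuous hP hw hā').comp (by fun_prop)).aestronglyMeasurable 1
      (ae_of_all _ fun x => ?_)
    have := ha.mem_unit hā' (inner ℝ P.n x)
    rw [Real.norm_eq_abs, abs_of_nonneg this.1]
    exact this.2
  · refine MemLp.of_bound (C := P.ℓ⁻¹) (((ha.profileDeriv_measurable hP hw hā').comp
      (by fun_prop)).smul_const _).aestronglyMeasurable (ae_of_all _ fun x => ?_)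
    rw [norm_smul, hn, mul_one]
    exact ha.abs_profileDeriv_le hP hā' _

/-! ### The energy of the localized response -/

section Localized

variable {t ā : ℝ} {a : ℝ → ℝ} {z : P.State}

/-- A localized response prescribes `u`, `p` and `α` only. Once `u` and `p` are known, testing the
distributional strain identity determines `e` almost everywhere. -/
theorem localized_elastic (hu : z.u =ᵐ[volume.restrict P.Ω] P.locDisp t ā)
    (hp : z.p = P.locPlastic t ā) : ∀ᵐ x ∂volume.restrict P.Ω, z.e x = P.locElastic ā := by
  have h : ∀ i j, ∀ᵐ x ∂volume.restrict P.Ω, (z.e x).1 i j = (P.locElastic ā).1 i j := by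
    intro i j
    refine ae_eq_of_integral_test P.isOpen_Ω (z.integrable_e i j) (integrable_const _) fun φ hφ => ?_
    have h1 := z.strain φ hφ i j
    rw [z.decomposition i j, hp, integral_add_locPlastic P t ā (z.integrable_e i j) hφ] at h1
    have h2 : ∫ x in P.Ω, (z.u x i * partialD j φ x + z.u x j * partialD i φ x) / 2 =
        ∫ x in P.Ω, (P.locDisp t ā x i * partialD j φ x + P.locDisp t ā x j * partialD i φ x) / 2 :=
      integral_congr_ae (hu.mono fun x hx => by simp only [hx])
    rw [h2, P.integral_locDisp t ā hφ] at h1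
    exact add_right_cancel h1
  filter_upwards [ae_all_iff.2 fun i => ae_all_iff.2 fun j => h i j] with x hx
  ext i j
  exact hx i j

theorem localized_gradient (hP : P.Standing)
    (hw : IntervalIntegrable (fun a => 1 / √(P.w a)) volume 0 1) (hā : ā ∈ Icc (0 : ℝ) 1)
    (ha : P.IsProfile ā a) (hα : z.α =ᵐ[volume.restrict P.Ω] fun x => a (inner ℝ P.n x)) :
    ∀ᵐ x ∂volume.restrict P.Ω, z.g x = P.profileDeriv a (inner ℝ P.n x) • P.n := by
  have h : ∀ i, ∀ᵐ x ∂volume.restrict P.Ω,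
      z.g x i = P.profileDeriv a (inner ℝ P.n x) * P.n i := by
    intro i
    refine ae_eq_of_integral_test P.isOpen_Ω
      ((EuclideanSpace.proj (𝕜 := ℝ) i).integrable_comp z.integrable_g)
      (ha.integrableOn_profileDeriv_mul hP hw hā (integrable_const _)) fun φ hφ => ?_
    have h1 := z.gradient φ hφ i
    have h2 := ha.isWeakGradient hP hw hā φ hφ i
    have h3 : ∫ x in P.Ω, z.α x * partialD i φ x =
        ∫ x in P.Ω, a (inner ℝ P.n x) * partialD i φ x :=
      integral_congr_ae (hα.mono fun x hx => by simp only [hx])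
    rw [h3, h2] at h1
    simpa using (neg_inj.1 h1).symm
  filter_upwards [ae_all_iff.2 h] with x hx
  ext i
  simpa using hx i

theorem localized_preciseRep (hP : P.Standing)
    (hw : IntervalIntegrable (fun a => 1 / √(P.w a)) volume 0 1) (hā : ā ∈ Ioc (0 : ℝ) 1)
    (ha : P.IsProfile ā a) (hα : z.α =ᵐ[volume.restrict P.Ω] fun x => a (inner ℝ P.n x)) :
    ∀ᵐ x ∂midPlaneArea P.b P.L, preciseRep z.α x = ā := by
  filter_upwards [ae_midPlaneArea P.b P.L hP.L_pos] with x hx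
  have hc : Continuous fun x : V3 => a (inner ℝ P.n x) :=
    (ha.continuous hP hw (Ioc_subset_Icc_self hā)).comp (by fun_prop)
  rw [preciseRep_eq_of_continuous P.isOpen_Ω hc hα hx.1, n, hx.2, ha.at_zero hP hw hā]

/-- The elastic strain contributes `k(ā) ε_e`, and the amplitude of the jump is chosen to supply the
rest of `t`. -/
theorem localized_averageStrain (hP : P.Standing)
    (hu : z.u =ᵐ[volume.restrict P.Ω] P.locDisp t ā) (hp : z.p = P.locPlastic t ā) :
    P.HasAverageStrain t z := by
  have hLp := hP.L_pos
  have h1 := z.integral_ddot_e_add P.s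
  have h2 : ∫ x in P.Ω, ddot P.s (z.e x) = P.L ^ 3 * ddot P.s (P.locElastic ā) := by
    rw [integral_congr_ae (g := fun _ => ddot P.s (P.locElastic ā))
      ((localized_elastic hu hp).mono fun x hx => by simp only [hx]), setIntegral_const, Ω,
      volume_real_cube _ _ hLp.le, smul_eq_mul]
  have h3 : ∑ i, ∑ j, P.s.1 i j * z.p.comp i j P.Ω =
      P.L ^ 2 * (P.jump t ā * traction P.s P.n P.d₀) := by
    rw [hp, traction_eq_ddot, ddot, Finset.mul_sum, Finset.mul_sum]
    refine Finset.sum_congr rfl fun i _ => ?_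
    rw [Finset.mul_sum, Finset.mul_sum]
    refine Finset.sum_congr rfl fun j _ => ?_
    rw [P.locPlastic_apply hLp]
    ring
  rw [h2, h3, hP.jump_mul_traction, locElastic, ddot_smul_right, hP.epsE_eq,
    ddot_comm P.s (P.A.symm P.s)] at h1
  rw [HasAverageStrain, ← h1]
  field_simp
  ring

/-- Each lower bound is attained: the strain `e` is the one conjugate to `k(ā) σc s`, the support
function is attained at `σc s`, and the phase field is the profile. -/
theorem localized_energy (hP : P.Standing)
    (hw : IntervalIntegrable (fun a => 1 / √(P.w a)) volume 0 1)
    (hL : 2 * P.ℓ * cStar P.w ≤ P.L) (ht : P.epsE < t) (hā : ā ∈ Ioc (0 : ℝ) 1)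
    (ha : P.IsProfile ā a) (hu : z.u =ᵐ[volume.restrict P.Ω] P.locDisp t ā)
    (hp : z.p = P.locPlastic t ā) (hα : z.α =ᵐ[volume.restrict P.Ω] fun x => a (inner ℝ P.n x)) :
    P.energy z = ENNReal.ofReal (P.redEnergy t ā) := by
  have hā' := Ioc_subset_Icc_self hā
  have hLp := hP.L_pos
  have hl := hP.ℓ_pos
  have hG := hP.Gc_pos
  have hcW := hP.constitutive.cW_pos
  have hσ := hP.σc_pos
  have hk := hP.constitutive.k_nonneg hā'
  have hcomp := hP.compliance_pos
  have hJ := hP.jump_pos ht hā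
  have hτ := hP.traction_pos
  have hn : ‖P.n‖ = 1 := P.b.norm_eq_one 0
  have h1 : ∫⁻ x in P.Ω, ENNReal.ofReal (ddot (P.A (z.e x)) (z.e x) / 2) =
      ENNReal.ofReal (P.L ^ 3 * ((P.k ā * P.σc) ^ 2 * ddot (P.A.symm P.s) P.s / 2)) := by
    have e : ∀ᵐ x ∂volume.restrict P.Ω, ENNReal.ofReal (ddot (P.A (z.e x)) (z.e x) / 2) =
        ENNReal.ofReal ((P.k ā * P.σc) ^ 2 * ddot (P.A.symm P.s) P.s / 2) := by
      filter_upwards [localized_elastic hu hp] with x hx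
      rw [hx, locElastic, map_smul, LinearEquiv.apply_symm_apply, ddot_smul_left, ddot_smul_right,
        ddot_comm P.s]
      congr 1; ring
    rw [lintegral_congr_ae e, lintegral_const, Measure.restrict_apply_univ, Ω, volume_cube,
      ← ENNReal.ofReal_mul hLp.le, ← ENNReal.ofReal_mul (by positivity),
      ← ENNReal.ofReal_mul (by positivity)]
    congr 1; ring
  have h2 := hP.nonlinear_eq hā' hJ (localized_preciseRep hP hw hā ha hα)
  have h3 : ∫⁻ x in P.Ω, ENNReal.ofReal
      (P.Gc / (4 * cW P.w) * (P.w (z.α x) / P.ℓ + P.ℓ * ‖z.g x‖ ^ 2)) =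
      ENNReal.ofReal (P.Gc * P.L ^ 2 / cW P.w * ∫ a in (0 : ℝ)..ā, √(P.w a)) := by
    -- By equipartition the gradient term equals `w(a)/ℓ`, so the prefactor `Gc/(4 c_w)` becomes
    -- `Gc/(2 c_w)`.
    have e : ∀ᵐ x ∂volume.restrict P.Ω, ENNReal.ofReal
        (P.Gc / (4 * cW P.w) * (P.w (z.α x) / P.ℓ + P.ℓ * ‖z.g x‖ ^ 2)) =
        ENNReal.ofReal (P.Gc / (2 * cW P.w) * (P.w (a (inner ℝ P.n x)) / P.ℓ)) := by
      filter_upwards [hα, localized_gradient hP hw hā' ha hα] with x hx hgx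
      rw [hx, hgx, norm_smul, hn, mul_one, Real.norm_eq_abs, sq_abs, IsProfile.profileDeriv_sq, slope,
        div_pow, Real.sq_sqrt (hP.constitutive.w_nonneg (ha.mem_unit hā' _))]
      congr 1
      field_simp
      ring
    have hi : IntegrableOn (fun x => P.Gc / (2 * cW P.w) * (P.w (a (inner ℝ P.n x)) / P.ℓ)) P.Ω :=
      (integrableOn_cube_of_continuous P.b P.L
        ((ha.continuous_w_comp hP hw hā').comp (by fun_prop))).const_mul _
    rw [lintegral_congr_ae e, ← ofReal_integral_eq_lintegral_ofReal hi (ae_of_all _ fun x => ?_)]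
    · congr 1
      rw [integral_const_mul, Ω, n,
        setIntegral_cube_normal P.b P.L hLp.le (fun r => P.w (a r) / P.ℓ),
        ha.integral_w hP hw hā (hP.halfWidth_le hw hL hā')]
      field_simp
    · have := hP.constitutive.w_nonneg (ha.mem_unit hā' (inner ℝ P.n x))
      change 0 ≤ P.Gc / (2 * cW P.w) * (P.w (a (inner ℝ P.n x)) / P.ℓ)
      positivity
  have hInt : 0 ≤ ∫ a in (0 : ℝ)..ā, √(P.w a) :=
    intervalIntegral.integral_nonneg hā.1.le fun x _ => Real.sqrt_nonneg _
  rw [energy, hp, h1, h2, h3, ← ENNReal.ofReal_add (by positivity) (by positivity),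
    ← ENNReal.ofReal_add (by positivity) (by positivity)]
  congr 1
  rw [hP.jump_mul_traction, redEnergy, hP.epsE_eq]
  ring

end Localized

end Problem

end CohesivePF

/-- The integrability hypothesis expresses `c*_w < ∞`; it is stated separately because the
real-valued integral `cStar` would take the default value `0` for a non-integrable function. -/
theorem mainTheorem1 (P : CohesivePF.Problem) (hP : P.Standing)
    (hw : IntervalIntegrable (fun a => 1 / √(P.w a)) MeasureTheory.volume 0 1) :
    0 < CohesivePF.rhoC P.k P.w ∧
    (2 * P.ℓ * CohesivePF.cStar P.w ≤ P.L →
      P.L / P.cohesiveLength ≤ CohesivePF.rhoC P.k P.w →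
      ∀ t : ℝ, P.epsE < t →
        (∃ z : P.State, P.IsLocalizedResponse t z) ∧
        ∀ z : P.State, P.IsLocalizedResponse t z →
          P.HasAverageStrain t z ∧ P.MaxOnMidPlane z ∧ P.energy z < ⊤ ∧
          ∀ z' : P.State, P.HasAverageStrain t z' → P.MaxOnMidPlane z' →
            P.energy z ≤ P.energy z') := by
  refine ⟨hP.constitutive.rhoC_pos hw, fun hL hρ t ht =>
    ⟨CohesivePF.Problem.exists_isLocalizedResponse hP hw ht, ?_⟩⟩
  rintro z ⟨ā, a, hāt, ha, hu, hp, hα⟩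
  have hā := hāt.mem_Ioc
  have hā' := Set.Ioc_subset_Icc_self hā
  have hE := CohesivePF.Problem.localized_energy hP hw hL ht hā ha hu hp hα
  refine ⟨CohesivePF.Problem.localized_averageStrain hP hu hp, ⟨ā, hā', ?_,
    CohesivePF.Problem.localized_preciseRep hP hw hā ha hα⟩, hE ▸ ENNReal.ofReal_lt_top, ?_⟩
  · filter_upwards [hα] with x hx
    rw [hx]
    exact ha.mem_Icc hā' _
  · rintro z' ht' ⟨b, hb, hαb, hΓ⟩
    rw [hE]
    -- The competitor has its own maximum `b`, so the comparison passes through the reduced energy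
    -- at `b`.
    exact (ENNReal.ofReal_le_ofReal (hP.redEnergy_le hρ hāt hb)).trans
      (hP.redEnergy_le_energy hw hL z' hb ht' hαb hΓ)
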